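/- Let $k$ be an algebraically closed field of characteristic $0$ and $n\ge 1$. Let $C$ be the irreducible nodal curve of arithmetic genus $1$ over $k$, with normalization $\pi:\mathbb{P}^1\to C$ such that $\pi(0)=\pi(\infty)$ is the node, where $t=x_1/x_0$ is the coordinate on $\mathbb{P}^1$; let $\omega_C$ be its dualizing sheaf (rational differentials on $\mathbb{P}^1$ that are regular away from $0,\infty$, with at most simple poles and opposite residues at $0$ and $\infty$). Let $(\sigma,\Gamma_1,\Gamma_2)$ be associative Belavin–Drinfeld data: with $\sigma_0=(1\,2\,\dots\,n)$, $\sigma\in S_n$ is an $n$-cycle and $\Gamma_1,\Gamma_2$ are proper subsets of $\{(i,\sigma_0(i)) : 1\le i\le n\}$ with $(\sigma\times\sigma)(\Gamma_1)=\Gamma_2$. Assume $(n,1)\notin\Gamma_1$ and choose $m\in\{1,\dots,n\}$ with $(\sigma_0^{-1}(m),m)\notin\Gamma_2$. For $a=1,2$ let $\Pi_a$ be the set of pairs $(i,\sigma_0^r(i))$, $r\ge 1$, such that $(\sigma_0^{s}(i),\sigma_0^{s+1}(i))\in\Gamma_a$ for $0\le s<r$. Let $S_m$ be the set of pairs $(i,j)$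 with $i<j<m$, or $m\le i<j$, or $i\ge m>j$. Let $I\subset \mathrm{Mat}_n(k)\oplus\mathrm{Mat}_n(k)$ be the subalgebra of pairs $(a,b)$ such that - $a_{ij}=0$ whenever $j<i$ and $(j,i)\notin\Pi_1$; - $b_{ij}=0$ whenever $(i,j)\in S_m$ and $(i,j)\notin\Pi_2$; - $a_{ij}=b_{\sigma(i)\sigma(j)}$ and $a_{ji}=b_{\sigma(j)\sigma(i)}$ whenever $i=j$ or $(i,j)\in\Pi_1$. Put $\epsilon_i=0$ for $i<m$, $\epsilon_i=1$ for $i\ge m$, and $\mathcal{V}=\bigoplus_{i=1}^n\mathcal{O}_{\mathbb{P}^1}(\epsilon_i)$, with the fibers $\mathcal{V}|_0$ and $\mathcal{V}|_\infty$ identified with $k^n$ by means of the trivializations $x_0$ and $x_1$ of $\mathcal{O}(1)$ at $0$ and at $\infty$. Let $\mathcal{A}\subset\pi_*\underline{\mathrm{End}}(\mathcal{V})$ be the sheaf of $\mathcal{O}_C$-algebras consisting of the sections $a$ with $(a(0),a(\infty))\in I$. Then $h^0(C,\mathcal{A})=1$, and $\mathcal{A}$ is a symmetric spherical order over $C$ with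 center $\mathcal{O}_C$. That is: $\mathcal{A}$ is a torsion free coherent sheaf of $\mathcal{O}_C$-algebras whose stalk at the generic point is a matrix algebra over the field of rational functions of $C$; $H^0(C,\mathcal{O}_C)=k$; there is a nonzero morphism of $\mathcal{O}_C$-modules $\tau:\mathcal{A}\to\omega_C$, unique up to rescaling by elements of $k$, it satisfies $\tau(xy)=\tau(yx)$, and the induced morphism $\mathcal{A}\to\underline{\mathrm{Hom}}(\mathcal{A},\omega_C)$, $y\mapsto(x\mapsto\tau(xy))$, is an isomorphism; and the center of $\mathcal{A}$ is $\mathcal{O}_C$. -/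

import Mathlib

open CategoryTheory Opposite TopologicalSpace AlgebraicGeometry

universe u

noncomputable section

/-! ### Sheaves of modules and algebras on a ringed space -/

namespace SphericalOrder

/-- The structure sheaf of a ringed space, as a sheaf of (not necessarily commutative) rings. -/
def ringSheaf (C : RingedSpace.{u}) : TopCat.Sheaf RingCat.{u} C.carrier :=
  ⟨C.presheaf ⋙ forget₂ CommRingCat RingCat,
    (CategoryTheory.GrothendieckTopology.HasSheafCompose.isSheaf
      (J := Opens.grothendieckTopology C.carrier) (F := forget₂ CommRingCat RingCat) C.presheaf C.IsSheaf)⟩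

/-- Sheaves of `𝒪_C`-modules. -/
abbrev Modules (C : RingedSpace.{u}) := SheafOfModules.{u} (ringSheaf C)

/-- Sections of the structure sheaf over `U`. -/
abbrev Fn (C : RingedSpace.{u}) (U : Opens C) : Type u := C.presheaf.obj (op U)

/-- Restriction of functions. -/
abbrev Fn.res {C : RingedSpace.{u}} {U V : Opens C} (h : V ≤ U) : Fn C U →+* Fn C V :=
  (C.presheaf.map (homOfLE h).op).hom

/-- Sections of a sheaf of modules over `U`. -/
def Sec {C : RingedSpace.{u}} (M : Modules C) (U : Opens C) : Type u := M.val.obj (op U)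

instance {C : RingedSpace.{u}} (M : Modules C) (U : Opens C) : AddCommGroup (Sec M U) :=
  inferInstanceAs (AddCommGroup (M.val.obj (op U)))

instance {C : RingedSpace.{u}} (M : Modules C) (U : Opens C) : Module (Fn C U) (Sec M U) :=
  (M.val.obj (op U)).isModule

/-- Restriction of sections. -/
def Sec.res {C : RingedSpace.{u}} {M : Modules C} {U V : Opens C} (h : V ≤ U) :
    Sec M U →+ Sec M V :=
  (M.val.presheaf.map (homOfLE h).op).hom

/-- A morphism of sheaves of modules, on sections over `U`. -/
def Sec.map {C : RingedSpace.{u}} {M N : Modules C} (f : SheafOfModules.Hom M N) (U : Opens C) :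
    Sec M U →ₗ[Fn C U] Sec N U :=
  (f.val.app (op U)).hom

/-- A sheaf of `𝒪_C`-algebras: a sheaf of rings with a central morphism from `𝒪_C`. -/
structure AlgebraSheaf (C : RingedSpace.{u}) where
  sheaf : TopCat.Sheaf RingCat.{u} C.carrier
  unit : ringSheaf C ⟶ sheaf
  central : ∀ (U : Opens C) (f : (ringSheaf C).obj.obj (op U)) (a : sheaf.obj.obj (op U)),
    Commute ((unit.hom.app (op U)).hom f) a


namespace AlgebraSheaf

variable {C : RingedSpace.{u}} (A : AlgebraSheaf C)

/-- Sections of a sheaf of algebras over `U`. -/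
abbrev Sections (U : Opens C) : Type u := A.sheaf.obj.obj (op U)

/-- Restriction of sections. -/
abbrev res {U V : Opens C} (h : V ≤ U) : A.Sections U →+* A.Sections V :=
  (A.sheaf.obj.map (homOfLE h).op).hom

/-- The structure map `𝒪_C(U) → 𝒜(U)`. -/
def unitMap (U : Opens C) : Fn C U →+* A.Sections U :=
  (A.unit.hom.app (op U)).hom

/-- The sheaf of `𝒪_C`-modules underlying a sheaf of algebras. -/
def toModules : Modules C :=
  letI (U : (Opens C)ᵒᵖ) : Module ((ringSheaf C).obj.obj U)
      ((A.sheaf.obj ⋙ forget₂ RingCat AddCommGrpCat).obj U) :=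
    Module.compHom (A.sheaf.obj.obj U) (A.unit.hom.app U).hom
  ⟨.ofPresheaf (A.sheaf.obj ⋙ forget₂ RingCat AddCommGrpCat) (by
      intro U V f r m
      have h := congrArg (fun g => g.hom r) (A.unit.hom.naturality f)
      refine (map_mul (A.sheaf.obj.map f).hom _ _).trans ?_
      exact congrArg (· * (A.sheaf.obj.map f).hom m) h.symm),
    CategoryTheory.GrothendieckTopology.HasSheafCompose.isSheaf
      (J := Opens.grothendieckTopology C.carrier)
      (F := forget₂ RingCat AddCommGrpCat) A.sheaf.obj A.sheaf.property⟩

/-- A section of the algebra, viewed as a section of the underlying sheaf of modules. -/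
def toSec {U : Opens C} (a : A.Sections U) : Sec A.toModules U := a


/-- `h⁰(𝒜)`: the dimension of the space of global sections over `k`, where `C` is a ringed
space over `k` through `s : k → 𝒪_C(C)`. -/
def h0 {k : Type u} [Field k] (s : k →+* Fn C ⊤) : ℕ :=
  letI : Module k (A.Sections ⊤) := Module.compHom _ ((A.unitMap ⊤).comp s)
  Module.finrank k (A.Sections ⊤)

end AlgebraSheaf

section

variable {C : RingedSpace.{u}}

/-- The finite family `s` of sections over `U` generates the sheaf `M|_U`. -/
def Generates (M : Modules C) {U : Opens C} {n : ℕ} (s : Fin n → Sec M U) : Prop :=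
  ∀ (V : Opens C) (hV : V ≤ U) (x : Sec M V), ∀ y ∈ V, ∃ (W : Opens C) (hW : W ≤ V), y ∈ W ∧
    Sec.res hW x ∈ Submodule.span (Fn C W) (Set.range fun i => Sec.res (hW.trans hV) (s i))

/-- `M` is of finite type. -/
def IsFiniteType (M : Modules C) : Prop :=
  ∀ y : C, ∃ (U : Opens C) (n : ℕ) (s : Fin n → Sec M U), y ∈ U ∧ Generates M s

/-- `r` is a family of relations over `U` between the sections `s i`, and generates the sheaf
of all relations between them, i.e. the kernel of `𝒪_U ^ n → M|_U`. -/
def GeneratesRelations (M : Modules C) {U : Opens C} {n m : ℕ} (s : Fin n → Sec M U)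
    (r : Fin m → Fin n → Fn C U) : Prop :=
  (∀ j, ∑ i, r j i • s i = 0) ∧
  ∀ (V : Opens C) (hV : V ≤ U) (c : Fin n → Fn C V), ∑ i, c i • Sec.res hV (s i) = 0 →
    ∀ y ∈ V, ∃ (W : Opens C) (hW : W ≤ V), y ∈ W ∧
      (fun i => Fn.res hW (c i)) ∈
        Submodule.span (Fn C W) (Set.range fun j i => Fn.res (hW.trans hV) (r j i))

/-- `M` is coherent: it is of finite type, and for every open `U` the kernel of every morphism
`𝒪_U ^ n → M|_U` is of finite type. -/
def IsCoherent (M : Modules C) : Prop :=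
  IsFiniteType M ∧
  ∀ (U : Opens C) (n : ℕ) (s : Fin n → Sec M U), ∀ y ∈ U, ∃ (V : Opens C) (hV : V ≤ U) (m : ℕ)
    (r : Fin m → Fin n → Fn C V), y ∈ V ∧ GeneratesRelations M (fun i => Sec.res hV (s i)) r

/-- `M` is torsion free (for an integral `C`). -/
def IsTorsionFree (M : Modules C) : Prop :=
  ∀ (U : Opens C) (f : Fn C U) (x : Sec M U), f • x = 0 → f = 0 ∨ x = 0

/-- A section over `U` of the sheaf `ℋom(M, N)`, i.e. a morphism `M|_U → N|_U`. -/
structure LocalHom (M N : Modules C) (U : Opens C) where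
  app : ∀ V : Opens C, V ≤ U → (Sec M V →ₗ[Fn C V] Sec N V)
  naturality : ∀ (V W : Opens C) (hV : V ≤ U) (hW : W ≤ V) (x : Sec M V),
    app W (hW.trans hV) (Sec.res hW x) = Sec.res hW (app V hV x)

/-- An order over an integral curve `C`: a torsion free coherent sheaf of `𝒪_C`-algebras whose
stalk at the generic point `η` is a matrix algebra over the field of rational functions
`𝒪_{C,η}`. -/
structure IsOrder (A : AlgebraSheaf C) : Prop where
  coherent : IsCoherent A.toModules
  torsionFree : IsTorsionFree A.toModules
  generic : ∃ η : C, IsGenericPoint η Set.univ ∧ IsField (C.presheaf.stalk η) ∧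
    ∃ (N : ℕ) (e : (TopCat.Presheaf.stalk A.sheaf.obj η : RingCat.{u}) ≃+*
        Matrix (Fin N) (Fin N) (C.presheaf.stalk η)), 0 < N ∧
      ∀ (U : Opens C) (hU : η ∈ U) (f : Fn C U),
        e ((TopCat.Presheaf.germ A.sheaf.obj U η hU).hom (A.unitMap U f)) =
          Matrix.scalar (Fin N) ((C.presheaf.germ U η hU).hom f)

/-- The morphism `ν : 𝒜 → ℋom(𝒜, ω)`, `y ↦ (x ↦ τ(xy))`, is an isomorphism of sheaves. -/
def NuIsIso (A : AlgebraSheaf C) {ω : Modules C} (τ : SheafOfModules.Hom A.toModules ω) : Prop :=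
  ∀ (U : Opens C) (φ : LocalHom A.toModules ω U), ∃! y : A.Sections U,
    ∀ (V : Opens C) (hV : V ≤ U) (x : A.Sections V),
      φ.app V hV (A.toSec x) = Sec.map τ V (A.toSec (x * A.res hV y))

/-- `𝒜` is a symmetric spherical order over the curve `C` over `k` with dualizing sheaf `ω`:
it is an order over `C`, where `H⁰(C, 𝒪_C) = k`; there is a nonzero morphism of `𝒪_C`-modules
`τ : 𝒜 → ω`, unique up to rescaling; the induced morphism `ν` is an isomorphism; and
`τ(xy) = τ(yx)`. -/
structure IsSymmetricSphericalOrder {k : Type u} [Field k] (s : k →+* Fn C ⊤) (ω : Modules C)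
    (A : AlgebraSheaf C) : Prop where
  isOrder : IsOrder A
  constants : Function.Bijective s
  spherical : ∃ τ : SheafOfModules.Hom A.toModules ω,
    (∃ (U : Opens C) (x : Sec A.toModules U), Sec.map τ U x ≠ 0) ∧
    (∀ τ' : SheafOfModules.Hom A.toModules ω, ∃ c : k, ∀ (U : Opens C) (x : Sec A.toModules U),
      Sec.map τ' U x = Fn.res (le_top : U ≤ ⊤) (s c) • Sec.map τ U x) ∧
    NuIsIso A τ ∧
    ∀ (U : Opens C) (x y : A.Sections U),
      Sec.map τ U (A.toSec (x * y)) = Sec.map τ U (A.toSec (y * x))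

/-- The center of `𝒜` is `𝒪_C`: the structure morphism is an isomorphism of `𝒪_C` onto the
subsheaf of those sections which commute with all sections over all smaller open sets. -/
def CenterIsStructureSheaf (A : AlgebraSheaf C) : Prop :=
  ∀ (U : Opens C), Function.Injective (A.unitMap U) ∧ Set.range (A.unitMap U) =
    {z | ∀ (V : Opens C) (hV : V ≤ U) (a : A.Sections V), A.res hV z * a = a * A.res hV z}

end

end SphericalOrder

/-! ### The nodal curve -/

namespace NodalCurve

theorem transcendental_X_inv (k : Type u) [Field k] :
    Function.Injective (Polynomial.aeval (R := k) (RatFunc.X : RatFunc k)⁻¹) := by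
  rw [← transcendental_iff_injective, Transcendental, IsAlgebraic.inv_iff]
  exact RatFunc.transcendental_X

/-- The substitution `t ↦ 1/t` on rational functions `k(t)`. -/
def swap (k : Type u) [Field k] : RatFunc k →ₐ[k] RatFunc k :=
  RatFunc.liftAlgHom (Polynomial.aeval (RatFunc.X : RatFunc k)⁻¹)
    (nonZeroDivisors_le_comap_nonZeroDivisors_of_injective _ (transcendental_X_inv k))

variable {k : Type u} [Field k]

theorem swap_X : swap k RatFunc.X = RatFunc.X⁻¹ := by
  have := RatFunc.liftAlgHom_apply (L := RatFunc k) (S := k)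
    (Polynomial.aeval (RatFunc.X : RatFunc k)⁻¹)
    (nonZeroDivisors_le_comap_nonZeroDivisors_of_injective _ (transcendental_X_inv k)) RatFunc.X
  simpa [swap] using this

/-- The rational function `f` is regular at the point `a` of the affine line. -/
def RegularAt (a : k) (f : RatFunc k) : Prop := f.denom.eval a ≠ 0

/-- The value of `f` at `0` (meaningful if `f` is regular at `0`). -/
def val0 (f : RatFunc k) : k := f.eval (RingHom.id k) 0

theorem RegularAt.add {a : k} {f g : RatFunc k} (hf : RegularAt a f) (hg : RegularAt a g) :
    RegularAt a (f + g) := fun h =>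
  (mul_ne_zero hf hg) (by
    rw [← Polynomial.eval_mul]
    exact Polynomial.eval_eq_zero_of_dvd_of_eval_eq_zero (RatFunc.denom_add_dvd f g) h)

theorem RegularAt.mul {a : k} {f g : RatFunc k} (hf : RegularAt a f) (hg : RegularAt a g) :
    RegularAt a (f * g) := fun h =>
  (mul_ne_zero hf hg) (by
    rw [← Polynomial.eval_mul]
    exact Polynomial.eval_eq_zero_of_dvd_of_eval_eq_zero (RatFunc.denom_mul_dvd f g) h)

theorem RegularAt.C (a c : k) : RegularAt a (RatFunc.C c) := by simp [RegularAt]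

theorem RegularAt.zero (a : k) : RegularAt a 0 := by simp [RegularAt]

theorem RegularAt.one (a : k) : RegularAt a 1 := by simp [RegularAt]

theorem RegularAt.neg {a : k} {f : RatFunc k} (hf : RegularAt a f) : RegularAt a (-f) := by
  have : -f = RatFunc.C (-1) * f := by simp
  rw [this]; exact (RegularAt.C a _).mul hf

theorem RegularAt.sum {ι : Type*} {s : Finset ι} {a : k} {f : ι → RatFunc k}
    (hf : ∀ i ∈ s, RegularAt a (f i)) : RegularAt a (∑ i ∈ s, f i) :=
  Finset.sum_induction _ _ (fun _ _ => RegularAt.add) (RegularAt.zero a) hf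

theorem val0_add {f g : RatFunc k} (hf : RegularAt 0 f) (hg : RegularAt 0 g) :
    val0 (f + g) = val0 f + val0 g := RatFunc.eval_add (RingHom.id k) 0 hf hg

theorem val0_mul {f g : RatFunc k} (hf : RegularAt 0 f) (hg : RegularAt 0 g) :
    val0 (f * g) = val0 f * val0 g := RatFunc.eval_mul (RingHom.id k) 0 hf hg

theorem val0_C (c : k) : val0 (RatFunc.C c) = c := by simp [val0]

theorem val0_zero : val0 (0 : RatFunc k) = 0 := by simp [val0]

theorem val0_one : val0 (1 : RatFunc k) = 1 := by simp [val0]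

theorem val0_neg {f : RatFunc k} (hf : RegularAt 0 f) : val0 (-f) = -val0 f := by
  have : -f = RatFunc.C (-1) * f := by simp
  rw [this, val0_mul (RegularAt.C 0 _) hf, val0_C]; ring

theorem val0_sum {ι : Type*} (s : Finset ι) {f : ι → RatFunc k}
    (hf : ∀ i, RegularAt 0 (f i)) : val0 (∑ i ∈ s, f i) = ∑ i ∈ s, val0 (f i) := by
  classical
  induction s using Finset.induction_on with
  | empty => simp [val0_zero]
  | insert a s ha ih =>
    rw [Finset.sum_insert ha, Finset.sum_insert ha,
      val0_add (hf a) (RegularAt.sum fun i _ => hf i), ih]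

/-- The points of the projective line over an algebraically closed field: the generic point,
the points `t = a` with `a ∈ k`, and `t = ∞`. -/
inductive P1 (k : Type u) : Type u
  | generic : P1 k
  | finite (a : k) : P1 k
  | infty : P1 k

/-- The points of the nodal curve: the generic point, the node, and the smooth points `t = a`
with `a ≠ 0`. -/
inductive Point (k : Type u) [Field k] : Type u
  | generic : Point k
  | node : Point k
  | smooth (a : kˣ) : Point k

open Classical in
/-- The normalization map `π : ℙ¹ → C`, which glues `0` and `∞` to the node. -/
def proj : P1 k → Point k
  | .generic => .generic
  | .finite a => if h : a = 0 then .node else .smooth (Units.mk0 a h)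
  | .infty => .node

/-- The Zariski topology: a nonempty set is open if it contains the generic point and its
complement is finite. -/
instance : TopologicalSpace (Point k) where
  IsOpen U := U.Nonempty → Point.generic ∈ U ∧ Uᶜ.Finite
  isOpen_univ := fun _ => by simp
  isOpen_inter U V hU hV := by
    rintro ⟨x, hxU, hxV⟩
    obtain ⟨h1, h2⟩ := hU ⟨x, hxU⟩
    obtain ⟨h3, h4⟩ := hV ⟨x, hxV⟩
    exact ⟨⟨h1, h3⟩, by rw [Set.compl_inter]; exact h2.union h4⟩
  isOpen_sUnion S hS := by
    rintro ⟨x, U, hU, hx⟩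
    obtain ⟨h1, h2⟩ := hS U hU ⟨x, hx⟩
    exact ⟨⟨U, hU, h1⟩, h2.subset (Set.compl_subset_compl.2 (Set.subset_sUnion_of_mem hU))⟩

/-- Rational sections of `𝒪(d)` on `ℙ¹` are identified with rational functions of
`t = x₁ / x₀` by means of the trivialization `x₀ ^ d` away from `∞`. This is the condition that
the rational section given by `f` is regular at `p`; near `∞` the trivialization is `x₁ ^ d`. -/
def IsSectionAt (d : ℤ) : P1 k → RatFunc k → Prop
  | .generic, _ => True
  | .finite a, f => RegularAt a f
  | .infty, f => RegularAt 0 (swap k (RatFunc.X ^ (-d) * f))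

/-- The value at `∞` of the section of `𝒪(d)` given by `f`, with respect to the trivialization
of `𝒪(d)|_∞` by `x₁ ^ d`. -/
def valInfty (d : ℤ) (f : RatFunc k) : k := val0 (swap k (RatFunc.X ^ (-d) * f))

theorem IsSectionAt.add {d : ℤ} {p : P1 k} {f g : RatFunc k} (hf : IsSectionAt d p f)
    (hg : IsSectionAt d p g) : IsSectionAt d p (f + g) := by
  cases p with
  | generic => trivial
  | finite a => exact RegularAt.add hf hg
  | infty =>
    simp only [IsSectionAt, mul_add, map_add] at *
    exact RegularAt.add hf hg

theorem twist_mul (d e : ℤ) (f g : RatFunc k) : swap k (RatFunc.X ^ (-(d + e)) * (f * g)) =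
    swap k (RatFunc.X ^ (-d) * f) * swap k (RatFunc.X ^ (-e) * g) := by
  rw [← map_mul, neg_add, zpow_add₀ RatFunc.X_ne_zero]
  congr 1; ring

theorem IsSectionAt.mul {d e : ℤ} {p : P1 k} {f g : RatFunc k} (hf : IsSectionAt d p f)
    (hg : IsSectionAt e p g) : IsSectionAt (d + e) p (f * g) := by
  cases p with
  | generic => trivial
  | finite a => exact RegularAt.mul hf hg
  | infty =>
    simp only [IsSectionAt] at *
    rw [twist_mul]
    exact RegularAt.mul hf hg

theorem IsSectionAt.neg {d : ℤ} {p : P1 k} {f : RatFunc k} (hf : IsSectionAt d p f) :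
    IsSectionAt d p (-f) := by
  cases p with
  | generic => trivial
  | finite a => exact RegularAt.neg hf
  | infty =>
    simp only [IsSectionAt, mul_neg, map_neg] at *
    exact RegularAt.neg hf

theorem IsSectionAt.zero (d : ℤ) (p : P1 k) : IsSectionAt d p 0 := by
  cases p <;> simp [IsSectionAt, RegularAt.zero]

theorem IsSectionAt.C (p : P1 k) (c : k) : IsSectionAt 0 p (RatFunc.C c) := by
  cases p with
  | generic => trivial
  | finite a => exact RegularAt.C a c
  | infty =>
    have : swap k (RatFunc.C c) = RatFunc.C c := (swap k).commutes c
    simpa [IsSectionAt, this] using RegularAt.C 0 c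

theorem IsSectionAt.sum {ι : Type*} {s : Finset ι} {d : ℤ} {p : P1 k} {f : ι → RatFunc k}
    (hf : ∀ i ∈ s, IsSectionAt d p (f i)) : IsSectionAt d p (∑ i ∈ s, f i) :=
  Finset.sum_induction _ _ (fun _ _ => IsSectionAt.add) (IsSectionAt.zero d p) hf

theorem valInfty_add {d : ℤ} {f g : RatFunc k} (hf : IsSectionAt d .infty f)
    (hg : IsSectionAt d .infty g) : valInfty d (f + g) = valInfty d f + valInfty d g := by
  simp only [valInfty, mul_add, map_add]
  exact val0_add hf hg

theorem valInfty_mul {d e : ℤ} {f g : RatFunc k} (hf : IsSectionAt d .infty f)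
    (hg : IsSectionAt e .infty g) :
    valInfty (d + e) (f * g) = valInfty d f * valInfty e g := by
  simp only [valInfty]
  rw [twist_mul]
  exact val0_mul hf hg

theorem valInfty_neg {d : ℤ} {f : RatFunc k} (hf : IsSectionAt d .infty f) :
    valInfty d (-f) = -valInfty d f := by
  simp only [valInfty, mul_neg, map_neg]
  exact val0_neg hf

theorem valInfty_zero (d : ℤ) : valInfty d (0 : RatFunc k) = 0 := by
  simp [valInfty, val0_zero]

theorem valInfty_C (c : k) : valInfty 0 (RatFunc.C c) = c := by
  have : swap k (RatFunc.C c) = RatFunc.C c := (swap k).commutes c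
  simp [valInfty, this, val0_C]

theorem valInfty_sum {ι : Type*} (s : Finset ι) {d : ℤ} {f : ι → RatFunc k}
    (hf : ∀ i, IsSectionAt d .infty (f i)) :
    valInfty d (∑ i ∈ s, f i) = ∑ i ∈ s, valInfty d (f i) := by
  simp only [valInfty, Finset.mul_sum, map_sum]
  exact val0_sum s hf

theorem proj_zero : proj (P1.finite (0 : k)) = Point.node := by simp [proj]

/-- The local ring `𝒪_{C,x}`, as a subring of the field of rational functions: the functions
regular at all points of `π⁻¹(x)`, and with equal values at `0` and `∞` if `x` is the node. -/
def localRing (x : Point k) : Subring (RatFunc k) where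
  carrier := {f | (∀ p, proj p = x → IsSectionAt 0 p f) ∧ (x = .node → val0 f = valInfty 0 f)}
  zero_mem' := ⟨fun p _ => .zero 0 p, fun _ => by rw [val0_zero, valInfty_zero]⟩
  one_mem' := by
    rw [← map_one RatFunc.C]
    exact ⟨fun p _ => .C p 1, fun _ => by rw [val0_C, valInfty_C]⟩
  add_mem' := by
    rintro f g ⟨hf, hf'⟩ ⟨hg, hg'⟩
    refine ⟨fun p hp => (hf p hp).add (hg p hp), fun hx => ?_⟩
    subst hx
    rw [val0_add (hf _ proj_zero) (hg _ proj_zero), valInfty_add (hf _ rfl) (hg _ rfl),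
      hf' rfl, hg' rfl]
  mul_mem' := by
    rintro f g ⟨hf, hf'⟩ ⟨hg, hg'⟩
    refine ⟨fun p hp => (hf p hp).mul (hg p hp), fun hx => ?_⟩
    subst hx
    have := valInfty_mul (hf _ rfl) (hg _ rfl)
    rw [add_zero] at this
    rw [val0_mul (hf _ proj_zero) (hg _ proj_zero), this, hf' rfl, hg' rfl]
  neg_mem' := by
    rintro f ⟨hf, hf'⟩
    refine ⟨fun p hp => (hf p hp).neg, fun hx => ?_⟩
    subst hx
    rw [val0_neg (hf _ proj_zero), valInfty_neg (hf _ rfl), hf' rfl]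

end NodalCurve

/-! ### Subsheaves of constant sheaves -/

namespace StalkwiseSheaf

variable {X : TopCat.{u}}

/-- Given a subset `S x` of `R` for each point `x`, the condition on a function on an open set to
be a section of the constant sheaf `R` (i.e. to be locally constant) with germ at `x` in `S x`. -/
def pred {R : Type u} (S : X → Set R) : TopCat.LocalPredicate (fun _ : X => R) where
  pred {U} f := IsLocallyConstant f ∧ ∀ x : U, f x ∈ S x.1
  res {_ _} i _ h := ⟨h.1.comp_continuous (Opens.isOpenEmbedding_of_le i.le).continuous,
    fun x => h.2 (i x)⟩
  locality {U} f w := by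
    refine ⟨?_, fun x => ?_⟩
    · rw [IsLocallyConstant.iff_exists_open]
      intro x
      obtain ⟨V, hx, i, h, -⟩ := w x
      obtain ⟨W, hW, hxW, hc⟩ := h.exists_open ⟨x.1, hx⟩
      refine ⟨Set.inclusion (leOfHom i) '' W,
        (Opens.isOpenEmbedding_of_le (leOfHom i)).isOpenMap W hW, ⟨⟨x.1, hx⟩, hxW, rfl⟩, ?_⟩
      rintro _ ⟨y, hy, rfl⟩
      exact hc y hy
    · obtain ⟨V, hx, i, -, h⟩ := w x
      exact h ⟨x.1, hx⟩

/-- The sections over `U` with germs in the additive subgroups `S x`. -/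
def addSections {M : Type u} [AddCommGroup M] (S : X → AddSubgroup M) (U : Opens X) :
    AddSubgroup (U → M) where
  carrier := {f | (pred fun x => (S x : Set M)).pred f}
  zero_mem' := ⟨IsLocallyConstant.const 0, fun x => (S x).zero_mem⟩
  add_mem' hf hg := ⟨hf.1.add hg.1, fun x => (S x).add_mem (hf.2 x) (hg.2 x)⟩
  neg_mem' hf := ⟨hf.1.neg, fun x => (S x).neg_mem (hf.2 x)⟩

/-- The sections over `U` with germs in the subrings `S x`. -/
def ringSections {R : Type u} [Ring R] (S : X → Subring R) (U : Opens X) : Subring (U → R) where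
  carrier := {f | (pred fun x => (S x : Set R)).pred f}
  zero_mem' := ⟨IsLocallyConstant.const 0, fun x => (S x).zero_mem⟩
  one_mem' := ⟨IsLocallyConstant.const 1, fun x => (S x).one_mem⟩
  add_mem' hf hg := ⟨hf.1.add hg.1, fun x => (S x).add_mem (hf.2 x) (hg.2 x)⟩
  mul_mem' hf hg := ⟨hf.1.mul hg.1, fun x => (S x).mul_mem (hf.2 x) (hg.2 x)⟩
  neg_mem' hf := ⟨hf.1.neg, fun x => (S x).neg_mem (hf.2 x)⟩

/-- Restriction of sections. -/
def ringRes {R : Type u} [Ring R] (S : X → Subring R) {U V : Opens X} (i : V ⟶ U) :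
    ringSections S U →+* ringSections S V where
  toFun f := ⟨fun x => f.1 (i x), (pred fun x => (S x : Set R)).res i f.1 f.2⟩
  map_zero' := rfl
  map_one' := rfl
  map_add' _ _ := rfl
  map_mul' _ _ := rfl

/-- Restriction of sections. -/
def addRes {M : Type u} [AddCommGroup M] (S : X → AddSubgroup M) {U V : Opens X} (i : V ⟶ U) :
    addSections S U →+ addSections S V where
  toFun f := ⟨fun x => f.1 (i x), (pred fun x => (S x : Set M)).res i f.1 f.2⟩
  map_zero' := rfl
  map_add' _ _ := rfl

/-- The subsheaf of the constant sheaf `R` with stalks `S x`, for a commutative ring `R`. -/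
def commRingPresheaf {R : Type u} [CommRing R] (S : X → Subring R) :
    TopCat.Presheaf CommRingCat.{u} X where
  obj U := CommRingCat.of (ringSections S U.unop)
  map i := CommRingCat.ofHom (ringRes S i.unop)

/-- The subsheaf of the constant sheaf `R` with stalks `S x`, for a ring `R`. -/
def ringPresheaf {R : Type u} [Ring R] (S : X → Subring R) :
    TopCat.Presheaf RingCat.{u} X where
  obj U := RingCat.of (ringSections S U.unop)
  map i := RingCat.ofHom (ringRes S i.unop)

/-- The subsheaf of the constant sheaf `M` with stalks `S x`, for an abelian group `M`. -/
def addPresheaf {M : Type u} [AddCommGroup M] (S : X → AddSubgroup M) :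
    TopCat.Presheaf AddCommGrpCat.{u} X where
  obj U := AddCommGrpCat.of (addSections S U.unop)
  map i := AddCommGrpCat.ofHom (addRes S i.unop)

theorem commRingPresheaf_isSheaf {R : Type u} [CommRing R] (S : X → Subring R) :
    (commRingPresheaf S).IsSheaf :=
  (TopCat.Presheaf.isSheaf_iff_isSheaf_comp (forget CommRingCat) _).2
    (TopCat.Presheaf.isSheaf_of_iso
      (NatIso.ofComponents (fun _ => Iso.refl _) : _ ≅ commRingPresheaf S ⋙ forget CommRingCat)
      (TopCat.subsheafToTypes (pred fun x => (S x : Set R))).property)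

theorem ringPresheaf_isSheaf {R : Type u} [Ring R] (S : X → Subring R) :
    (ringPresheaf S).IsSheaf :=
  (TopCat.Presheaf.isSheaf_iff_isSheaf_comp (forget RingCat) _).2
    (TopCat.Presheaf.isSheaf_of_iso
      (NatIso.ofComponents (fun _ => Iso.refl _) : _ ≅ ringPresheaf S ⋙ forget RingCat)
      (TopCat.subsheafToTypes (pred fun x => (S x : Set R))).property)

theorem addPresheaf_isSheaf {M : Type u} [AddCommGroup M] (S : X → AddSubgroup M) :
    (addPresheaf S).IsSheaf :=
  (TopCat.Presheaf.isSheaf_iff_isSheaf_comp (forget AddCommGrpCat) _).2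
    (TopCat.Presheaf.isSheaf_of_iso
      (NatIso.ofComponents (fun _ => Iso.refl _) : _ ≅ addPresheaf S ⋙ forget AddCommGrpCat)
      (TopCat.subsheafToTypes (pred fun x => (S x : Set M))).property)

end StalkwiseSheaf

namespace NodalCurve

open SphericalOrder StalkwiseSheaf

/-- The irreducible nodal curve `C` of arithmetic genus `1` over an algebraically closed field
`k`, as a ringed space: `ℙ¹` with the points `0` and `∞` glued to a node. A section of `𝒪_C` over a
nonempty open `U` is a rational function in `𝒪_{C,x}` for all `x ∈ U` (since `C` is irreducible,
a locally constant function on `U` is constant). -/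
def nodalCurve (k : Type u) [Field k] : RingedSpace.{u} where
  carrier := TopCat.of (Point k)
  presheaf := commRingPresheaf (X := TopCat.of (Point k)) localRing
  IsSheaf := commRingPresheaf_isSheaf (X := TopCat.of (Point k)) localRing

variable {k : Type u} [Field k]

theorem C_mem_localRing (c : k) (x : Point k) : RatFunc.C c ∈ localRing x :=
  ⟨fun p _ => .C p c, fun _ => by rw [val0_C, valInfty_C]⟩

/-- The structure of a `k`-space: scalars are constant functions. -/
def scalars (k : Type u) [Field k] : k →+* Fn (nodalCurve k) ⊤ :=
  RingHom.codRestrict ((Pi.constRingHom _ (RatFunc k)).comp RatFunc.C)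
    (ringSections (X := TopCat.of (Point k)) localRing ⊤)
    (fun c => ⟨IsLocallyConstant.const _, fun x => C_mem_localRing c x.1⟩)

/-- The coefficient with respect to `ds`, `s = 1/t`, of the differential `f dt`. -/
def coeffInfty (f : RatFunc k) : RatFunc k := -(swap k f * RatFunc.X ^ (-2 : ℤ))

/-- The stalk of the dualizing sheaf `ω_C`; the rational differential `f dt` is represented by `f`.
At a smooth point `f dt` has to be regular. At the node it has to have at most simple poles at the
two preimages `0` and `∞`, and opposite residues at them. -/
def IsDualizingAt : Point k → RatFunc k → Prop
  | .generic, _ => True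
  | .smooth a, f => RegularAt (a : k) f
  | .node, f => RegularAt 0 (RatFunc.X * f) ∧ RegularAt 0 (RatFunc.X * coeffInfty f) ∧
      val0 (RatFunc.X * f) + val0 (RatFunc.X * coeffInfty f) = 0

theorem IsDualizingAt.add {x : Point k} {f g : RatFunc k} (hf : IsDualizingAt x f)
    (hg : IsDualizingAt x g) : IsDualizingAt x (f + g) := by
  cases x with
  | generic => trivial
  | smooth a => exact RegularAt.add hf hg
  | node =>
    obtain ⟨h1, h2, h3⟩ := hf
    obtain ⟨h1', h2', h3'⟩ := hg
    have e : coeffInfty (f + g) = coeffInfty f + coeffInfty g := by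
      simp only [coeffInfty, map_add]; ring
    refine ⟨?_, ?_, ?_⟩
    · rw [mul_add]; exact h1.add h1'
    · rw [e, mul_add]; exact h2.add h2'
    · rw [e, mul_add, mul_add, val0_add h1 h1', val0_add h2 h2']
      linear_combination h3 + h3'

theorem IsDualizingAt.smul {x : Point k} {f g : RatFunc k} (hf : f ∈ localRing x)
    (hg : IsDualizingAt x g) : IsDualizingAt x (f * g) := by
  cases x with
  | generic => trivial
  | smooth a =>
    refine RegularAt.mul ?_ hg
    exact hf.1 (.finite a) (by simp [proj])
  | node =>
    obtain ⟨h1, h2, h3⟩ := hg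
    have h0 : RegularAt 0 f := hf.1 (.finite 0) proj_zero
    have hi : RegularAt 0 (swap k f) := by
      have := hf.1 .infty rfl
      simpa [IsSectionAt] using this
    have hv : val0 f = val0 (swap k f) := by
      have := hf.2 rfl
      simpa [valInfty] using this
    have e1 : RatFunc.X * (f * g) = f * (RatFunc.X * g) := by ring
    have e2 : RatFunc.X * coeffInfty (f * g) = swap k f * (RatFunc.X * coeffInfty g) := by
      simp only [coeffInfty, map_mul]; ring
    refine ⟨?_, ?_, ?_⟩
    · rw [e1]; exact h0.mul h1
    · rw [e2]; exact hi.mul h2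
    · rw [e1, e2, val0_mul h0 h1, val0_mul hi h2, hv, ← mul_add, h3, mul_zero]

/-- The stalk of the dualizing sheaf as a subgroup of the space of rational differentials. -/
def dualizingStalk (x : Point k) : AddSubgroup (RatFunc k) where
  carrier := {f | IsDualizingAt x f}
  zero_mem' := by
    cases x <;> simp [IsDualizingAt, RegularAt.zero, coeffInfty, val0_zero]
  add_mem' := IsDualizingAt.add
  neg_mem' {f} hf := by
    have : -f = RatFunc.C (-1) * f := by simp
    change IsDualizingAt x (-f)
    rw [this]
    exact .smul (C_mem_localRing _ x) hf

/-- `ω_C(U)` is an `𝒪_C(U)`-module. -/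
instance dualizingModule (U : Opens (TopCat.of (Point k))) :
    Module (ringSections (X := TopCat.of (Point k)) localRing U)
      (addSections (X := TopCat.of (Point k)) dualizingStalk U) where
  smul f g := ⟨f.1 * g.1, f.2.1.mul g.2.1, fun x => .smul (f.2.2 x) (g.2.2 x)⟩
  one_smul g := Subtype.ext (one_mul g.1)
  mul_smul f f' g := Subtype.ext (mul_assoc f.1 f'.1 g.1)
  smul_zero f := Subtype.ext (mul_zero f.1)
  smul_add f g g' := Subtype.ext (mul_add f.1 g.1 g'.1)
  add_smul f f' g := Subtype.ext (add_mul f.1 f'.1 g.1)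
  zero_smul g := Subtype.ext (zero_mul g.1)

/-- The dualizing sheaf `ω_C` of the nodal curve: rational differentials on `ℙ¹`, regular away
from the node, with at most simple poles and opposite residues at the preimages of the node. -/
def dualizingSheaf (k : Type u) [Field k] : Modules (nodalCurve k) :=
  letI (U : (Opens (nodalCurve k))ᵒᵖ) : Module ((ringSheaf (nodalCurve k)).obj.obj U)
      ((addPresheaf (X := TopCat.of (Point k)) dualizingStalk).obj U) :=
    dualizingModule (k := k) U.unop
  ⟨.ofPresheaf (addPresheaf (X := TopCat.of (Point k)) dualizingStalk) (fun _ _ _ _ _ => rfl),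
    addPresheaf_isSheaf (X := TopCat.of (Point k)) dualizingStalk⟩

/-! ### The sheaf of algebras attached to a bundle and a subalgebra of its fibers -/

variable {n : ℕ}

/-- The value at `0` of a matrix of rational functions. -/
def matVal0 (M : Matrix (Fin n) (Fin n) (RatFunc k)) : Matrix (Fin n) (Fin n) k :=
  .of fun i j => val0 (M i j)

/-- The value at `∞` of a section of `ℰnd(𝒱)`, where `𝒱 = ⨁ 𝒪(d i)`. -/
def matValInfty (d : Fin n → ℤ) (M : Matrix (Fin n) (Fin n) (RatFunc k)) :
    Matrix (Fin n) (Fin n) k :=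
  .of fun i j => valInfty (d i - d j) (M i j)

/-- The matrix `M` of rational functions is a section at `p` of `ℰnd(𝒱)`, `𝒱 = ⨁ 𝒪(d i)`: its
entry at `(i, j)` is a section of `ℋom(𝒪(d j), 𝒪(d i)) = 𝒪(d i - d j)`. -/
def IsEndSectionAt (d : Fin n → ℤ) (p : P1 k) (M : Matrix (Fin n) (Fin n) (RatFunc k)) : Prop :=
  ∀ i j, IsSectionAt (d i - d j) p (M i j)

/-- The stalk at `x` of the sheaf `𝒜(𝒱, I)`, where `𝒱 = ⨁ 𝒪(d i)` and `I` is a subalgebra of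
`End(𝒱|_0) ⊕ End(𝒱|_∞)`: sections of `ℰnd(𝒱)` near `π⁻¹(x)`, whose pair of values at `0` and `∞`
lies in `I` if `x` is the node. -/
def orderStalk (d : Fin n → ℤ)
    (I : Subalgebra k (Matrix (Fin n) (Fin n) k × Matrix (Fin n) (Fin n) k)) (x : Point k) :
    Subring (Matrix (Fin n) (Fin n) (RatFunc k)) where
  carrier := {M | (∀ p, proj p = x → IsEndSectionAt d p M) ∧
    (x = .node → (matVal0 M, matValInfty d M) ∈ I)}
  zero_mem' := by
    refine ⟨fun p _ i j => .zero _ p, fun _ => ?_⟩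
    have e1 : matVal0 (0 : Matrix (Fin n) (Fin n) (RatFunc k)) = 0 := by
      ext i j; simp [matVal0, val0_zero]
    have e2 : matValInfty d (0 : Matrix (Fin n) (Fin n) (RatFunc k)) = 0 := by
      ext i j; simp [matValInfty, valInfty_zero]
    rw [e1, e2]; exact I.zero_mem
  one_mem' := by
    refine ⟨fun p _ i j => ?_, fun _ => ?_⟩
    · by_cases h : i = j
      · subst h; simpa using IsSectionAt.C p 1
      · simpa [h] using IsSectionAt.zero _ p
    · have e1 : matVal0 (1 : Matrix (Fin n) (Fin n) (RatFunc k)) = 1 := by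
        ext i j
        by_cases h : i = j
        · subst h; simp [matVal0, val0_one]
        · simp [matVal0, h, val0_zero]
      have e2 : matValInfty d (1 : Matrix (Fin n) (Fin n) (RatFunc k)) = 1 := by
        ext i j
        by_cases h : i = j
        · subst h; simpa [matValInfty] using valInfty_C (1 : k)
        · simp [matValInfty, h, valInfty_zero]
      rw [e1, e2]; exact I.one_mem
  add_mem' := by
    rintro M N ⟨hM, hM'⟩ ⟨hN, hN'⟩
    refine ⟨fun p hp i j => (hM p hp i j).add (hN p hp i j), fun hx => ?_⟩
    subst hx
    have e1 : matVal0 (M + N) = matVal0 M + matVal0 N := by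
      ext i j
      exact val0_add (hM _ proj_zero i j) (hN _ proj_zero i j)
    have e2 : matValInfty d (M + N) = matValInfty d M + matValInfty d N := by
      ext i j
      exact valInfty_add (hM _ rfl i j) (hN _ rfl i j)
    rw [e1, e2]; exact I.add_mem (hM' rfl) (hN' rfl)
  mul_mem' := by
    rintro M N ⟨hM, hM'⟩ ⟨hN, hN'⟩
    have key : ∀ p, IsEndSectionAt d p M → IsEndSectionAt d p N → ∀ i j l,
        IsSectionAt (d i - d j) p (M i l * N l j) := by
      intro p h h' i j l
      have := (h i l).mul (h' l j)
      rwa [sub_add_sub_cancel] at this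
    refine ⟨fun p hp i j => ?_, fun hx => ?_⟩
    · rw [Matrix.mul_apply]
      exact .sum fun l _ => key p (hM p hp) (hN p hp) i j l
    · subst hx
      have e1 : matVal0 (M * N) = matVal0 M * matVal0 N := by
        ext i j
        have h0 := proj_zero (k := k)
        simp only [matVal0, Matrix.mul_apply, Matrix.of_apply]
        rw [val0_sum _ fun l => key _ (hM _ h0) (hN _ h0) i j l]
        exact Finset.sum_congr rfl fun l _ => val0_mul (hM _ h0 i l) (hN _ h0 l j)
      have e2 : matValInfty d (M * N) = matValInfty d M * matValInfty d N := by
        ext i j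
        simp only [matValInfty, Matrix.mul_apply, Matrix.of_apply]
        rw [valInfty_sum _ fun l => key _ (hM _ rfl) (hN _ rfl) i j l]
        refine Finset.sum_congr rfl fun l _ => ?_
        rw [← valInfty_mul (hM _ rfl i l) (hN _ rfl l j), sub_add_sub_cancel]
      rw [e1, e2]; exact I.mul_mem (hM' rfl) (hN' rfl)
  neg_mem' := by
    rintro M ⟨hM, hM'⟩
    refine ⟨fun p hp i j => (hM p hp i j).neg, fun hx => ?_⟩
    subst hx
    have e1 : matVal0 (-M) = -matVal0 M := by
      ext i j
      exact val0_neg (hM _ proj_zero i j)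
    have e2 : matValInfty d (-M) = -matValInfty d M := by
      ext i j
      exact valInfty_neg (hM _ rfl i j)
    rw [e1, e2]; exact I.neg_mem (hM' rfl)

theorem scalar_mem_orderStalk (d : Fin n → ℤ)
    (I : Subalgebra k (Matrix (Fin n) (Fin n) k × Matrix (Fin n) (Fin n) k)) (x : Point k)
    {f : RatFunc k} (hf : f ∈ localRing x) : Matrix.scalar (Fin n) f ∈ orderStalk d I x := by
  refine ⟨fun p hp i j => ?_, fun hx => ?_⟩
  · by_cases h : i = j
    · subst h; simpa using hf.1 p hp
    · simpa [h] using IsSectionAt.zero _ p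
  · have e1 : matVal0 (Matrix.scalar (Fin n) f) = algebraMap k _ (val0 f) := by
      ext i j
      by_cases h : i = j
      · subst h; simp [matVal0, Matrix.algebraMap_matrix_apply]
      · simp [matVal0, h, val0_zero, Matrix.algebraMap_matrix_apply]
    have e2 : matValInfty d (Matrix.scalar (Fin n) f) = algebraMap k _ (val0 f) := by
      ext i j
      by_cases h : i = j
      · subst h; simp [matValInfty, hf.2 hx, Matrix.algebraMap_matrix_apply]
      · simp [matValInfty, h, valInfty_zero, Matrix.algebraMap_matrix_apply]
    rw [e1, e2]
    exact I.algebraMap_mem (val0 f)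

/-- The structure morphism of `𝒜(𝒱, I)`: functions are scalar matrices. -/
def orderUnit (d : Fin n → ℤ)
    (I : Subalgebra k (Matrix (Fin n) (Fin n) k × Matrix (Fin n) (Fin n) k))
    (U : Opens (TopCat.of (Point k))) :
    ringSections (X := TopCat.of (Point k)) localRing U →+*
      ringSections (X := TopCat.of (Point k)) (orderStalk d I) U where
  toFun f := ⟨fun x => Matrix.scalar (Fin n) (f.1 x), f.2.1.comp (Matrix.scalar (Fin n)),
    fun x => scalar_mem_orderStalk d I x.1 (f.2.2 x)⟩
  map_zero' := Subtype.ext (funext fun _ => map_zero (Matrix.scalar (Fin n)))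
  map_one' := Subtype.ext (funext fun _ => map_one (Matrix.scalar (Fin n)))
  map_add' _ _ := Subtype.ext (funext fun _ => map_add (Matrix.scalar (Fin n)) _ _)
  map_mul' _ _ := Subtype.ext (funext fun _ => map_mul (Matrix.scalar (Fin n)) _ _)

/-- The sheaf of `𝒪_C`-algebras `𝒜(𝒱, I) ⊂ π_* ℰnd(𝒱)`, where `𝒱 = ⨁ 𝒪(d i)`, consisting of the
sections `a` with `(a(0), a(∞)) ∈ I`. -/
def orderSheaf (d : Fin n → ℤ)
    (I : Subalgebra k (Matrix (Fin n) (Fin n) k × Matrix (Fin n) (Fin n) k)) :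
    AlgebraSheaf (nodalCurve k) where
  sheaf := ⟨ringPresheaf (X := TopCat.of (Point k)) (orderStalk d I),
    ringPresheaf_isSheaf (X := TopCat.of (Point k)) (orderStalk d I)⟩
  unit := ⟨{ app := fun U => RingCat.ofHom (orderUnit d I U.unop)
             naturality := fun _ _ _ => rfl }⟩
  central _ f a := Subtype.ext (funext fun x =>
    (Matrix.scalar_commute (f.1 x) (fun _ => Commute.all _ _) (a.1 x)).eq)

end NodalCurve

/-! ### Associative Belavin-Drinfeld data -/

/-- Associative Belavin-Drinfeld data `(σ, Γ₁, Γ₂)` of size `n`, with the standard cyclic permutation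
`σ₀ : i ↦ i + 1` of the index set `Fin n = {0, …, n - 1}` (`finRotate n`): a cyclic permutation `σ`
of the whole index set, and proper subsets `Γ₁`, `Γ₂` of the graph of `σ₀` with `σ(Γ₁) = Γ₂`. -/
structure AssociativeBDData (n : ℕ) where
  σ : Equiv.Perm (Fin n)
  Γ₁ : Set (Fin n × Fin n)
  Γ₂ : Set (Fin n × Fin n)
  cyclic : σ.IsCycleOn Set.univ
  proper₁ : Γ₁ ⊂ {p | p.2 = finRotate n p.1}
  proper₂ : Γ₂ ⊂ {p | p.2 = finRotate n p.1}
  image_eq : Prod.map σ σ '' Γ₁ = Γ₂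

namespace AssociativeBDData

variable {n : ℕ}

/-- The extension `Π` of `Γ`: the pairs `(i, σ₀^r(i))`, `r ≥ 1`, such that
`(i, σ₀(i)), (σ₀(i), σ₀²(i)), …, (σ₀^{r-1}(i), σ₀^r(i))` are all in `Γ`. -/
def extend (Γ : Set (Fin n × Fin n)) : Set (Fin n × Fin n) :=
  {p | ∃ r : ℕ, 1 ≤ r ∧ p.2 = (finRotate n ^ r) p.1 ∧
    ∀ s < r, ((finRotate n ^ s) p.1, (finRotate n ^ (s + 1)) p.1) ∈ Γ}

/-- The set `S_m` of pairs `(i, j)` with `i < j < m` or `m ≤ i < j` or `i ≥ m > j`. -/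
def cyclicOrder (m : Fin n) : Set (Fin n × Fin n) :=
  {p | (p.1 < p.2 ∧ p.2 < m) ∨ (m ≤ p.1 ∧ p.1 < p.2) ∨ (m ≤ p.1 ∧ p.2 < m)}

/-- The degrees `ε_i`: `0` for `i < m` and `1` for `i ≥ m`. -/
def degrees (m : Fin n) (i : Fin n) : ℤ := if i < m then 0 else 1

/-- A rank function for the order `S_m`. -/
def rank (m i : Fin n) : ℕ := if i < m then i + n else i

theorem rank_injective (m : Fin n) : Function.Injective (rank m) := by
  intro i j h
  simp only [rank, Fin.lt_def] at h
  ext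
  split_ifs at h <;> omega

theorem mem_cyclicOrder_iff (m i j : Fin n) : (i, j) ∈ cyclicOrder m ↔ rank m i < rank m j := by
  simp only [cyclicOrder, rank, Set.mem_ofPred_eq, Fin.lt_def, Fin.le_def]
  split_ifs <;> omega

theorem rank_zero_lt [NeZero n] (i j : Fin n) : rank 0 i < rank 0 j ↔ i < j := by
  have h (l : Fin n) : ¬ l < 0 := not_lt.2 (Fin.zero_le l)
  rw [rank, rank, if_neg (h i), if_neg (h j), Fin.lt_def]

theorem extend_iff {Γ : Set (Fin n × Fin n)} (hΓ : Γ ⊆ {p | p.2 = finRotate n p.1})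
    (i j : Fin n) : (i, j) ∈ extend Γ ↔ Relation.TransGen (fun i j => (i, j) ∈ Γ) i j := by
  constructor
  · rintro ⟨r, hr, hj, h⟩
    dsimp only at hj h
    subst hj
    induction r, hr using Nat.le_induction with
    | base => exact .single (by simpa using h 0 one_pos)
    | succ r hr ih =>
      exact (ih fun s hs => h s (hs.trans r.lt_succ_self)).tail (h r r.lt_succ_self)
  · intro h
    induction h with
    | single h => exact ⟨1, le_rfl, by simpa using hΓ h, fun s hs => by
        obtain rfl : s = 0 := by omega
        simpa [← show _ = finRotate n i from hΓ h] using h⟩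
    | tail _ h ih =>
      obtain ⟨r, hr, hj, hs⟩ := ih
      dsimp only at hj hs
      have h' : _ = finRotate n _ := hΓ h
      dsimp only at h'
      have e : (finRotate n ^ (r + 1)) i = finRotate n ((finRotate n ^ r) i) := by
        rw [pow_succ', Equiv.Perm.mul_apply]
      refine ⟨r + 1, by omega, by rw [h', hj, e], fun s hsr => ?_⟩
      rcases Nat.lt_succ_iff_lt_or_eq.1 hsr with hlt | rfl
      · exact hs s hlt
      · dsimp only
        rw [e, ← hj, ← h']; exact h

section Order

variable {Γ : Set (Fin n × Fin n)} {m : Fin n}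

theorem rank_step (hΓ : Γ ⊆ {p | p.2 = finRotate n p.1})
    (hm : ((finRotate n).symm m, m) ∉ Γ) {i j : Fin n} (h : (i, j) ∈ Γ) :
    rank m j = rank m i + 1 := by
  have hj : j = finRotate n i := hΓ h
  have hjm : j ≠ m := by
    rintro rfl
    apply hm
    rwa [hj, Equiv.symm_apply_apply, ← hj]
  obtain _ | n := n
  · exact i.elim0
  have hv : j.val ≠ m.val := fun h => hjm (Fin.ext h)
  rw [finRotate_apply] at hj
  have hval : j.val = if i.val = n then 0 else i.val + 1 := by
    rw [hj, Fin.val_add_one]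
    simp [Fin.ext_iff]
  simp only [rank, Fin.lt_def]
  have := m.2
  have := i.2
  split_ifs at * <;> omega

theorem rank_lt {i j : Fin n} (hΓ : Γ ⊆ {p | p.2 = finRotate n p.1})
    (hm : ((finRotate n).symm m, m) ∉ Γ) (h : (i, j) ∈ extend Γ) : rank m i < rank m j := by
  rw [extend_iff hΓ] at h
  induction h with
  | single h => have := rank_step hΓ hm h; omega
  | tail _ h ih => have := rank_step hΓ hm h; omega

theorem extend_trans (hΓ : Γ ⊆ {p | p.2 = finRotate n p.1}) {i j l : Fin n}
    (h : (i, j) ∈ extend Γ) (h' : (j, l) ∈ extend Γ) : (i, l) ∈ extend Γ := by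
  rw [extend_iff hΓ] at *
  exact h.trans h'

theorem extend_convex {i j l : Fin n} (hΓ : Γ ⊆ {p | p.2 = finRotate n p.1})
    (hm : ((finRotate n).symm m, m) ∉ Γ) (h : (i, j) ∈ extend Γ) (h1 : rank m i < rank m l)
    (h2 : rank m l < rank m j) : (i, l) ∈ extend Γ ∧ (l, j) ∈ extend Γ := by
  rw [extend_iff hΓ] at *
  rw [extend_iff hΓ]
  induction h using Relation.TransGen.head_induction_on with
  | single h => have := rank_step hΓ hm h; omega
  | head h hc ih =>
    rename_i a c
    have hs := rank_step hΓ hm h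
    by_cases e : c = l
    · subst e; exact ⟨.single h, hc⟩
    · have : rank m c ≠ rank m l := fun h => e (rank_injective m h)
      obtain ⟨h3, h4⟩ := ih (by omega)
      exact ⟨.head h h3, h4⟩

/-- The pairs `(i, j)` with `i = j` or `(i, j) ∈ Π` or `(j, i) ∈ Π`, i.e. the positions of the
nonzero entries of the Levi component. -/
def Block (Γ : Set (Fin n × Fin n)) (i j : Fin n) : Prop :=
  i = j ∨ (i, j) ∈ extend Γ ∨ (j, i) ∈ extend Γ

theorem zero_of_zero (hΓ : Γ ⊆ {p | p.2 = finRotate n p.1})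
    (hm : ((finRotate n).symm m, m) ∉ Γ) {i j : Fin n} (h : rank m i < rank m j)
    (h' : (i, j) ∉ extend Γ) (l : Fin n) :
    (rank m i < rank m l ∧ (i, l) ∉ extend Γ) ∨ (rank m l < rank m j ∧ (l, j) ∉ extend Γ) := by
  by_contra! hc
  obtain ⟨h1, h2⟩ := hc
  rcases lt_trichotomy (rank m l) (rank m i) with hl | hl | hl
  · exact h' (extend_convex hΓ hm (h2 (hl.trans h)) hl h).2
  · rw [rank_injective m hl] at h2; exact h' (h2 h)
  · rcases lt_trichotomy (rank m l) (rank m j) with hj | hj | hj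
    · exact h' (extend_trans hΓ (h1 hl) (h2 hj))
    · rw [rank_injective m hj] at h1; exact h' (h1 h)
    · exact h' (extend_convex hΓ hm (h1 hl) h hj).1

theorem Block.symm {i j : Fin n} (h : Block Γ i j) : Block Γ j i := by
  rcases h with h | h | h
  exacts [.inl h.symm, .inr (.inr h), .inr (.inl h)]

theorem Block.trans (hΓ : Γ ⊆ {p | p.2 = finRotate n p.1})
    (hm : ((finRotate n).symm m, m) ∉ Γ) {i j l : Fin n} (h : Block Γ i j) (h' : Block Γ j l) :
    Block Γ i l := by
  rcases h with rfl | h | h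
  · exact h'
  · rcases h' with rfl | h' | h'
    · exact .inr (.inl h)
    · exact .inr (.inl (extend_trans hΓ h h'))
    · have h1 := rank_lt hΓ hm h
      have h2 := rank_lt hΓ hm h'
      rcases lt_trichotomy (rank m i) (rank m l) with hl | hl | hl
      · exact .inr (.inl (extend_convex hΓ hm h hl h2).1)
      · exact .inl (rank_injective m hl)
      · exact .inr (.inr (extend_convex hΓ hm h' hl h1).1)
  · rcases h' with rfl | h' | h'
    · exact .inr (.inr h)
    · have h1 := rank_lt hΓ hm h
      have h2 := rank_lt hΓ hm h'
      rcases lt_trichotomy (rank m i) (rank m l) with hl | hl | hl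
      · exact .inr (.inl (extend_convex hΓ hm h' h1 hl).2)
      · exact .inl (rank_injective m hl)
      · exact .inr (.inr (extend_convex hΓ hm h h2 hl).2)
    · exact .inr (.inr (extend_trans hΓ h' h))

theorem zero_of_block (hΓ : Γ ⊆ {p | p.2 = finRotate n p.1})
    (hm : ((finRotate n).symm m, m) ∉ Γ) {i j l : Fin n} (h : Block Γ i j) (hl : ¬ Block Γ i l) :
    (rank m i < rank m l ∧ (i, l) ∉ extend Γ) ∨ (rank m l < rank m j ∧ (l, j) ∉ extend Γ) := by
  have hl' : ¬ Block Γ l j := fun h' => hl (h.trans hΓ hm h'.symm)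
  rcases lt_trichotomy (rank m l) (rank m i) with h1 | h1 | h1
  · right
    refine ⟨?_, fun h' => hl' (.inr (.inl h'))⟩
    by_contra hc
    rcases h with rfl | h | h
    · exact hc h1
    · have := rank_lt hΓ hm h; omega
    · rcases (not_lt.1 hc).eq_or_lt with e | e
      · exact hl' (.inl (rank_injective m e.symm))
      · exact hl (.inr (.inr (extend_convex hΓ hm h e h1).2))
  · exact absurd (.inl (rank_injective m h1.symm)) hl
  · exact .inl ⟨h1, fun h' => hl (.inr (.inl h'))⟩

end Order

variable (D : AssociativeBDData n)

/-- The set `Π₁`. -/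
def Pi₁ : Set (Fin n × Fin n) := extend D.Γ₁

/-- The set `Π₂`. -/
def Pi₂ : Set (Fin n × Fin n) := extend D.Γ₂

theorem mem_Pi_iff (i j : Fin n) : (D.σ i, D.σ j) ∈ D.Pi₂ ↔ (i, j) ∈ D.Pi₁ := by
  have key : ∀ i j, (D.σ i, D.σ j) ∈ D.Γ₂ ↔ (i, j) ∈ D.Γ₁ := by
    intro i j
    rw [← D.image_eq]
    exact (Function.Injective.prodMap D.σ.injective D.σ.injective).mem_set_image (a := (i, j))
  rw [Pi₁, Pi₂, extend_iff D.proper₁.1, extend_iff D.proper₂.1]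
  constructor
  · intro h
    have := h.lift (p := fun i j => (i, j) ∈ D.Γ₁) D.σ.symm (fun a b hab => by
      change (D.σ.symm a, D.σ.symm b) ∈ D.Γ₁
      rw [← key]; simpa using hab)
    change Relation.TransGen _ (D.σ.symm (D.σ i)) (D.σ.symm (D.σ j)) at this
    rwa [Equiv.symm_apply_apply, Equiv.symm_apply_apply] at this
  · intro h
    exact h.lift D.σ fun a b hab => (key a b).2 hab

theorem block_iff (i j : Fin n) : Block D.Γ₂ (D.σ i) (D.σ j) ↔ Block D.Γ₁ i j := by
  unfold Block
  exact or_congr D.σ.injective.eq_iff (or_congr (D.mem_Pi_iff i j) (D.mem_Pi_iff j i))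

/-- The parabolic subalgebra `P₁ = {a | a_{ij} = 0 for i > j, (j, i) ∉ Π₁}`. -/
def IsInP₁ {k : Type u} [Field k] (a : Matrix (Fin n) (Fin n) k) : Prop :=
  ∀ i j, j < i → (j, i) ∉ D.Pi₁ → a i j = 0

/-- The parabolic subalgebra `P₂ = {b | b_{ij} = 0 for (i, j) ∈ S_m, (i, j) ∉ Π₂}`. -/
def IsInP₂ {k : Type u} [Field k] (m : Fin n) (b : Matrix (Fin n) (Fin n) k) : Prop :=
  ∀ i j, (i, j) ∈ cyclicOrder m → (i, j) ∉ D.Pi₂ → b i j = 0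

/-- The Levi components of `a` and `b` correspond to each other under `σ`. -/
def LeviMatch {k : Type u} [Field k] (a b : Matrix (Fin n) (Fin n) k) : Prop :=
  ∀ i j, (i = j ∨ (i, j) ∈ D.Pi₁) → a i j = b (D.σ i) (D.σ j) ∧ a j i = b (D.σ j) (D.σ i)

theorem leviMatch_iff {k : Type u} [Field k] (a b : Matrix (Fin n) (Fin n) k) :
    D.LeviMatch a b ↔ ∀ i j, Block D.Γ₁ i j → a i j = b (D.σ i) (D.σ j) := by
  constructor
  · rintro h i j (hij | hij | hij)
    exacts [(h i j (.inl hij)).1, (h i j (.inr hij)).1, (h j i (.inr hij)).2]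
  · rintro h i j (hij | hij)
    · exact ⟨h i j (.inl hij), h j i (.inl hij.symm)⟩
    · exact ⟨h i j (.inr (.inl hij)), h j i (.inr (.inr hij))⟩

variable [NeZero n]

/-- The subalgebra `I(P₁, P₂, σ)` of `Mat_n(k) ⊕ Mat_n(k)`: the pairs `(a, b)` with `a ∈ P₁`,
`b ∈ P₂`, whose images in the Levi components `L(P₁)`, `L(P₂)` correspond under the isomorphism
`e_{ij} ↦ e_{σ(i)σ(j)}`. -/
def isotropicSubalgebra (k : Type u) [Field k] (h₁ : ((finRotate n).symm 0, 0) ∉ D.Γ₁) (m : Fin n)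
    (h₂ : ((finRotate n).symm m, m) ∉ D.Γ₂) :
    Subalgebra k (Matrix (Fin n) (Fin n) k × Matrix (Fin n) (Fin n) k) where
  carrier := {p | D.IsInP₁ p.1 ∧ D.IsInP₂ m p.2 ∧ D.LeviMatch p.1 p.2}
  add_mem' := by
    rintro ⟨a, b⟩ ⟨a', b'⟩ ⟨h1, h2, h3⟩ ⟨h1', h2', h3'⟩
    dsimp only at h1 h2 h3 h1' h2' h3'
    refine ⟨fun i j h h' => ?_, fun i j h h' => ?_, fun i j h => ?_⟩
    · change a i j + a' i j = 0
      rw [h1 i j h h', h1' i j h h', add_zero]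
    · change b i j + b' i j = 0
      rw [h2 i j h h', h2' i j h h', add_zero]
    · obtain ⟨e1, e2⟩ := h3 i j h
      obtain ⟨e3, e4⟩ := h3' i j h
      exact ⟨congrArg₂ (· + ·) e1 e3, congrArg₂ (· + ·) e2 e4⟩
  mul_mem' := by
    rintro ⟨a, b⟩ ⟨a', b'⟩ ⟨h1, h2, h3⟩ ⟨h1', h2', h3'⟩
    dsimp only at h1 h2 h3 h1' h2' h3'
    refine ⟨fun i j h h' => ?_, fun i j h h' => ?_, (D.leviMatch_iff _ _).2 fun i j h => ?_⟩
    · refine (Matrix.mul_apply ..).trans (Finset.sum_eq_zero fun l _ => ?_)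
      change a i l * a' l j = 0
      rcases zero_of_zero D.proper₁.1 h₁ ((rank_zero_lt j i).2 h) h' l with ⟨h4, h5⟩ | ⟨h4, h5⟩
      · rw [h1' l j ((rank_zero_lt j l).1 h4) h5, mul_zero]
      · rw [h1 i l ((rank_zero_lt l i).1 h4) h5, zero_mul]
    · refine (Matrix.mul_apply ..).trans (Finset.sum_eq_zero fun l _ => ?_)
      change b i l * b' l j = 0
      rcases zero_of_zero D.proper₂.1 h₂ ((mem_cyclicOrder_iff m i j).1 h) h' l with
        ⟨h4, h5⟩ | ⟨h4, h5⟩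
      · rw [h2 i l ((mem_cyclicOrder_iff m i l).2 h4) h5, zero_mul]
      · rw [h2' l j ((mem_cyclicOrder_iff m l j).2 h4) h5, mul_zero]
    · dsimp only [Prod.mk_mul_mk]
      rw [Matrix.mul_apply, Matrix.mul_apply,
        ← Equiv.sum_comp D.σ fun l => b (D.σ i) l * b' l (D.σ j)]
      rw [leviMatch_iff] at h3 h3'
      refine Finset.sum_congr rfl fun l _ => ?_
      by_cases hl : Block D.Γ₁ i l
      · rw [h3 i l hl, h3' l j (hl.symm.trans D.proper₁.1 h₁ h)]
      · have hl' : ¬ Block D.Γ₁ j l := fun h' => hl (h.trans D.proper₁.1 h₁ h')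
        have e1 : a i l * a' l j = 0 := by
          rcases zero_of_block D.proper₁.1 h₁ h.symm hl' with ⟨h4, h5⟩ | ⟨h4, h5⟩
          · rw [h1' l j ((rank_zero_lt j l).1 h4) h5, mul_zero]
          · rw [h1 i l ((rank_zero_lt l i).1 h4) h5, zero_mul]
        have e2 : b (D.σ i) (D.σ l) * b' (D.σ l) (D.σ j) = 0 := by
          rcases zero_of_block D.proper₂.1 h₂ ((D.block_iff i j).2 h)
            (fun h' => hl ((D.block_iff i l).1 h')) with ⟨h4, h5⟩ | ⟨h4, h5⟩
          · rw [h2 _ _ ((mem_cyclicOrder_iff m _ _).2 h4) h5, zero_mul]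
          · rw [h2' _ _ ((mem_cyclicOrder_iff m _ _).2 h4) h5, mul_zero]
        rw [e1, e2]
  algebraMap_mem' c := by
    refine ⟨fun i j h _ => ?_, fun i j h _ => ?_, fun i j h => ?_⟩
    · simp [Matrix.algebraMap_matrix_apply, h.ne']
    · have : i ≠ j := by
        rintro rfl
        exact lt_irrefl _ ((mem_cyclicOrder_iff m i i).1 h)
      simp [Matrix.algebraMap_matrix_apply, this]
    · simp [Matrix.algebraMap_matrix_apply]

/-- The sheaf of algebras `𝒜 = 𝒜(𝒱, I(P₁, P₂, σ))`, `𝒱 = ⨁ 𝒪(ε_i)`, on the nodal curve attached to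
associative Belavin-Drinfeld data with `(n, 1) ∉ Γ₁` and a choice of `m` with
`(σ₀⁻¹(m), m) ∉ Γ₂`. -/
def order (k : Type u) [Field k] (h₁ : ((finRotate n).symm 0, 0) ∉ D.Γ₁) (m : Fin n)
    (h₂ : ((finRotate n).symm m, m) ∉ D.Γ₂) :
    SphericalOrder.AlgebraSheaf (NodalCurve.nodalCurve k) :=
  NodalCurve.orderSheaf (degrees m) (D.isotropicSubalgebra k h₁ m h₂)

end AssociativeBDData

end

namespace NodalCurve

variable {k : Type u} [Field k]

/-! ### Regular rational functions -/

/-! Every nonempty open set of the curve contains the generic point, so a section over it is one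
single element of `k(t)`, or one matrix over `k(t)`, subject to a condition at each point of the
open set (`eq_of_pred`). All assertions thereby become statements about lattices in
finite-dimensional `k(t)`-vector spaces. At a smooth point the stalk of the order is the full matrix
ring over the local ring, so only the node is delicate. There `1 + t` trivializes `𝒪(1)` on both
branches, and `twist` turns the stalk into the matrices `G`, regular at `0` and `∞`, with `(G(0),
G(∞)) ∈ I`.

Coherence. The local rings are noetherian (`isNoetherianRing_localRing`), so stalks and modules of
relations are finitely generated. Generators at one point which span over `k(t)` still generate at
all but finitely many points (`finite_not_isCombAt`), hence on a neighbourhood.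

Duality. The dualizing sheaf is `𝒪_C · dt/t`, and `τ(a) = tr(a) dt/t`. The subalgebra `I` is
Lagrangian for the form `tr(aa') - tr(bb')`. Equality of the two traces on `I` (`trace_eq_of_mem`)
makes `τ` land in the dualizing sheaf. The inclusion of the orthogonal of `I` in `I`
(`mem_of_forall_trace_mul_eq`) shows that the stalk at the node contains its trace dual
(`mem_orderStalk_node_of_trace_mul_mem`), so `ν` is an isomorphism (`nuIsIso_traceHom`). Any other
`τ'` is then `x ↦ τ(xy)` with a global section `y`, and uniqueness of `τ` up to scalars follows from
the fact that global sections are scalar.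

Global sections. The entries of a global section are sections of `𝒪(-1)`, hence zero, or of `𝒪`,
hence constants with equal values at `0` and `∞`, or of `𝒪(1)`, hence determined by the two values.
Let the value at `0` have a nonzero entry below the diagonal. It lies in the Levi part, so `σ`
carries it to a nonzero entry of the value at `∞`. That entry cannot have degree `-1`, nor degree
`1` by comparison of the two orders, so it is a constant and again a nonzero entry below the
diagonal at `0`. Repeating this gives `σ^r(j) < σ^r(i)` for all `r`, impossible for a cycle
(`Equiv.Perm.IsCycleOn.not_forall_pow_lt`). The same argument with `σ⁻¹` applies at `∞`. Hence all
off-diagonal entries vanish, and the constant diagonal is invariant under the transitive `σ`.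

Center. Away from the node the elementary matrices are sections, so central sections are scalar; the
diagonal part of the Levi condition glues their values at the node. -/

theorem regularAt_div {a : k} (p : Polynomial k) {q : Polynomial k} (hq : q.eval a ≠ 0) :
    RegularAt a (algebraMap _ (RatFunc k) p / algebraMap _ _ q) := fun h =>
  hq (Polynomial.eval_eq_zero_of_dvd_of_eval_eq_zero (RatFunc.denom_div_dvd p q) h)

theorem RegularAt.X (a : k) : RegularAt a RatFunc.X := by
  simp [RegularAt]

theorem val0_X : val0 (RatFunc.X : RatFunc k) = 0 := by simp [val0]

theorem RegularAt.sub {a : k} {f g : RatFunc k} (hf : RegularAt a f) (hg : RegularAt a g) :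
    RegularAt a (f - g) := by
  rw [sub_eq_add_neg]; exact hf.add hg.neg

theorem val0_sub {f g : RatFunc k} (hf : RegularAt 0 f) (hg : RegularAt 0 g) :
    val0 (f - g) = val0 f - val0 g := by
  rw [sub_eq_add_neg, sub_eq_add_neg, val0_add hf hg.neg, val0_neg hg]

theorem RegularAt.pow {a : k} {f : RatFunc k} (hf : RegularAt a f) (N : ℕ) :
    RegularAt a (f ^ N) := by
  induction N with
  | zero => simpa using RegularAt.one a
  | succ N ih => rw [pow_succ]; exact ih.mul hf

theorem finite_not_regularAt (f : RatFunc k) : {a : k | ¬ RegularAt a f}.Finite := by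
  classical
  refine (f.denom.roots.toFinset.finite_toSet).subset fun a ha => ?_
  simpa [RegularAt, RatFunc.denom_ne_zero] using ha

theorem X_sub_C_ne_zero (a : k) : (RatFunc.X - RatFunc.C a : RatFunc k) ≠ 0 := by
  have := Polynomial.X_sub_C_ne_zero a
  rwa [← RatFunc.algebraMap_X, ← RatFunc.algebraMap_C, ← map_sub, Ne,
    FaithfulSMul.algebraMap_eq_zero_iff]

theorem RegularAt.X_sub_C (a b : k) : RegularAt a (RatFunc.X - RatFunc.C b) :=
  (RegularAt.X a).sub (RegularAt.C a b)

/-- A nonzero rational function is a power of the uniformizer `t - a` times a local unit. -/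
theorem exists_eq_zpow_mul (a : k) {f : RatFunc k} (hf : f ≠ 0) :
    ∃ (e : ℤ) (g : RatFunc k), g ≠ 0 ∧ f = (RatFunc.X - RatFunc.C a) ^ e * g ∧ RegularAt a g ∧
      RegularAt a g⁻¹ := by
  obtain ⟨p, hp, hp'⟩ := Polynomial.exists_eq_pow_rootMultiplicity_mul_and_not_dvd f.num
    (RatFunc.num_ne_zero hf) a
  obtain ⟨q, hq, hq'⟩ := Polynomial.exists_eq_pow_rootMultiplicity_mul_and_not_dvd f.denom
    (RatFunc.denom_ne_zero f) a
  rw [Polynomial.dvd_iff_isRoot] at hp' hq'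
  have hp0 : p ≠ 0 := by rintro rfl; simp at hp'
  have hq0 : q ≠ 0 := by rintro rfl; simp at hq'
  have e : algebraMap (Polynomial k) (RatFunc k) (.X - .C a) = RatFunc.X - RatFunc.C a := by
    simp
  refine ⟨(f.num.rootMultiplicity a : ℤ) - f.denom.rootMultiplicity a,
    algebraMap _ _ p / algebraMap _ _ q, ?_, ?_, regularAt_div p hq', ?_⟩
  · simp [hp0, hq0]
  · conv_lhs => rw [← RatFunc.num_div_denom f, hp, hq]
    rw [map_mul, map_mul, map_pow, map_pow, e, zpow_sub₀ (X_sub_C_ne_zero a), zpow_natCast,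
      zpow_natCast, mul_div_mul_comm]
  · rw [inv_div]; exact regularAt_div q hp'

theorem RegularAt.zpow_of_nonneg {a : k} {f : RatFunc k} (hf : RegularAt a f) {e : ℤ} (he : 0 ≤ e) :
    RegularAt a (f ^ e) := by
  lift e to ℕ using he
  rw [zpow_natCast]; exact hf.pow e

/-- A rational function is regular after division by the uniformizer, or its inverse is regular. -/
theorem regularAt_div_or_inv (a : k) (f : RatFunc k) :
    RegularAt a (f / (RatFunc.X - RatFunc.C a)) ∨ RegularAt a f⁻¹ := by
  by_cases h0 : f = 0
  · left; simp [h0, RegularAt.zero]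
  obtain ⟨e, g, -, he, hg, hg'⟩ := exists_eq_zpow_mul a h0
  rcases le_or_gt e 0 with h | h
  · right
    rw [he, mul_inv, ← zpow_neg]
    exact ((RegularAt.X_sub_C a a).zpow_of_nonneg (by omega)).mul hg'
  · left
    have : f / (RatFunc.X - RatFunc.C a) = (RatFunc.X - RatFunc.C a) ^ (e - 1) * g := by
      rw [he, zpow_sub_one₀ (X_sub_C_ne_zero a), div_eq_mul_inv]; ring
    rw [this]
    exact ((RegularAt.X_sub_C a a).zpow_of_nonneg (by omega)).mul hg

/-- If `f / t` is regular at `0`, then `f = t · (f / t)` vanishes there; the dichotomy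
`regularAt_div_or_inv` leaves only the regularity of the inverse. Regularity of `f` itself plays no
role. -/
theorem regularAt_inv {f : RatFunc k} (h : val0 f ≠ 0) :
    RegularAt 0 f⁻¹ := by
  rcases regularAt_div_or_inv 0 f with h' | h'
  · refine absurd ?_ h
    rw [map_zero, sub_zero] at h'
    have := val0_mul (RegularAt.X 0) h'
    rwa [mul_div_cancel₀ _ RatFunc.X_ne_zero, val0_X, zero_mul] at this
  · exact h'

theorem val0_inv {f : RatFunc k} (hf : RegularAt 0 f) (h : val0 f ≠ 0) :
    val0 f⁻¹ = (val0 f)⁻¹ := by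
  have h0 : f ≠ 0 := by rintro rfl; exact h val0_zero
  have := val0_mul hf (regularAt_inv h)
  rw [mul_inv_cancel₀ h0, val0_one] at this
  exact (inv_eq_of_mul_eq_one_right this.symm).symm

/-- The inverse of `f` cannot be regular at `0`, since `f * f⁻¹ = 1` would have value `0`; so the
other alternative of `regularAt_div_or_inv` holds. -/
theorem RegularAt.div_X {f : RatFunc k} (hf : RegularAt 0 f) (h : val0 f = 0) :
    RegularAt 0 (f / RatFunc.X) := by
  by_cases h0 : f = 0
  · simp [h0, RegularAt.zero]
  rcases regularAt_div_or_inv 0 f with h' | h'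
  · simpa using h'
  · have := val0_mul hf h'
    rw [mul_inv_cancel₀ h0, h, zero_mul, val0_one] at this
    exact absurd this one_ne_zero

/-- High powers of a function vanishing at `a` are divisible by any given function. -/
theorem exists_pow_div_regularAt {a : k} {f g : RatFunc k} (hf : f ≠ 0) (hg : RegularAt a g) :
    ∃ N₀ : ℕ, ∀ N ≥ N₀, RegularAt a (((RatFunc.X - RatFunc.C a) * g) ^ N / f) := by
  obtain ⟨e, h, h0, he, hh, hh'⟩ := exists_eq_zpow_mul a hf
  refine ⟨e.toNat, fun N hN => ?_⟩
  have : ((RatFunc.X - RatFunc.C a) * g) ^ N / f =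
      (RatFunc.X - RatFunc.C a) ^ ((N : ℤ) - e) * (g ^ N * h⁻¹) := by
    rw [he, zpow_sub₀ (X_sub_C_ne_zero a), zpow_natCast, mul_pow]
    simp only [div_eq_mul_inv, mul_inv]; ring
  rw [this]
  exact ((RegularAt.X_sub_C a a).zpow_of_nonneg (by omega)).mul ((hg.pow N).mul hh')

theorem swap_C (c : k) : swap k (RatFunc.C c) = RatFunc.C c := (swap k).commutes c

theorem swap_algebraMap (p : Polynomial k) :
    swap k (algebraMap _ _ p) = Polynomial.aeval (RatFunc.X : RatFunc k)⁻¹ p := by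
  rw [← RatFunc.aeval_X_left_eq_algebraMap, ← Polynomial.aeval_algHom_apply, swap_X]

theorem swap_ne_zero {f : RatFunc k} (hf : f ≠ 0) : swap k f ≠ 0 := by
  rwa [Ne, map_eq_zero]

/-! ### Functions near the two preimages of the node -/

/-- The function `1 + t`, a trivialization of `𝒪(1)` near both `0` and `∞`. -/
noncomputable def oneAddX (k : Type u) [Field k] : RatFunc k := 1 + RatFunc.X

theorem regularAt_oneAddX : RegularAt (0 : k) (oneAddX k) := (RegularAt.one 0).add (RegularAt.X 0)

theorem val0_oneAddX : val0 (oneAddX k) = 1 := by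
  rw [oneAddX, val0_add (RegularAt.one 0) (RegularAt.X 0), val0_one, val0_X, add_zero]

theorem oneAddX_ne_zero : oneAddX k ≠ 0 := by
  intro h
  have := val0_oneAddX (k := k)
  rw [h, val0_zero] at this
  exact zero_ne_one this

theorem swap_oneAddX : swap k (oneAddX k) = oneAddX k * RatFunc.X⁻¹ := by
  rw [oneAddX, map_add, map_one, swap_X, add_mul, mul_inv_cancel₀ RatFunc.X_ne_zero]; ring

theorem regularAt_oneAddX_zpow (e : ℤ) :
    RegularAt (0 : k) (oneAddX k ^ e) ∧ val0 (oneAddX k ^ e) = 1 := by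
  have pos (N : ℕ) : RegularAt (0 : k) (oneAddX k ^ N) ∧ val0 (oneAddX k ^ N) = 1 := by
    refine ⟨regularAt_oneAddX.pow N, ?_⟩
    induction N with
    | zero => simp [val0_one]
    | succ N ih =>
      rw [pow_succ, val0_mul (regularAt_oneAddX.pow N) regularAt_oneAddX, ih, val0_oneAddX, one_mul]
  obtain ⟨N, rfl | rfl⟩ := e.eq_nat_or_neg
  · simpa using pos N
  · obtain ⟨h1, h2⟩ := pos N
    rw [zpow_neg, zpow_natCast]
    have h3 : val0 (oneAddX k ^ N) ≠ 0 := by rw [h2]; exact one_ne_zero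
    exact ⟨regularAt_inv h3, by rw [val0_inv h1 h3, h2, inv_one]⟩

/-- The substitution `t ↦ 1/t` sends `1 + t` to `(1 + t)/t`, and the power of `t` is absorbed by the
change of trivialization from `x₀` to `x₁`. So the factor `(1 + t) ^ d` looks the same on both
branches. -/
theorem swap_twist (d : ℤ) (g : RatFunc k) :
    swap k (RatFunc.X ^ (-d) * (oneAddX k ^ d * g)) = oneAddX k ^ d * swap k g := by
  rw [map_mul, map_mul, map_zpow₀, map_zpow₀, swap_X, swap_oneAddX, mul_zpow, inv_zpow, inv_zpow,
    zpow_neg, inv_inv]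
  have : (RatFunc.X : RatFunc k) ^ d ≠ 0 := zpow_ne_zero _ RatFunc.X_ne_zero
  field_simp

/-- The sections of `𝒪(d)` near `0` and `∞` are the functions `(1 + t) ^ d * g` with `g` regular
there. -/
theorem regularAt_twist_iff (d : ℤ) (f : RatFunc k) :
    RegularAt 0 (oneAddX k ^ d * f) ↔ RegularAt 0 f := by
  refine ⟨fun h => ?_, fun h => (regularAt_oneAddX_zpow d).1.mul h⟩
  have := (regularAt_oneAddX_zpow (k := k) (-d)).1.mul h
  rwa [← mul_assoc, ← zpow_add₀ oneAddX_ne_zero, neg_add_cancel, zpow_zero, one_mul] at this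

theorem val0_twist (d : ℤ) {f : RatFunc k} (hf : RegularAt 0 f) :
    val0 (oneAddX k ^ d * f) = val0 f := by
  rw [val0_mul (regularAt_oneAddX_zpow d).1 hf, (regularAt_oneAddX_zpow d).2, one_mul]

theorem isSectionAt_infty_twist_iff (d : ℤ) (g : RatFunc k) :
    IsSectionAt d .infty (oneAddX k ^ d * g) ↔ RegularAt 0 (swap k g) := by
  rw [IsSectionAt, swap_twist, regularAt_twist_iff]

theorem valInfty_twist (d : ℤ) {g : RatFunc k} (hg : RegularAt 0 (swap k g)) :
    valInfty d (oneAddX k ^ d * g) = val0 (swap k g) := by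
  rw [valInfty, swap_twist, val0_twist d hg]

theorem exists_eq_twist (d : ℤ) (f : RatFunc k) : ∃ g, f = oneAddX k ^ d * g :=
  ⟨(oneAddX k ^ d)⁻¹ * f, by rw [mul_inv_cancel_left₀ (zpow_ne_zero _ oneAddX_ne_zero)]⟩

theorem isSectionAt_zero_infty {f : RatFunc k} :
    IsSectionAt 0 .infty f ↔ RegularAt 0 (swap k f) := by
  simp [IsSectionAt]

theorem valInfty_zero_left (f : RatFunc k) : valInfty 0 f = val0 (swap k f) := by
  simp [valInfty]

/-- The function `1 / (1 + t)`, with value `1` at `0` and `0` at `∞`. -/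
noncomputable def sep (k : Type u) [Field k] : RatFunc k := (oneAddX k)⁻¹

theorem regularAt_sep : RegularAt (0 : k) (sep k) := by
  simpa [sep] using (regularAt_oneAddX_zpow (k := k) (-1)).1

theorem val0_sep : val0 (sep k) = 1 := by
  simpa [sep] using (regularAt_oneAddX_zpow (k := k) (-1)).2

theorem swap_sep : swap k (sep k) = RatFunc.X * sep k := by
  rw [sep, map_inv₀, swap_oneAddX, mul_inv, inv_inv, mul_comm]

theorem regularAt_swap_sep : RegularAt 0 (swap k (sep k)) := by
  rw [swap_sep]; exact (RegularAt.X 0).mul regularAt_sep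

theorem val0_swap_sep : val0 (swap k (sep k)) = 0 := by
  rw [swap_sep, val0_mul (RegularAt.X 0) regularAt_sep, val0_X, zero_mul]

/-- The function `t / (1 + t) ^ 2`, with simple zeros at `0` and `∞`. -/
noncomputable def van (k : Type u) [Field k] : RatFunc k := RatFunc.X * (sep k * sep k)

theorem sep_ne_zero : sep k ≠ 0 := inv_ne_zero oneAddX_ne_zero

theorem van_ne_zero : van k ≠ 0 :=
  mul_ne_zero RatFunc.X_ne_zero (mul_ne_zero sep_ne_zero sep_ne_zero)

theorem swap_van : swap k (van k) = van k := by
  rw [van, map_mul, map_mul, swap_sep, swap_X]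
  have := RatFunc.X_ne_zero (K := k)
  field_simp

theorem regularAt_van : RegularAt 0 (van k) :=
  (RegularAt.X 0).mul (regularAt_sep.mul regularAt_sep)

theorem val0_van : val0 (van k) = 0 := by
  rw [van, val0_mul (RegularAt.X 0) (regularAt_sep.mul regularAt_sep), val0_X, zero_mul]

theorem regularAt_div_van {f : RatFunc k} (hf : RegularAt 0 f) (h : val0 f = 0) :
    RegularAt 0 (f / van k) := by
  have : f / van k = (f / RatFunc.X) * (oneAddX k * oneAddX k) := by
    rw [van, sep]; field_simp [oneAddX_ne_zero (k := k), RatFunc.X_ne_zero (K := k)]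
  rw [this]
  exact (hf.div_X h).mul (regularAt_oneAddX.mul regularAt_oneAddX)

end NodalCurve

/-! ### A noetherianity criterion -/

/-- A domain with a finitely generated ideal `m` such that all elements outside of `m` are units and
every nonzero element divides some power of each element of `m` is noetherian. -/
theorem isNoetherianRing_of_dvd_pow {R : Type*} [CommRing R] (m : Ideal R) (hm : m.FG)
    (hu : ∀ f ∉ m, IsUnit f) (hd : ∀ f ≠ 0, ∀ g ∈ m, ∃ N, f ∣ g ^ N) : IsNoetherianRing R := by
  -- Cohen's theorem leaves the nonzero primes. Such a `P` contains no unit, so `P ≤ m`; it contains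
  -- some nonzero `f`, which divides a power of each element of `m`, so `m ≤ P`.
  refine IsNoetherianRing.of_prime_ne_bot fun P hP hP0 => ?_
  obtain ⟨f, hf, hf0⟩ := Submodule.exists_mem_ne_zero_of_ne_bot hP0
  have : P = m := by
    refine le_antisymm (fun g hg => ?_) fun g hg => ?_
    · by_contra h
      exact hP.ne_top (Ideal.eq_top_of_isUnit_mem _ hg (hu g h))
    · obtain ⟨N, h⟩ := hd f hf0 g hg
      exact hP.mem_of_pow_mem N (Ideal.mem_of_dvd _ h hf)
  rwa [this]

namespace NodalCurve

variable {k : Type u} [Field k]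

/-! ### The local rings -/

theorem proj_eq_smooth_iff {p : P1 k} {a : kˣ} : proj p = .smooth a ↔ p = .finite (a : k) := by
  cases p with
  | generic => simp [proj]
  | infty => simp [proj]
  | finite b =>
    rw [proj]
    split_ifs with h
    · subst h; simpa using a.ne_zero.symm
    · simp [Units.ext_iff]

theorem proj_eq_node_iff {p : P1 k} : proj p = .node ↔ p = .finite (0 : k) ∨ p = .infty := by
  cases p with
  | generic => simp [proj]
  | infty => simp [proj]
  | finite b =>
    rw [proj]
    split_ifs with h <;> simp [h]

theorem proj_eq_generic_iff {p : P1 k} : proj p = .generic ↔ p = .generic := by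
  cases p with
  | generic => simp [proj]
  | infty => simp [proj]
  | finite b =>
    rw [proj]
    split_ifs with h <;> simp

theorem mem_localRing_generic (f : RatFunc k) : f ∈ localRing (.generic : Point k) :=
  ⟨fun p hp => by rw [proj_eq_generic_iff.1 hp]; trivial, fun h => by cases h⟩

theorem mem_localRing_smooth {a : kˣ} {f : RatFunc k} :
    f ∈ localRing (.smooth a) ↔ RegularAt (a : k) f :=
  ⟨fun h => h.1 _ (proj_eq_smooth_iff.2 rfl), fun h => ⟨fun p hp => by
    rw [proj_eq_smooth_iff.1 hp]; exact h, fun h => by cases h⟩⟩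

theorem mem_localRing_node {f : RatFunc k} :
    f ∈ localRing (.node : Point k) ↔
      RegularAt 0 f ∧ RegularAt 0 (swap k f) ∧ val0 f = val0 (swap k f) := by
  refine ⟨fun h => ⟨h.1 _ proj_zero, isSectionAt_zero_infty.1 (h.1 .infty rfl), ?_⟩,
    fun h => ⟨fun p hp => ?_, fun _ => ?_⟩⟩
  · rw [← valInfty_zero_left]; exact h.2 rfl
  · rcases proj_eq_node_iff.1 hp with rfl | rfl
    exacts [h.1, isSectionAt_zero_infty.2 h.2.1]
  · rw [valInfty_zero_left]; exact h.2.2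

theorem finite_notMem_localRing (f : RatFunc k) : {x : Point k | f ∉ localRing x}.Finite := by
  refine ((((finite_not_regularAt f).preimage (f := fun a : kˣ => (a : k))
    Units.val_injective.injOn).image .smooth).insert .node).subset fun x hx => ?_
  cases x with
  | generic => exact absurd (mem_localRing_generic f) hx
  | node => exact .inl rfl
  | smooth a => exact .inr ⟨a, fun h => hx (mem_localRing_smooth.2 h), rfl⟩

/-- This ring is the whole field `k(t)`, and the criterion applies with `m = ⊥`. -/
theorem isNoetherianRing_localRing_generic : IsNoetherianRing (localRing (.generic : Point k)) := by
  refine isNoetherianRing_of_dvd_pow ⊥ Submodule.fg_bot (fun f hf => ?_) fun f _ g hg =>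
    ⟨1, by rw [(Submodule.mem_bot _).1 hg]; simp⟩
  have h0 : f.1 ≠ 0 := fun h => hf (Subtype.ext h)
  exact IsUnit.of_mul_eq_one ⟨f.1⁻¹, mem_localRing_generic _⟩
    (Subtype.ext (mul_inv_cancel₀ h0))

/-- The maximal ideal is generated by the uniformizer `t - a`. -/
theorem isNoetherianRing_localRing_smooth (a : kˣ) :
    IsNoetherianRing (localRing (.smooth a : Point k)) := by
  set z : localRing (.smooth a : Point k) :=
    ⟨RatFunc.X - RatFunc.C (a : k), mem_localRing_smooth.2 (.X_sub_C _ _)⟩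
  have hz : z.1 ≠ 0 := X_sub_C_ne_zero _
  refine isNoetherianRing_of_dvd_pow (Ideal.span {z}) (Submodule.fg_span_singleton z)
    (fun f hf => ?_) fun f hf g hg => ?_
  · have h0 : f.1 ≠ 0 := fun h => hf (by rw [show f = 0 from Subtype.ext h]; exact zero_mem _)
    rcases regularAt_div_or_inv (a : k) f.1 with h | h
    · refine absurd (Ideal.mem_span_singleton.2 ⟨⟨_, mem_localRing_smooth.2 h⟩, Subtype.ext ?_⟩) hf
      exact (mul_div_cancel₀ f.1 hz).symm
    · exact IsUnit.of_mul_eq_one ⟨f.1⁻¹, mem_localRing_smooth.2 h⟩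
        (Subtype.ext (mul_inv_cancel₀ h0))
  · obtain ⟨c, rfl⟩ := Ideal.mem_span_singleton.1 hg
    have h0 : f.1 ≠ 0 := fun h => hf (Subtype.ext h)
    obtain ⟨N, hN⟩ := exists_pow_div_regularAt h0 (mem_localRing_smooth.1 c.2)
    exact ⟨N, ⟨_, mem_localRing_smooth.2 (hN N le_rfl)⟩,
      Subtype.ext (mul_div_cancel₀ (((RatFunc.X - RatFunc.C (a : k)) * c.1) ^ N) h0).symm⟩

theorem mem_localRing_node_of_val0_eq_zero {f : RatFunc k} (h : RegularAt 0 f)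
    (h' : RegularAt 0 (swap k f)) (hv : val0 f = 0) (hv' : val0 (swap k f) = 0) :
    f ∈ localRing (.node : Point k) :=
  mem_localRing_node.2 ⟨h, h', (hv'.trans hv.symm).symm⟩

/-- A function regular at `0` and `∞` is a combination of `1` and `1 / (1 + t)` with coefficients in
the local ring of the node. -/
theorem exists_eq_add_mul_sep {f : RatFunc k} (h : RegularAt 0 f) (h' : RegularAt 0 (swap k f)) :
    ∃ α ∈ localRing (.node : Point k), ∃ β ∈ localRing (.node : Point k), f = α + β * sep k := by
  -- The constant `c` is the jump of `f` between the two branches; as `sep` jumps by `1`, the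
  -- difference `f - c * sep` takes equal values at `0` and `∞`.
  set c := RatFunc.C (val0 f - val0 (swap k f)) with hc
  have hs : swap k (f - c * sep k) = swap k f - c * swap k (sep k) := by
    rw [map_sub, map_mul, hc, swap_C]
  have r1 : RegularAt 0 (c * sep k) := (RegularAt.C 0 _).mul regularAt_sep
  have r2 : RegularAt 0 (c * swap k (sep k)) := (RegularAt.C 0 _).mul regularAt_swap_sep
  refine ⟨f - c * sep k, mem_localRing_node.2 ⟨h.sub r1, hs ▸ h'.sub r2, ?_⟩, c,
    C_mem_localRing _ _, by ring⟩
  rw [hs, val0_sub h r1, val0_sub h' r2, val0_mul (RegularAt.C 0 _) regularAt_sep,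
    val0_mul (RegularAt.C 0 _) regularAt_swap_sep, val0_sep, val0_swap_sep, val0_C]
  ring

/-- High powers of a function vanishing at `0` are divisible by any given function. -/
theorem exists_pow_div_vanishing {f g : RatFunc k} (hf : f ≠ 0) (hg : RegularAt 0 g)
    (h : val0 g = 0) :
    ∃ N₀ : ℕ, ∀ N ≥ N₀, RegularAt 0 (g ^ (N + 1) / f) ∧ val0 (g ^ (N + 1) / f) = 0 := by
  obtain ⟨N₀, hN⟩ := exists_pow_div_regularAt (a := 0) hf (hg.div_X h)
  simp only [map_zero, sub_zero, mul_div_cancel₀ g RatFunc.X_ne_zero] at hN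
  refine ⟨N₀, fun N h' => ?_⟩
  -- The extra factor `g` makes the quotient vanish, not merely regular. At the node this ensures
  -- that the values on the two branches agree.
  have e : g ^ (N + 1) / f = g * (g ^ N / f) := by ring
  rw [e]
  exact ⟨hg.mul (hN N h'), by rw [val0_mul hg (hN N h'), h, zero_mul]⟩

/-- High powers of a function vanishing at `0` and `∞` are divisible by any given function in the
local ring of the node. -/
theorem exists_pow_div_mem_localRing_node {f g : RatFunc k} (hf : f ≠ 0)
    (h1 : RegularAt 0 g) (h2 : RegularAt 0 (swap k g)) (hv : val0 g = 0)
    (hv' : val0 (swap k g) = 0) : ∃ N : ℕ, g ^ N / f ∈ localRing (.node : Point k) := by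
  obtain ⟨N₁, hN₁⟩ := exists_pow_div_vanishing hf h1 hv
  obtain ⟨N₂, hN₂⟩ := exists_pow_div_vanishing (swap_ne_zero hf) h2 hv'
  have m1 := hN₁ (max N₁ N₂) (le_max_left _ _)
  have m2 := hN₂ (max N₁ N₂) (le_max_right _ _)
  rw [← map_pow, ← map_div₀] at m2
  exact ⟨max N₁ N₂ + 1, mem_localRing_node_of_val0_eq_zero m1.1 m2.1 m1.2 m2.2⟩

/-- The maximal ideal consists of the functions vanishing on both branches. Division by `van`
identifies it with all functions regular at `0` and `∞`, which are generated over the local ring by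
`1` and `sep`; so `van` and `van * sep` generate it. A function outside of it has equal nonzero
values on the branches, and its inverse lies in the ring. -/
theorem isNoetherianRing_localRing_node : IsNoetherianRing (localRing (.node : Point k)) := by
  have hv := val0_van (k := k)
  have rv := regularAt_van (k := k)
  have rs : RegularAt 0 (van k * sep k) := rv.mul regularAt_sep
  have rs' : RegularAt 0 (swap k (van k * sep k)) := by
    rw [map_mul, swap_van]; exact rv.mul regularAt_swap_sep
  have vs : val0 (van k * sep k) = 0 := by rw [val0_mul rv regularAt_sep, hv, zero_mul]
  have vs' : val0 (swap k (van k * sep k)) = 0 := by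
    rw [map_mul, swap_van, val0_mul rv regularAt_swap_sep, hv, zero_mul]
  set w : localRing (.node : Point k) := ⟨van k, mem_localRing_node_of_val0_eq_zero rv
    (by rwa [swap_van]) hv (by rwa [swap_van])⟩
  set w' : localRing (.node : Point k) := ⟨van k * sep k,
    mem_localRing_node_of_val0_eq_zero rs rs' vs vs'⟩
  have key (f : localRing (.node : Point k)) : f ∈ Ideal.span {w, w'} ↔ val0 f.1 = 0 := by
    obtain ⟨f, hf⟩ := f
    obtain ⟨h1, h2, h3⟩ := mem_localRing_node.1 hf
    rw [Ideal.mem_span_pair]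
    constructor
    · rintro ⟨a, b, hab⟩
      have : f = a.1 * van k + b.1 * (van k * sep k) := (congrArg Subtype.val hab).symm
      have ra := (mem_localRing_node.1 a.2).1
      have rb := (mem_localRing_node.1 b.2).1
      dsimp only
      rw [this, val0_add (ra.mul rv) (rb.mul rs), val0_mul ra rv, val0_mul rb rs, hv, vs]
      ring
    · intro h
      dsimp only at h
      have e : swap k (f / van k) = swap k f / van k := by rw [map_div₀, swap_van]
      obtain ⟨α, hα, β, hβ, h'⟩ := exists_eq_add_mul_sep (regularAt_div_van h1 h)
        (by rw [e]; exact regularAt_div_van h2 (h3 ▸ h))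
      refine ⟨⟨α, hα⟩, ⟨β, hβ⟩, Subtype.ext ?_⟩
      change α * van k + β * (van k * sep k) = f
      rw [div_eq_iff van_ne_zero] at h'
      rw [h']; ring
  refine isNoetherianRing_of_dvd_pow (Ideal.span {w, w'}) (Submodule.fg_span (by simp))
    (fun f hf => ?_) fun f hf g hg => ?_
  · rw [key] at hf
    obtain ⟨h1, h2, h3⟩ := mem_localRing_node.1 f.2
    have h0 : f.1 ≠ 0 := by intro h; rw [h] at hf; exact hf val0_zero
    have hf' : val0 (swap k f.1) ≠ 0 := h3 ▸ hf
    refine IsUnit.of_mul_eq_one ⟨f.1⁻¹, mem_localRing_node.2 ⟨regularAt_inv hf, ?_, ?_⟩⟩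
      (Subtype.ext (mul_inv_cancel₀ h0))
    · rw [map_inv₀]; exact regularAt_inv hf'
    · rw [map_inv₀, val0_inv h1 hf, val0_inv h2 hf', h3]
  · rw [key] at hg
    obtain ⟨h1, h2, h3⟩ := mem_localRing_node.1 g.2
    have h0 : f.1 ≠ 0 := fun h => hf (Subtype.ext h)
    obtain ⟨N, hN⟩ := exists_pow_div_mem_localRing_node h0 h1 h2 hg (h3 ▸ hg)
    exact ⟨N, ⟨_, hN⟩, Subtype.ext (mul_div_cancel₀ (g.1 ^ N) h0).symm⟩

instance isNoetherianRing_localRing (x : Point k) : IsNoetherianRing (localRing x) := by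
  cases x with
  | generic => exact isNoetherianRing_localRing_generic
  | node => exact isNoetherianRing_localRing_node
  | smooth a => exact isNoetherianRing_localRing_smooth a

/-- Every rational function has a denominator in the local ring at `x`. -/
theorem exists_denom_mem_localRing (x : Point k) (c : RatFunc k) :
    ∃ f ≠ 0, f ∈ localRing x ∧ f * c ∈ localRing x := by
  by_cases h0 : c = 0
  · exact ⟨1, one_ne_zero, one_mem _, by rw [h0, mul_zero]; exact zero_mem _⟩
  cases x with
  | generic => exact ⟨1, one_ne_zero, one_mem _, mem_localRing_generic _⟩
  | smooth a =>
    obtain ⟨N, hN⟩ := exists_pow_div_regularAt (inv_ne_zero h0) (RegularAt.one (a : k))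
    have := hN N le_rfl
    rw [div_inv_eq_mul, mul_one] at this
    exact ⟨_, pow_ne_zero N (X_sub_C_ne_zero (a : k)),
      mem_localRing_smooth.2 ((RegularAt.X_sub_C _ _).pow N), mem_localRing_smooth.2 this⟩
  | node =>
    have h : swap k (van k) = van k := swap_van
    obtain ⟨N, hN⟩ := exists_pow_div_mem_localRing_node (inv_ne_zero h0) (regularAt_van (k := k))
      (by rw [h]; exact regularAt_van) val0_van (by rw [h]; exact val0_van)
    rw [div_inv_eq_mul] at hN
    refine ⟨_, pow_ne_zero N van_ne_zero, pow_mem ?_ N, hN⟩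
    exact mem_localRing_node_of_val0_eq_zero regularAt_van (by rw [h]; exact regularAt_van)
      val0_van (by rw [h]; exact val0_van)

theorem exists_denom_mem_localRing_pi {ι : Type*} [Finite ι] (x : Point k) (c : ι → RatFunc k) :
    ∃ f ≠ 0, ∀ i, f * c i ∈ localRing x := by
  classical
  have := Fintype.ofFinite ι
  choose f hf0 hf hfc using fun i => exists_denom_mem_localRing x (c i)
  refine ⟨∏ i, f i, Finset.prod_ne_zero_iff.2 fun i _ => hf0 i, fun i => ?_⟩
  rw [← Finset.prod_erase_mul _ _ (Finset.mem_univ i), mul_assoc]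
  exact mul_mem (prod_mem fun j _ => hf j) (hfc i)

/-! ### Open sets -/

theorem generic_mem {U : Opens (nodalCurve k)} {y : Point k} (hy : y ∈ U) :
    (Point.generic : Point k) ∈ U :=
  (U.isOpen ⟨y, hy⟩).1

/-- A condition which holds at `y`, at the generic point and at all but finitely many points, holds
in a neighborhood of `y`. -/
theorem exists_open_forall {U : Opens (nodalCurve k)} {y : Point k} (hy : y ∈ U)
    {Q : Point k → Prop} (hQ : {x | ¬ Q x}.Finite) (hg : Q .generic) (hQy : Q y) :
    ∃ W : Opens (nodalCurve k), W ≤ U ∧ y ∈ W ∧ ∀ x ∈ W, Q x := by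
  refine ⟨⟨{x : Point k | x ∈ U ∧ Q x}, fun _ => ⟨⟨generic_mem hy, hg⟩, ?_⟩⟩,
    fun x hx => hx.1, ⟨hy, hQy⟩, fun x hx => hx.2⟩
  refine ((U.isOpen ⟨y, hy⟩).2.union hQ).subset fun x hx => ?_
  by_cases h : x ∈ U
  · exact .inr fun hq => hx ⟨h, hq⟩
  · exact .inl h

open StalkwiseSheaf

/-- Sections over an open subset of the nodal curve are constant. -/
theorem eq_of_pred {R : Type u} {S : Point k → Set R} {U : Opens (TopCat.of (Point k))} {f : U → R}
    (hf : (pred (X := TopCat.of (Point k)) S).pred f) (x y : U) : f x = f y := by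
  have key (x : U) : f x = f ⟨.generic, generic_mem x.2⟩ := by
    -- The fibre through `x` is open and nonempty, so it contains the generic point.
    have ho := hf.1.isOpen_fiber (f x)
    obtain ⟨W, hW, hW'⟩ := isOpen_induced_iff.1 ho
    have hx : x.1 ∈ W := by
      have : x ∈ Subtype.val ⁻¹' W := by rw [hW']; rfl
      exact this
    have : (⟨.generic, generic_mem x.2⟩ : U) ∈ Subtype.val ⁻¹' W := (hW ⟨_, hx⟩).1
    rw [hW'] at this
    exact this.symm
  rw [key x, key y]

/-- The constant section with value `r`. -/
theorem pred_const {R : Type u} {S : Point k → Set R} {U : Opens (TopCat.of (Point k))} {r : R}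
    (hr : ∀ x ∈ U, r ∈ S x) : (pred (X := TopCat.of (Point k)) S).pred (fun _ : U => r) :=
  ⟨IsLocallyConstant.const r, fun x => hr x.1 x.2⟩


open SphericalOrder StalkwiseSheaf

variable {k : Type u} [Field k]

/-! ### Combinations with coefficients in the local rings -/

section Combination

variable {V : Type*} [AddCommGroup V] [Module (RatFunc k) V]

/-- `c` is a linear combination of the `g i` with coefficients in the local ring at `x`. -/
def IsCombAt {ι : Type*} [Fintype ι] (x : Point k) (g : ι → V) (c : V) : Prop :=
  ∃ b : ι → RatFunc k, (∀ i, b i ∈ localRing x) ∧ c = ∑ i, b i • g i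

variable {ι κ : Type*} [Fintype ι] [Fintype κ]

theorem IsCombAt.trans {x : Point k} {g : ι → V} {v : κ → V} {c : V} (hc : IsCombAt x v c)
    (hv : ∀ p, IsCombAt x g (v p)) : IsCombAt x g c := by
  obtain ⟨b, hb, rfl⟩ := hc
  choose a ha h using hv
  refine ⟨fun i => ∑ p, b p * a p i, fun i => sum_mem fun p _ => mul_mem (hb p) (ha p i), ?_⟩
  simp_rw [Finset.sum_smul, mul_smul]
  rw [Finset.sum_comm]
  refine Finset.sum_congr rfl fun p _ => ?_
  rw [h p, Finset.smul_sum]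

/-- A finite family spanning (rationally) a family `v`, generates at almost all points at which `v`
generates. -/
theorem finite_not_isCombAt {L : Point k → Set V} {g : ι → V} {v : κ → V}
    (hv : ∀ p, v p ∈ Submodule.span (RatFunc k) (Set.range g))
    (h : {x | ¬ ∀ c ∈ L x, IsCombAt x v c}.Finite) :
    {x | ¬ ∀ c ∈ L x, IsCombAt x g c}.Finite := by
  simp_rw [Submodule.mem_span_range_iff_exists_fun] at hv
  choose a ha using hv
  -- The exceptional points are those at which `v` fails to generate, and those at which one of the
  -- finitely many coefficients expressing `v` through `g` is not in the local ring.
  refine (h.union (Set.finite_iUnion fun p => Set.finite_iUnion fun i =>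
    finite_notMem_localRing (a p i))).subset fun x hx => ?_
  by_contra hc
  simp only [Set.mem_union, Set.mem_iUnion, not_or, not_exists, Set.mem_ofPred_eq, not_not] at hc
  exact hx fun c hcL => (hc.1 c hcL).trans fun p => ⟨a p, hc.2 p, (ha p).symm⟩

theorem isCombAt_generic {L : Set V} {g : ι → V} {v : κ → V}
    (hv : ∀ p, v p ∈ Submodule.span (RatFunc k) (Set.range g))
    (h : ∀ c ∈ L, IsCombAt (.generic : Point k) v c) (c : V) (hc : c ∈ L) :
    IsCombAt (.generic : Point k) g c := by
  simp_rw [Submodule.mem_span_range_iff_exists_fun] at hv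
  choose a ha using hv
  exact (h c hc).trans fun p => ⟨a p, fun i => mem_localRing_generic _, (ha p).symm⟩

/-- The `g i` need not belong to `T`: they only place `T` inside a finitely generated module, and
noetherianity then gives generators in `T` itself. -/
theorem exists_finite_generators {x : Point k} (T : Submodule (localRing x) V) (g : ι → V)
    (h : ∀ c ∈ T, IsCombAt x g c) :
    ∃ (N : ℕ) (r : Fin N → V), (∀ l, r l ∈ T) ∧ ∀ c ∈ T, IsCombAt x r c := by
  have hT : T.FG := by
    refine Submodule.FG.of_le (T := Submodule.span (localRing x) (Set.range g))
      (Submodule.fg_span (Set.finite_range g)) fun c hc => ?_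
    obtain ⟨b, hb, rfl⟩ := h c hc
    exact sum_mem fun i _ => Submodule.smul_mem _ (⟨b i, hb i⟩ : localRing x)
      (Submodule.subset_span ⟨i, rfl⟩)
  obtain ⟨N, r, rfl⟩ := Submodule.fg_iff_exists_fin_generating_family.1 hT
  refine ⟨N, r, fun l => Submodule.subset_span ⟨l, rfl⟩, fun c hc => ?_⟩
  obtain ⟨b, hb⟩ := (Submodule.mem_span_range_iff_exists_fun _).1 hc
  exact ⟨fun i => b i, fun i => (b i).2, hb.symm⟩

end Combination

/-! ### Stalks of the order -/

section Stalk

variable {n : ℕ} {d : Fin n → ℤ}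
  {I : Subalgebra k (Matrix (Fin n) (Fin n) k × Matrix (Fin n) (Fin n) k)}

theorem mem_orderStalk_generic (M : Matrix (Fin n) (Fin n) (RatFunc k)) :
    M ∈ orderStalk d I (.generic : Point k) :=
  ⟨fun p hp => by rw [proj_eq_generic_iff.1 hp]; intro i j; trivial, fun h => by cases h⟩

theorem mem_orderStalk_smooth {a : kˣ} {M : Matrix (Fin n) (Fin n) (RatFunc k)} :
    M ∈ orderStalk d I (.smooth a) ↔ ∀ i j, RegularAt (a : k) (M i j) :=
  ⟨fun h => h.1 _ (proj_eq_smooth_iff.2 rfl), fun h => ⟨fun p hp => by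
    rw [proj_eq_smooth_iff.1 hp]; exact h, fun h => by cases h⟩⟩

/-- The matrix of functions corresponding to a matrix of sections of the `𝒪(d i - d j)`, by means of
the trivialization `1 + t` of `𝒪(1)`. -/
noncomputable def twist (d : Fin n → ℤ) (G : Matrix (Fin n) (Fin n) (RatFunc k)) :
    Matrix (Fin n) (Fin n) (RatFunc k) :=
  .of fun i j => oneAddX k ^ (d i - d j) * G i j

theorem twist_apply (G : Matrix (Fin n) (Fin n) (RatFunc k)) (i j : Fin n) :
    twist d G i j = oneAddX k ^ (d i - d j) * G i j := rfl

theorem exists_twist_eq (M : Matrix (Fin n) (Fin n) (RatFunc k)) : ∃ G, twist d G = M := by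
  choose G hG using fun i j => exists_eq_twist (d i - d j) (M i j)
  exact ⟨.of G, Matrix.ext fun i j => (hG i j).symm⟩

/-- The trivializations by `1 + t` agree with `x₀` at `0` and with `x₁` at `∞`, because `1 + t` and
its analogue in `1/t` have value `1` there. Hence twisting removes the bundle from the stalk at the
node without changing the pair of values. -/
theorem twist_mem_orderStalk_node {G : Matrix (Fin n) (Fin n) (RatFunc k)} :
    twist d G ∈ orderStalk d I (.node : Point k) ↔
      (∀ i j, RegularAt 0 (G i j) ∧ RegularAt 0 (swap k (G i j))) ∧
      (matVal0 G, (.of fun i j => val0 (swap k (G i j)))) ∈ I := by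
  have h1 : ∀ i j, IsSectionAt (d i - d j) (.finite 0) (twist d G i j) ↔ RegularAt 0 (G i j) :=
    fun i j => regularAt_twist_iff _ _
  have h2 : ∀ i j, IsSectionAt (d i - d j) .infty (twist d G i j) ↔ RegularAt 0 (swap k (G i j)) :=
    fun i j => isSectionAt_infty_twist_iff _ _
  have h3 (h : ∀ i j, RegularAt 0 (G i j) ∧ RegularAt 0 (swap k (G i j))) :
      (matVal0 (twist d G), matValInfty d (twist d G)) =
        (matVal0 G, .of fun i j => val0 (swap k (G i j))) :=
    Prod.ext (Matrix.ext fun i j => val0_twist _ (h i j).1)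
      (Matrix.ext fun i j => valInfty_twist _ (h i j).2)
  constructor
  · intro h
    have hr : ∀ i j, RegularAt 0 (G i j) ∧ RegularAt 0 (swap k (G i j)) := fun i j =>
      ⟨(h1 i j).1 (h.1 _ proj_zero i j), (h2 i j).1 (h.1 .infty rfl i j)⟩
    exact ⟨hr, h3 hr ▸ h.2 rfl⟩
  · intro h
    refine ⟨fun p hp i j => ?_, fun _ => ?_⟩
    · rcases proj_eq_node_iff.1 hp with rfl | rfl
      exacts [(h1 i j).2 (h.1 i j).1, (h2 i j).2 (h.1 i j).2]
    · rw [h3 h.1]; exact h.2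

theorem single_mem_orderStalk_of_ne_node {x : Point k} (hx : x ≠ .node) (i j : Fin n) :
    Matrix.single i j (1 : RatFunc k) ∈ orderStalk d I x := by
  cases x with
  | generic => exact mem_orderStalk_generic _
  | node => exact absurd rfl hx
  | smooth a =>
    refine mem_orderStalk_smooth.2 fun i' j' => ?_
    rw [Matrix.single_apply]
    split_ifs
    exacts [RegularAt.one _, RegularAt.zero _]

theorem entry_mem_localRing_of_ne_node {x : Point k} (hx : x ≠ .node)
    {M : Matrix (Fin n) (Fin n) (RatFunc k)} (hM : M ∈ orderStalk d I x) (i j : Fin n) :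
    M i j ∈ localRing x := by
  cases x with
  | generic => exact mem_localRing_generic _
  | node => exact absurd rfl hx
  | smooth a => exact mem_localRing_smooth.2 (mem_orderStalk_smooth.1 hM i j)

theorem mem_orderStalk_of_ne_node {x : Point k} (hx : x ≠ .node)
    {M : Matrix (Fin n) (Fin n) (RatFunc k)} (hM : ∀ i j, M i j ∈ localRing x) :
    M ∈ orderStalk d I x := by
  cases x with
  | generic => exact mem_orderStalk_generic _
  | node => exact absurd rfl hx
  | smooth a => exact mem_orderStalk_smooth.2 fun i j => mem_localRing_smooth.1 (hM i j)

theorem finite_notMem_orderStalk (M : Matrix (Fin n) (Fin n) (RatFunc k)) :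
    {x : Point k | M ∉ orderStalk d I x}.Finite := by
  refine ((Set.finite_iUnion fun i => Set.finite_iUnion fun j =>
    finite_notMem_localRing (M i j)).insert .node).subset fun x hx => ?_
  by_contra hc
  simp only [Set.mem_insert_iff, Set.mem_iUnion, not_or, not_exists, Set.mem_ofPred_eq,
    not_not] at hc
  exact hx (mem_orderStalk_of_ne_node hc.1 hc.2)

theorem isCombAt_single {x : Point k} (hx : x ≠ .node)
    {M : Matrix (Fin n) (Fin n) (RatFunc k)} (hM : M ∈ orderStalk d I x) :
    IsCombAt x (fun p : Fin n × Fin n => Matrix.single p.1 p.2 (1 : RatFunc k)) M := by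
  refine ⟨fun p => M p.1 p.2, fun p => entry_mem_localRing_of_ne_node hx hM _ _, ?_⟩
  conv_lhs => rw [Matrix.matrix_eq_sum_single M]
  rw [Fintype.sum_prod_type]
  simp [Matrix.smul_single]

theorem smul_mem_orderStalk {x : Point k} {f : RatFunc k} (hf : f ∈ localRing x)
    {M : Matrix (Fin n) (Fin n) (RatFunc k)} (hM : M ∈ orderStalk d I x) :
    f • M ∈ orderStalk d I x := by
  have := mul_mem (scalar_mem_orderStalk d I x hf) hM
  rwa [Matrix.scalar_apply, ← Matrix.smul_eq_diagonal_mul] at this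

/-- The stalk of the order as a module over the local ring. -/
def orderSubmodule (d : Fin n → ℤ)
    (I : Subalgebra k (Matrix (Fin n) (Fin n) k × Matrix (Fin n) (Fin n) k)) (x : Point k) :
    Submodule (localRing x) (Matrix (Fin n) (Fin n) (RatFunc k)) where
  carrier := orderStalk d I x
  zero_mem' := zero_mem _
  add_mem' := add_mem
  smul_mem' f _ hM := smul_mem_orderStalk f.2 hM

/-- At the node the order sits inside the twisted matrices regular on both branches, and each entry
of these is a combination of `1` and `sep` over the local ring. The generators of that larger module
do not depend on `I`; noetherianity does the rest. -/
theorem exists_generators_orderStalk (x : Point k) :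
    ∃ (N : ℕ) (r : Fin N → Matrix (Fin n) (Fin n) (RatFunc k)),
      (∀ l, r l ∈ orderStalk d I x) ∧ ∀ M ∈ orderStalk d I x, IsCombAt x r M := by
  by_cases hx : x = .node
  · subst hx
    refine exists_finite_generators (orderSubmodule d I .node)
      (fun p : (Fin n × Fin n) × Fin 2 => twist d (Matrix.single p.1.1 p.1.2 (![1, sep k] p.2)))
      fun M hM => ?_
    obtain ⟨G, rfl⟩ := exists_twist_eq (d := d) M
    have hG := (twist_mem_orderStalk_node.1 hM).1
    choose α hα β hβ h using fun i j => exists_eq_add_mul_sep (hG i j).1 (hG i j).2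
    refine ⟨fun p => ![α p.1.1 p.1.2, β p.1.1 p.1.2] p.2, fun ⟨⟨i, j⟩, e⟩ => ?_, ?_⟩
    · fin_cases e
      exacts [hα i j, hβ i j]
    · ext i j
      rw [Matrix.sum_apply, Fintype.sum_prod_type, Finset.sum_eq_single (i, j)]
      · simp [twist_apply, h i j]; ring
      · rintro ⟨i', j'⟩ - hne
        refine Finset.sum_eq_zero fun e _ => ?_
        have : ¬ (i' = i ∧ j' = j) := fun h => hne (Prod.ext h.1 h.2)
        simp [twist_apply, this]
      · simp
  · exact exists_finite_generators (orderSubmodule d I x) _ fun M hM => isCombAt_single hx hM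

theorem twist_single (i j : Fin n) (f : RatFunc k) :
    twist d (Matrix.single i j f) = Matrix.single i j (oneAddX k ^ (d i - d j) * f) := by
  ext i' j'
  by_cases h : i = i' ∧ j = j'
  · obtain ⟨rfl, rfl⟩ := h; simp [twist_apply]
  · simp [twist_apply, h]

/-- Sections of `ℰnd(𝒱)` vanishing at `0` and `∞` are in the order. -/
theorem twist_single_van_mem_orderStalk_node (i j : Fin n) {g : RatFunc k} (hg : RegularAt 0 g)
    (hg' : RegularAt 0 (swap k g)) :
    twist d (Matrix.single i j (van k * g)) ∈ orderStalk d I (.node : Point k) := by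
  have e : swap k (van k * g) = van k * swap k g := by rw [map_mul, swap_van]
  have h1 : val0 (van k * g) = 0 := by rw [val0_mul regularAt_van hg, val0_van, zero_mul]
  have h2 : val0 (swap k (van k * g)) = 0 := by
    rw [e, val0_mul regularAt_van hg', val0_van, zero_mul]
  rw [twist_mem_orderStalk_node]
  have h0 : (matVal0 (Matrix.single i j (van k * g)),
      Matrix.of fun i' j' => val0 (swap k (Matrix.single i j (van k * g) i' j'))) = 0 := by
    refine Prod.ext (Matrix.ext fun i' j' => ?_) (Matrix.ext fun i' j' => ?_)
    · simp only [matVal0, Matrix.of_apply, Matrix.single_apply]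
      split_ifs
      exacts [h1, val0_zero]
    · simp only [Matrix.of_apply, Matrix.single_apply]
      split_ifs
      exacts [h2, by rw [map_zero]; exact val0_zero]
  refine ⟨fun i' j' => ?_, h0 ▸ I.zero_mem⟩
  rw [Matrix.single_apply]
  split_ifs
  · exact ⟨regularAt_van.mul hg, e ▸ regularAt_van.mul hg'⟩
  · rw [map_zero]; exact ⟨RegularAt.zero 0, RegularAt.zero 0⟩

/-- This shows that generators of a stalk span all matrices over `k(t)`. At the node a factor `van`
makes both values zero, so the condition given by `I` is harmless. -/
theorem exists_single_mem_orderStalk (x : Point k) (i j : Fin n) :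
    ∃ f : RatFunc k, f ≠ 0 ∧ Matrix.single i j f ∈ orderStalk d I x := by
  by_cases hx : x = .node
  · subst hx
    have := twist_single_van_mem_orderStalk_node (d := d) (I := I) i j (RegularAt.one 0)
      (by rw [map_one]; exact RegularAt.one 0)
    rw [twist_single, mul_one] at this
    exact ⟨_, mul_ne_zero (zpow_ne_zero _ oneAddX_ne_zero) van_ne_zero, this⟩
  · exact ⟨1, one_ne_zero, single_mem_orderStalk_of_ne_node hx i j⟩

end Stalk


open SphericalOrder StalkwiseSheaf

variable {k : Type u} [Field k]

/-! ### Sections of the structure sheaf and of the order -/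

/-- The germ at `x ∈ U` of a function, as a rational function. -/
noncomputable def fnEval {U : Opens (nodalCurve k)} {x : Point k} (hx : x ∈ U) :
    Fn (nodalCurve k) U →+* RatFunc k :=
  (Pi.evalRingHom (fun _ : U => RatFunc k) ⟨x, hx⟩).comp
    (ringSections (X := TopCat.of (Point k)) localRing U).subtype

/-- The function on `U` given by a rational function. -/
noncomputable def constFn {U : Opens (nodalCurve k)} (f : RatFunc k)
    (hf : ∀ x ∈ U, f ∈ localRing x) : Fn (nodalCurve k) U :=
  (⟨fun _ => f, pred_const hf⟩ : ringSections (X := TopCat.of (Point k)) localRing U)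

theorem fnEval_constFn {U : Opens (nodalCurve k)} {x : Point k} (hx : x ∈ U) (f : RatFunc k)
    (hf : ∀ x ∈ U, f ∈ localRing x) : fnEval hx (constFn f hf) = f := rfl

theorem fnEval_res {U V : Opens (nodalCurve k)} (h : V ≤ U) {x : Point k} (hx : x ∈ V)
    (f : Fn (nodalCurve k) U) : fnEval hx (Fn.res h f) = fnEval (h hx) f := rfl

theorem fnEval_eq {U : Opens (nodalCurve k)} {x y : Point k} (hx : x ∈ U) (hy : y ∈ U)
    (f : Fn (nodalCurve k) U) : fnEval hx f = fnEval hy f :=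
  eq_of_pred (k := k) (U := U) (f := f.1) (S := fun x => (localRing x : Set (RatFunc k))) f.2
    ⟨x, hx⟩ ⟨y, hy⟩

theorem fnEval_mem {U : Opens (nodalCurve k)} {x y : Point k} (hx : x ∈ U) (hy : y ∈ U)
    (f : Fn (nodalCurve k) U) : fnEval hx f ∈ localRing y := by
  rw [fnEval_eq hx hy]
  exact f.2.2 ⟨y, hy⟩

theorem fnEval_injective {U : Opens (nodalCurve k)} {x : Point k} (hx : x ∈ U) :
    Function.Injective (fnEval hx) := fun f g h =>
  Subtype.ext (funext fun y => by
    have h1 := fnEval_eq hx y.2 f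
    have h2 := fnEval_eq hx y.2 g
    exact h1.symm.trans (h.trans h2))

theorem fn_subsingleton {U : Opens (nodalCurve k)} (hU : ∀ x, x ∉ U) :
    Subsingleton (Fn (nodalCurve k) U) :=
  ⟨fun _ _ => Subtype.ext (funext fun y => absurd y.2 (hU y.1))⟩

variable {n : ℕ} {d : Fin n → ℤ}
  {I : Subalgebra k (Matrix (Fin n) (Fin n) k × Matrix (Fin n) (Fin n) k)}

/-- The germ at `x ∈ U` of a section of the order, as a matrix of rational functions. -/
noncomputable def secEval {U : Opens (nodalCurve k)} {x : Point k} (hx : x ∈ U) :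
    (orderSheaf d I).Sections U →+* Matrix (Fin n) (Fin n) (RatFunc k) :=
  (Pi.evalRingHom (fun _ : U => Matrix (Fin n) (Fin n) (RatFunc k)) ⟨x, hx⟩).comp
    (ringSections (X := TopCat.of (Point k)) (orderStalk d I) U).subtype

/-- The section over `U` given by a matrix of rational functions. -/
noncomputable def constSec {U : Opens (nodalCurve k)} (M : Matrix (Fin n) (Fin n) (RatFunc k))
    (hM : ∀ x ∈ U, M ∈ orderStalk d I x) : (orderSheaf d I).Sections U :=
  (⟨fun _ => M, pred_const hM⟩ : ringSections (X := TopCat.of (Point k)) (orderStalk d I) U)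

theorem secEval_constSec {U : Opens (nodalCurve k)} {x : Point k} (hx : x ∈ U)
    (M : Matrix (Fin n) (Fin n) (RatFunc k)) (hM : ∀ x ∈ U, M ∈ orderStalk d I x) :
    secEval hx (constSec M hM) = M := rfl

theorem secEval_res {U V : Opens (nodalCurve k)} (h : V ≤ U) {x : Point k} (hx : x ∈ V)
    (s : (orderSheaf d I).Sections U) :
    secEval hx ((orderSheaf d I).res h s) = secEval (h hx) s := rfl

theorem secEval_unitMap {U : Opens (nodalCurve k)} {x : Point k} (hx : x ∈ U)
    (f : Fn (nodalCurve k) U) :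
    secEval hx ((orderSheaf d I).unitMap U f) = Matrix.scalar (Fin n) (fnEval hx f) := rfl

theorem secEval_eq {U : Opens (nodalCurve k)} {x y : Point k} (hx : x ∈ U) (hy : y ∈ U)
    (s : (orderSheaf d I).Sections U) : secEval hx s = secEval hy s :=
  eq_of_pred (k := k) (U := U) (f := s.1)
    (S := fun x => (orderStalk d I x : Set (Matrix (Fin n) (Fin n) (RatFunc k)))) s.2
    ⟨x, hx⟩ ⟨y, hy⟩

theorem secEval_mem {U : Opens (nodalCurve k)} {x y : Point k} (hx : x ∈ U) (hy : y ∈ U)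
    (s : (orderSheaf d I).Sections U) : secEval hx s ∈ orderStalk d I y := by
  rw [secEval_eq hx hy]
  exact s.2.2 ⟨y, hy⟩

theorem secEval_injective {U : Opens (nodalCurve k)} {x : Point k} (hx : x ∈ U) :
    Function.Injective (secEval (d := d) (I := I) hx) := fun f g h =>
  Subtype.ext (funext fun y => by
    have h1 := secEval_eq hx y.2 f
    have h2 := secEval_eq hx y.2 g
    exact h1.symm.trans (h.trans h2))

theorem sections_subsingleton {U : Opens (nodalCurve k)} (hU : ∀ x, x ∉ U) :
    Subsingleton ((orderSheaf d I).Sections U) :=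
  ⟨fun _ _ => Subtype.ext (funext fun y => absurd y.2 (hU y.1))⟩

/-- A section of the underlying module of the order, as a section of the order. -/
noncomputable def ofSec {U : Opens (nodalCurve k)} (s : Sec (orderSheaf d I).toModules U) :
    (orderSheaf d I).Sections U := s

/-- The germ at `x ∈ U` of a section of the underlying module of the order. -/
noncomputable def modEval {U : Opens (nodalCurve k)} {x : Point k} (hx : x ∈ U) :
    Sec (orderSheaf d I).toModules U →+ Matrix (Fin n) (Fin n) (RatFunc k) where
  toFun s := secEval hx (ofSec s)
  map_zero' := rfl
  map_add' _ _ := rfl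

theorem modEval_toSec {U : Opens (nodalCurve k)} {x : Point k} (hx : x ∈ U)
    (s : (orderSheaf d I).Sections U) : modEval hx ((orderSheaf d I).toSec s) = secEval hx s := rfl

theorem modEval_res {U V : Opens (nodalCurve k)} (h : V ≤ U) {x : Point k} (hx : x ∈ V)
    (s : Sec (orderSheaf d I).toModules U) : modEval hx (Sec.res h s) = modEval (h hx) s := rfl

theorem modEval_smul {U : Opens (nodalCurve k)} {x : Point k} (hx : x ∈ U)
    (f : Fn (nodalCurve k) U) (s : Sec (orderSheaf d I).toModules U) :
    modEval hx (f • s) = fnEval hx f • modEval hx s := by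
  rw [Matrix.smul_eq_diagonal_mul]; rfl

theorem modEval_injective {U : Opens (nodalCurve k)} {x : Point k} (hx : x ∈ U) :
    Function.Injective (modEval (d := d) (I := I) hx) := secEval_injective hx

theorem isTorsionFree_order : IsTorsionFree (orderSheaf d I).toModules := by
  intro U f s h
  by_cases hU : ∃ x, x ∈ U
  · obtain ⟨x, hx⟩ := hU
    change Point k at x
    have h' := congrArg (modEval hx) h
    rw [modEval_smul, map_zero, smul_eq_zero] at h'
    exact h'.imp (fun e => fnEval_injective hx (e.trans (map_zero _).symm))
      fun e => modEval_injective hx (e.trans (map_zero _).symm)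
  -- Over the empty set the ring of functions is zero.
  · exact .inl ((fn_subsingleton (by simpa using hU)).elim _ _)

/-! ### Coherence -/

theorem exists_open_mem_localRing {ι : Type*} [Finite ι] {U : Opens (nodalCurve k)} {y : Point k}
    (hy : y ∈ U) (b : ι → RatFunc k) (hb : ∀ i, b i ∈ localRing y) :
    ∃ W : Opens (nodalCurve k), W ≤ U ∧ y ∈ W ∧ ∀ x ∈ W, ∀ i, b i ∈ localRing x := by
  refine exists_open_forall hy ((Set.finite_iUnion fun i => finite_notMem_localRing (b i)).subset
    fun x hx => ?_) (fun i => mem_localRing_generic _) hb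
  simpa using hx

/-- Generators of the stalk at `y` span all matrices over `k(t)`. Elementary matrices generate every
stalk away from the node, so the former generate at almost all points, and `exists_open_forall`
removes the bad ones. -/
theorem isFiniteType_order : IsFiniteType (orderSheaf d I).toModules := by
  intro y
  change Point k at y
  obtain ⟨N, r, hr, hgen⟩ := exists_generators_orderStalk (d := d) (I := I) y
  set v := fun p : Fin n × Fin n => Matrix.single p.1 p.2 (1 : RatFunc k)
  have hv : ∀ p, v p ∈ Submodule.span (RatFunc k) (Set.range r) := by
    intro p
    obtain ⟨f, hf0, hf⟩ := exists_single_mem_orderStalk (d := d) (I := I) y p.1 p.2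
    obtain ⟨b, -, hb⟩ := hgen _ hf
    have : v p = f⁻¹ • Matrix.single p.1 p.2 f := by
      rw [Matrix.smul_single, smul_eq_mul, inv_mul_cancel₀ hf0]
    rw [this, hb]
    exact Submodule.smul_mem _ _ (sum_mem fun i _ => Submodule.smul_mem _ _
      (Submodule.subset_span ⟨i, rfl⟩))
  have hfin := finite_not_isCombAt (L := fun x => orderStalk d I x) hv
    ((Set.finite_singleton .node).subset fun x hx => by
      by_contra h
      exact hx fun c hc => isCombAt_single h hc)
  obtain ⟨U, -, hyU, hU⟩ := exists_open_forall (U := ⊤) (y := y) trivial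
    (Q := fun x => (∀ l, r l ∈ orderStalk d I x) ∧ ∀ c ∈ orderStalk d I x, IsCombAt x r c)
    (((Set.finite_iUnion fun l => finite_notMem_orderStalk (d := d) (I := I) (r l)).union
      hfin).subset fun x hx => by
        by_contra hc
        simp only [Set.mem_union, Set.mem_iUnion, not_or, not_exists, Set.mem_ofPred_eq,
          not_not] at hc
        exact hx hc)
    ⟨fun l => mem_orderStalk_generic _, isCombAt_generic hv fun c hc =>
      isCombAt_single (d := d) (I := I) (by simp) hc⟩ ⟨hr, hgen⟩
  refine ⟨U, N, fun l => (orderSheaf d I).toSec (constSec (r l) fun x hx => (hU x hx).1 l), hyU, ?_⟩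
  intro V hV s z hz
  change Point k at z
  -- The coefficients found in the stalk at `z` belong to the local rings on a neighbourhood, which
  -- turns the combination of germs into one of sections.
  obtain ⟨b, hb, hs⟩ := (hU z (hV hz)).2 _ (secEval_mem hz hz (ofSec s))
  obtain ⟨W, hWV, hzW, hW⟩ := exists_open_mem_localRing hz b hb
  refine ⟨W, hWV, hzW, (Submodule.mem_span_range_iff_exists_fun _).2
    ⟨fun l => constFn (b l) fun x hx => hW x hx l, modEval_injective hzW ?_⟩⟩
  rw [map_sum, modEval_res]
  refine Eq.trans (Finset.sum_congr rfl fun l _ => ?_) hs.symm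
  rw [modEval_smul]; rfl

/-- The relations at `x` are the vectors of `ker φ` with coordinates in the local ring at `x`. At
`y` they form a finitely generated module by noetherianity, and its generators work at almost all
points. -/
theorem exists_generatesRelations {U : Opens (nodalCurve k)} {N : ℕ}
    (s : Fin N → Sec (orderSheaf d I).toModules U) {y : Point k} (hy : y ∈ U) :
    ∃ (V : Opens (nodalCurve k)) (hV : V ≤ U) (m : ℕ) (r : Fin m → Fin N → Fn (nodalCurve k) V),
      y ∈ V ∧ GeneratesRelations (orderSheaf d I).toModules (fun i => Sec.res hV (s i)) r := by
  set φ := Fintype.linearCombination (RatFunc k) fun i => modEval hy (s i)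
  have hφ (c : Fin N → RatFunc k) : φ c = ∑ i, c i • modEval hy (s i) := rfl
  have modEval_eq {V : Opens (nodalCurve k)} (hV : V ≤ U) {z : Point k} (hz : z ∈ V) (i : Fin N) :
      modEval hz (Sec.res hV (s i)) = modEval hy (s i) := secEval_eq _ _ _
  let L (x : Point k) : Set (Fin N → RatFunc k) := {c | φ c = 0 ∧ ∀ i, c i ∈ localRing x}
  let T : Submodule (localRing y) (Fin N → RatFunc k) :=
    { carrier := L y
      zero_mem' := ⟨map_zero φ, fun _ => zero_mem _⟩
      add_mem' := fun h h' => ⟨by rw [map_add, h.1, h'.1, add_zero],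
        fun i => add_mem (h.2 i) (h'.2 i)⟩
      smul_mem' := fun f c h => ⟨by
        change φ (f.1 • c) = 0
        rw [map_smul, h.1, smul_zero], fun i => mul_mem f.2 (h.2 i)⟩ }
  have hsum (c : Fin N → RatFunc k) : c = ∑ i, c i • (Pi.single i 1 : Fin N → RatFunc k) := by
    ext j; simp [Finset.sum_apply, Pi.single_apply]
  obtain ⟨m, r, hr, hgen⟩ := exists_finite_generators T
    (fun i => (Pi.single i 1 : Fin N → RatFunc k)) fun c hc => ⟨c, hc.2, hsum c⟩
  -- A linear projection `q` onto the rational relations fixes each relation `c`, so `c = ∑ c i •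
  -- q(e i)` with the coordinates of `c` itself as coefficients. Thus the fixed vectors `v i = q(e
  -- i)` generate at every point, although they need not be relations with coefficients in the local
  -- ring.
  obtain ⟨q, hq⟩ := (LinearMap.ker φ).subtype.exists_leftInverse_of_injective
    (Submodule.ker_subtype _)
  set v : Fin N → Fin N → RatFunc k := fun i => (q (Pi.single i 1)).1
  have hLv (x : Point k) : ∀ c ∈ L x, IsCombAt x v c := by
    intro c hc
    refine ⟨c, hc.2, ?_⟩
    have h1 : q c = ⟨c, hc.1⟩ := LinearMap.congr_fun hq ⟨c, hc.1⟩
    have h2 : (q c).1 = ∑ i, c i • v i := by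
      conv_lhs => rw [hsum c, map_sum]
      simp [v]
    rw [← h2, h1]
  have hv : ∀ i, v i ∈ Submodule.span (RatFunc k) (Set.range r) := by
    intro i
    -- Clearing denominators moves `v i` into the lattice of relations at `y`, where `r` generates.
    obtain ⟨f, hf0, hf⟩ := exists_denom_mem_localRing_pi y (v i)
    have hker : φ (v i) = 0 := (q (Pi.single i 1)).2
    obtain ⟨b, -, hb⟩ := hgen (f • v i) ⟨by rw [map_smul, hker, smul_zero], hf⟩
    have : v i = f⁻¹ • (f • v i) := by rw [smul_smul, inv_mul_cancel₀ hf0, one_smul]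
    rw [this, hb]
    exact Submodule.smul_mem _ _ (sum_mem fun i _ => Submodule.smul_mem _ _
      (Submodule.subset_span ⟨i, rfl⟩))
  have hfin := finite_not_isCombAt (L := L) hv (Set.finite_empty.subset fun x hx => hx (hLv x))
  obtain ⟨V, hVU, hyV, hV⟩ := exists_open_forall hy
    (Q := fun x => (∀ j i, r j i ∈ localRing x) ∧ ∀ c ∈ L x, IsCombAt x r c)
    (((Set.finite_iUnion fun j => Set.finite_iUnion fun i =>
      finite_notMem_localRing (r j i)).union hfin).subset fun x hx => by
        by_contra hc
        simp only [Set.mem_union, Set.mem_iUnion, not_or, not_exists, Set.mem_ofPred_eq,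
          not_not] at hc
        exact hx hc)
    ⟨fun j i => mem_localRing_generic _, isCombAt_generic hv (hLv _)⟩
    ⟨fun j i => (hr j).2 i, hgen⟩
  refine ⟨V, hVU, m, fun j i => constFn (r j i) fun x hx => (hV x hx).1 j i, hyV,
    fun j => modEval_injective hyV ?_, fun W hW c hc z hz => ?_⟩
  · rw [map_sum, map_zero]
    refine Eq.trans (Finset.sum_congr rfl fun i _ => ?_) (hr j).1
    rw [modEval_smul, fnEval_constFn, modEval_eq]
  · change Point k at z
    have hc' : (fun i => fnEval hz (c i)) ∈ L z := by
      refine ⟨?_, fun i => fnEval_mem hz hz (c i)⟩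
      have := congrArg (modEval hz) hc
      rw [map_sum, map_zero] at this
      rw [hφ]
      refine Eq.trans (Finset.sum_congr rfl fun i _ => ?_) this
      rw [modEval_smul, modEval_res, modEval_eq]
    obtain ⟨b, hb, hcb⟩ := (hV z (hW hz)).2 _ hc'
    obtain ⟨W', hW'W, hzW', hW'⟩ := exists_open_mem_localRing hz b hb
    refine ⟨W', hW'W, hzW', (Submodule.mem_span_range_iff_exists_fun _).2
      ⟨fun j => constFn (b j) fun x hx => hW' x hx j, funext fun i => fnEval_injective hzW' ?_⟩⟩
    rw [fnEval_res, Finset.sum_apply, map_sum, congrFun hcb i, Finset.sum_apply]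
    rfl

theorem isCoherent_order : IsCoherent (orderSheaf d I).toModules :=
  ⟨isFiniteType_order, fun _ _ s _ hy => exists_generatesRelations s hy⟩

end NodalCurve

/-! ### Stalks from evaluation maps -/

/-- A compatible family of injective and jointly surjective maps from the sections near `x` to a
ring identifies the stalk at `x` with this ring. -/
theorem RingCat.exists_stalk_equiv {X : TopCat.{u}} (F : TopCat.Presheaf RingCat.{u} X) (x : X)
    {R : Type u} [Ring R] (φ : ∀ U : Opens X, x ∈ U → (F.obj (op U) →+* R))
    (hφ : ∀ (U V : Opens X) (i : V ⟶ U) (hV : x ∈ V) (s : F.obj (op U)),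
      φ V hV ((F.map i.op).hom s) = φ U (i.le hV) s)
    (hinj : ∀ U hU, Function.Injective (φ U hU)) (hsurj : ∀ r, ∃ U hU s, φ U hU s = r) :
    ∃ e : (TopCat.Presheaf.stalk F x : RingCat.{u}) ≃+* R, ∀ (U : Opens X) (hU : x ∈ U)
      (s : F.obj (op U)), e ((TopCat.Presheaf.germ F U x hU).hom s) = φ U hU s := by
  let ψ : TopCat.Presheaf.stalk F x ⟶ RingCat.of R :=
    Limits.colimit.desc ((OpenNhds.inclusion x).op ⋙ F) ⟨RingCat.of R,
      { app := fun U => RingCat.ofHom (φ U.unop.1 U.unop.2)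
        naturality := fun U V i => by
          ext s
          exact hφ U.unop.1 V.unop.1 ((OpenNhds.inclusion x).map i.unop) V.unop.2 s }⟩
  have hψ (U : Opens X) (hU : x ∈ U) (s : F.obj (op U)) :
      ψ.hom ((TopCat.Presheaf.germ F U x hU).hom s) = φ U hU s := by
    have : TopCat.Presheaf.germ F U x hU ≫ ψ = RingCat.ofHom (φ U hU) :=
      Limits.colimit.ι_desc (F := (OpenNhds.inclusion x).op ⋙ F) _ _
    exact congrArg (fun g => g.hom s) this
  refine ⟨RingEquiv.ofBijective ψ.hom ⟨?_, fun r => ?_⟩, hψ⟩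
  · rw [injective_iff_map_eq_zero]
    intro t ht
    obtain ⟨U, hU, s, rfl⟩ := TopCat.Presheaf.exists_germ_eq F t
    have : s = 0 := hinj U hU ((hψ U hU s).symm.trans (ht.trans (map_zero _).symm))
    rw [this]; exact map_zero (TopCat.Presheaf.germ F U x hU).hom
  · obtain ⟨U, hU, s, rfl⟩ := hsurj r
    exact ⟨_, hψ U hU s⟩

/-- A compatible family of injective and jointly surjective maps from the sections near `x` to a
ring identifies the stalk at `x` with this ring. -/
theorem CommRingCat.exists_stalk_equiv {X : TopCat.{u}} (F : TopCat.Presheaf CommRingCat.{u} X)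
    (x : X) {R : Type u} [CommRing R] (φ : ∀ U : Opens X, x ∈ U → (F.obj (op U) →+* R))
    (hφ : ∀ (U V : Opens X) (i : V ⟶ U) (hV : x ∈ V) (s : F.obj (op U)),
      φ V hV ((F.map i.op).hom s) = φ U (i.le hV) s)
    (hinj : ∀ U hU, Function.Injective (φ U hU)) (hsurj : ∀ r, ∃ U hU s, φ U hU s = r) :
    ∃ e : (TopCat.Presheaf.stalk F x : CommRingCat.{u}) ≃+* R, ∀ (U : Opens X) (hU : x ∈ U)
      (s : F.obj (op U)), e ((TopCat.Presheaf.germ F U x hU).hom s) = φ U hU s := by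
  let ψ : TopCat.Presheaf.stalk F x ⟶ CommRingCat.of R :=
    Limits.colimit.desc ((OpenNhds.inclusion x).op ⋙ F) ⟨CommRingCat.of R,
      { app := fun U => CommRingCat.ofHom (φ U.unop.1 U.unop.2)
        naturality := fun U V i => by
          ext s
          exact hφ U.unop.1 V.unop.1 ((OpenNhds.inclusion x).map i.unop) V.unop.2 s }⟩
  have hψ (U : Opens X) (hU : x ∈ U) (s : F.obj (op U)) :
      ψ.hom ((TopCat.Presheaf.germ F U x hU).hom s) = φ U hU s := by
    have : TopCat.Presheaf.germ F U x hU ≫ ψ = CommRingCat.ofHom (φ U hU) :=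
      Limits.colimit.ι_desc (F := (OpenNhds.inclusion x).op ⋙ F) _ _
    exact congrArg (fun g => g.hom s) this
  refine ⟨RingEquiv.ofBijective ψ.hom ⟨?_, fun r => ?_⟩, hψ⟩
  · rw [injective_iff_map_eq_zero]
    intro t ht
    obtain ⟨U, hU, s, rfl⟩ := TopCat.Presheaf.exists_germ_eq F t
    have : s = 0 := hinj U hU ((hψ U hU s).symm.trans (ht.trans (map_zero _).symm))
    rw [this]; exact map_zero (TopCat.Presheaf.germ F U x hU).hom
  · obtain ⟨U, hU, s, rfl⟩ := hsurj r
    exact ⟨_, hψ U hU s⟩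

namespace NodalCurve

open SphericalOrder StalkwiseSheaf

variable {k : Type u} [Field k] {n : ℕ} {d : Fin n → ℤ}
  {I : Subalgebra k (Matrix (Fin n) (Fin n) k × Matrix (Fin n) (Fin n) k)}

/-! ### The generic stalks -/

theorem isGenericPoint_generic :
    IsGenericPoint (Point.generic : nodalCurve k) Set.univ := by
  refine Set.eq_univ_of_forall fun x => mem_closure_iff.2 fun o ho hx => ?_
  exact ⟨_, (ho ⟨x, hx⟩).1, rfl⟩

theorem exists_stalk_generic_equiv :
    ∃ e : ((nodalCurve k).presheaf.stalk (Point.generic : nodalCurve k)) ≃+* RatFunc k,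
      ∀ (U : Opens (nodalCurve k)) (hU : (Point.generic : Point k) ∈ U) (f : Fn (nodalCurve k) U),
        e (((nodalCurve k).presheaf.germ U (Point.generic : nodalCurve k) hU).hom f) =
          fnEval hU f := by
  refine CommRingCat.exists_stalk_equiv (nodalCurve k).presheaf _ (fun U hU => fnEval hU)
    (fun _ _ _ _ _ => rfl) (fun U hU => fnEval_injective hU) fun f => ?_
  obtain ⟨W, -, hW, h⟩ := exists_open_mem_localRing (U := ⊤) (y := (.generic : Point k)) trivial
    (fun _ : Unit => f) fun _ => mem_localRing_generic f
  exact ⟨W, hW, constFn f fun x hx => h x hx (), rfl⟩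

theorem exists_order_stalk_generic_equiv :
    ∃ e : (TopCat.Presheaf.stalk (orderSheaf d I).sheaf.obj (Point.generic : nodalCurve k) :
        RingCat.{u}) ≃+* Matrix (Fin n) (Fin n) (RatFunc k),
      ∀ (U : Opens (nodalCurve k)) (hU : (Point.generic : Point k) ∈ U)
        (s : (orderSheaf d I).Sections U),
        e ((TopCat.Presheaf.germ (orderSheaf d I).sheaf.obj U
          (Point.generic : nodalCurve k) hU).hom s) = secEval hU s := by
  refine RingCat.exists_stalk_equiv (orderSheaf d I).sheaf.obj _ (fun U hU => secEval hU)
    (fun _ _ _ _ _ => rfl) (fun U hU => secEval_injective hU) fun M => ?_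
  obtain ⟨W, -, hW, h⟩ := exists_open_forall (U := ⊤) (y := (.generic : Point k)) trivial
    (finite_notMem_orderStalk (d := d) (I := I) M) (mem_orderStalk_generic M)
    (mem_orderStalk_generic M)
  exact ⟨W, hW, constSec M h, rfl⟩

theorem isOrder_order [NeZero n] : IsOrder (orderSheaf d I) where
  coherent := isCoherent_order
  torsionFree := isTorsionFree_order
  generic := by
    obtain ⟨e, he⟩ := exists_stalk_generic_equiv (k := k)
    obtain ⟨e', he'⟩ := exists_order_stalk_generic_equiv (d := d) (I := I)
    refine ⟨(.generic : Point k), isGenericPoint_generic,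
      e.toMulEquiv.isField (Field.toIsField _), n, e'.trans e.symm.mapMatrix,
      Nat.pos_of_neZero n, fun U hU f => ?_⟩
    rw [RingEquiv.trans_apply]
    have h1 := he' U hU ((orderSheaf d I).unitMap U f)
    have h2 := he U hU f
    refine (congrArg e.symm.mapMatrix h1).trans ?_
    rw [secEval_unitMap, ← h2]
    ext i j
    by_cases hij : i = j
    · subst hij; simp
    · simp [hij]

/-! ### The center -/

/-- The complement of the node in an open set is open. -/
theorem exists_open_ne_node {U : Opens (nodalCurve k)} {y : Point k} (hy : y ∈ U) :
    ∃ W : Opens (nodalCurve k), W ≤ U ∧ (.generic : Point k) ∈ W ∧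
      ∀ x : Point k, x ∈ W ↔ x ∈ U ∧ x ≠ .node := by
  refine ⟨⟨{x : Point k | x ∈ U ∧ x ≠ .node}, fun _ => ⟨⟨generic_mem hy, by simp⟩, ?_⟩⟩,
    fun x hx => hx.1, ⟨generic_mem hy, by simp⟩, fun x => Iff.rfl⟩
  refine ((U.isOpen ⟨y, hy⟩).2.union (Set.finite_singleton (.node : Point k))).subset fun x hx => ?_
  by_cases h : x ∈ U
  · exact .inr (by by_contra h'; exact hx ⟨h, h'⟩)
  · exact .inl h

/-- The center of the order consists of the scalar sections, if the scalar pairs in `I` are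
diagonal. -/
theorem centerIsStructureSheaf_order [NeZero n]
    (hI : ∀ a b : k, (algebraMap k (Matrix (Fin n) (Fin n) k) a,
      algebraMap k (Matrix (Fin n) (Fin n) k) b) ∈ I → a = b) :
    CenterIsStructureSheaf (orderSheaf d I) := by
  intro U
  by_cases hU : ∃ x, x ∈ U
  swap
  · have hU' : ∀ x, x ∉ U := by simpa using hU
    have h1 := fn_subsingleton hU'
    have h2 := sections_subsingleton (d := d) (I := I) hU'
    refine ⟨Function.injective_of_subsingleton _, Set.Subset.antisymm (fun z _ V hV a => ?_)
      fun z _ => ⟨0, Subsingleton.elim _ _⟩⟩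
    have h3 := sections_subsingleton (d := d) (I := I) (U := V) fun x hx => hU' x (hV hx)
    exact Subsingleton.elim _ _
  obtain ⟨y, hy⟩ := hU
  change Point k at y
  refine ⟨fun f g h => fnEval_injective hy ?_, Set.Subset.antisymm ?_ fun z hz => ?_⟩
  · have := congrArg (secEval hy) h
    rw [secEval_unitMap, secEval_unitMap] at this
    exact Matrix.scalar_inj.1 this
  · rintro _ ⟨f, rfl⟩ V hV a
    exact (orderSheaf d I).central V (Fn.res hV f) a
  -- On the complement of the node all elementary matrices are sections, and commuting with them
  -- forces a matrix to be scalar.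
  · obtain ⟨W, hWU, hgW, hW⟩ := exists_open_ne_node hy
    have hg := hWU hgW
    have hcomm (i j : Fin n) : Commute (Matrix.single i j (1 : RatFunc k)) (secEval hg z) := by
      have := congrArg (secEval hgW) (hz W hWU (constSec (Matrix.single i j 1) fun x hx =>
        single_mem_orderStalk_of_ne_node ((hW x).1 hx).2 i j))
      rw [map_mul, map_mul] at this
      exact this.symm
    obtain ⟨f, hf⟩ := Matrix.mem_range_scalar_of_commute_single fun i j _ => hcomm i j
    -- Regularity is read off the entry `(0, 0)`, which has degree `0`. At the node the pair of
    -- scalar values lies in `I`, so `hI` makes the values equal.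
    have hfU : ∀ x ∈ U, f ∈ localRing x := by
      intro x hx
      have hx' := secEval_mem hg hx z
      rw [← hf] at hx'
      refine ⟨fun p hp => ?_, fun hxn => ?_⟩
      · simpa using hx'.1 p hp 0 0
      · have h := hx'.2 hxn
        have e1 : matVal0 (Matrix.scalar (Fin n) f) = algebraMap k _ (val0 f) := by
          ext i j
          by_cases h : i = j
          · subst h; simp [matVal0, Matrix.algebraMap_matrix_apply]
          · simp [matVal0, h, val0_zero, Matrix.algebraMap_matrix_apply]
        have e2 : matValInfty d (Matrix.scalar (Fin n) f) = algebraMap k _ (valInfty 0 f) := by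
          ext i j
          by_cases h : i = j
          · subst h; simp [matValInfty, Matrix.algebraMap_matrix_apply]
          · simp [matValInfty, h, valInfty_zero, Matrix.algebraMap_matrix_apply]
        rw [e1, e2] at h
        exact hI _ _ h
    refine ⟨constFn f hfU, secEval_injective hg ?_⟩
    rw [secEval_unitMap, fnEval_constFn, hf]


open SphericalOrder StalkwiseSheaf

variable {k : Type u} [Field k] {n : ℕ} {d : Fin n → ℤ}
  {I : Subalgebra k (Matrix (Fin n) (Fin n) k × Matrix (Fin n) (Fin n) k)}

/-! ### The dualizing sheaf -/

/-- The dualizing sheaf is freely generated by `dt / t`. -/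
theorem isDualizingAt_mul_inv_X_iff {x : Point k} {f : RatFunc k} :
    IsDualizingAt x (f * RatFunc.X⁻¹) ↔ f ∈ localRing x := by
  have hX := RatFunc.X_ne_zero (K := k)
  cases x with
  | generic => exact ⟨fun _ => mem_localRing_generic f, fun _ => trivial⟩
  | smooth a =>
    rw [mem_localRing_smooth]
    refine ⟨fun h => ?_, fun h => RegularAt.mul h ?_⟩
    · have := RegularAt.mul h (RegularAt.X (a : k))
      rwa [inv_mul_cancel_right₀ hX] at this
    · simpa using regularAt_div (a := (a : k)) 1 (q := Polynomial.X) (by simp)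
  | node =>
    have e1 : RatFunc.X * (f * RatFunc.X⁻¹) = f := by field_simp
    have e2 : RatFunc.X * coeffInfty (f * RatFunc.X⁻¹) = -swap k f := by
      rw [coeffInfty, map_mul, map_inv₀, swap_X]
      simp only [inv_inv]
      field_simp
    rw [mem_localRing_node, IsDualizingAt, e1, e2]
    constructor
    · rintro ⟨h1, h2, h3⟩
      have h2' := h2.neg
      rw [neg_neg] at h2'
      rw [val0_neg h2'] at h3
      exact ⟨h1, h2', by linear_combination h3⟩
    · rintro ⟨h1, h2, h3⟩
      exact ⟨h1, h2.neg, by rw [val0_neg h2, h3, add_neg_cancel]⟩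

/-- The germ at `x ∈ U` of a section of the dualizing sheaf. -/
noncomputable def dualEval {U : Opens (nodalCurve k)} {x : Point k} (hx : x ∈ U) :
    Sec (dualizingSheaf k) U →+ RatFunc k :=
  (Pi.evalAddMonoidHom (fun _ : U => RatFunc k) ⟨x, hx⟩).comp
    (addSections (X := TopCat.of (Point k)) dualizingStalk U).subtype

theorem dualEval_res {U V : Opens (nodalCurve k)} (h : V ≤ U) {x : Point k} (hx : x ∈ V)
    (s : Sec (dualizingSheaf k) U) : dualEval hx (Sec.res h s) = dualEval (h hx) s := rfl

theorem dualEval_smul {U : Opens (nodalCurve k)} {x : Point k} (hx : x ∈ U)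
    (f : Fn (nodalCurve k) U) (s : Sec (dualizingSheaf k) U) :
    dualEval hx (f • s) = fnEval hx f * dualEval hx s := rfl

theorem dualEval_eq {U : Opens (nodalCurve k)} {x y : Point k} (hx : x ∈ U) (hy : y ∈ U)
    (s : Sec (dualizingSheaf k) U) : dualEval hx s = dualEval hy s := by
  have hs : (pred (X := TopCat.of (Point k)) fun x => (dualizingStalk x : Set (RatFunc k))).pred
    (U := U) (Subtype.val (p := (· ∈ addSections (X := TopCat.of (Point k)) dualizingStalk U)) s) :=
    Subtype.property (p := (· ∈ addSections (X := TopCat.of (Point k)) dualizingStalk U)) s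
  exact eq_of_pred hs ⟨x, hx⟩ ⟨y, hy⟩

theorem dualEval_mem {U : Opens (nodalCurve k)} {x y : Point k} (hx : x ∈ U) (hy : y ∈ U)
    (s : Sec (dualizingSheaf k) U) : IsDualizingAt y (dualEval hx s) := by
  rw [dualEval_eq hx hy]
  exact (Subtype.property (p := (· ∈ addSections (X := TopCat.of (Point k)) dualizingStalk U)) s).2
    ⟨y, hy⟩

theorem dualEval_injective {U : Opens (nodalCurve k)} {x : Point k} (hx : x ∈ U) :
    Function.Injective (dualEval hx) := fun f g h =>
  Subtype.ext (p := (· ∈ addSections (X := TopCat.of (Point k)) dualizingStalk U))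
    (funext fun y => by
      have h1 := dualEval_eq hx y.2 f
      have h2 := dualEval_eq hx y.2 g
      exact h1.symm.trans (h.trans h2))

theorem dual_subsingleton {U : Opens (nodalCurve k)} (hU : ∀ x, x ∉ U) :
    Subsingleton (Sec (dualizingSheaf k) U) :=
  ⟨fun _ _ => Subtype.ext (p := (· ∈ addSections (X := TopCat.of (Point k)) dualizingStalk U))
    (funext fun y => absurd y.2 (hU y.1))⟩

/-! ### The trace form -/

theorem regularAt_trace_mul {G H : Matrix (Fin n) (Fin n) (RatFunc k)}
    (hG : ∀ i j, RegularAt 0 (G i j)) (hH : ∀ i j, RegularAt 0 (H i j)) :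
    RegularAt 0 (G * H).trace ∧ val0 (G * H).trace = (matVal0 G * matVal0 H).trace := by
  have h1 (i j : Fin n) : RegularAt 0 (G i j * H j i) := (hG i j).mul (hH j i)
  have h2 (i : Fin n) : RegularAt 0 (∑ j, G i j * H j i) := .sum fun j _ => h1 i j
  simp only [Matrix.trace, Matrix.diag_apply, Matrix.mul_apply]
  refine ⟨.sum fun i _ => h2 i, ?_⟩
  rw [val0_sum _ h2]
  refine Finset.sum_congr rfl fun i _ => ?_
  rw [val0_sum _ (h1 i)]
  exact Finset.sum_congr rfl fun j _ => val0_mul (hG i j) (hH j i)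

/-- Twisting is conjugation by the diagonal matrix with entries `(1 + t) ^ d i`. -/
theorem trace_twist_mul_twist (G H : Matrix (Fin n) (Fin n) (RatFunc k)) :
    (twist d G * twist d H).trace = (G * H).trace := by
  simp only [Matrix.trace, Matrix.diag_apply, Matrix.mul_apply, twist_apply]
  refine Finset.sum_congr rfl fun i _ => Finset.sum_congr rfl fun j _ => ?_
  have : oneAddX k ^ (d i - d j) * oneAddX k ^ (d j - d i) = 1 := by
    rw [← zpow_add₀ oneAddX_ne_zero, sub_add_sub_cancel, sub_self, zpow_zero]
  linear_combination (G i j * H j i) * this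

theorem swap_trace_mul (G H : Matrix (Fin n) (Fin n) (RatFunc k)) :
    swap k (G * H).trace = (G.map (swap k) * H.map (swap k)).trace := by
  simp [Matrix.trace, Matrix.mul_apply, map_sum, map_mul]

/-- Traces of sections of the order are functions, if the two components of a pair in `I` have the
same trace. -/
theorem trace_mem_localRing (hI : ∀ p ∈ I, p.1.trace = p.2.trace) {x : Point k}
    {M : Matrix (Fin n) (Fin n) (RatFunc k)} (hM : M ∈ orderStalk d I x) :
    M.trace ∈ localRing x := by
  by_cases hx : x = .node
  · subst hx
    obtain ⟨G, rfl⟩ := exists_twist_eq (d := d) M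
    obtain ⟨hG, hG'⟩ := twist_mem_orderStalk_node.1 hM
    have e : (twist d G).trace = G.trace := by simp [Matrix.trace, twist_apply]
    have r (F : Matrix (Fin n) (Fin n) (RatFunc k)) (hF : ∀ i j, RegularAt 0 (F i j)) :
        RegularAt 0 F.trace ∧ val0 F.trace = (matVal0 F).trace :=
      ⟨.sum fun i _ => hF i i, val0_sum _ fun i => hF i i⟩
    have e' : swap k G.trace = (G.map (swap k)).trace := by simp [Matrix.trace, map_sum]
    obtain ⟨h1, h2⟩ := r G fun i j => (hG i j).1
    obtain ⟨h3, h4⟩ := r (G.map (swap k)) fun i j => (hG i j).2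
    rw [e, mem_localRing_node, e', h2, h4]
    exact ⟨h1, h3, hI _ hG'⟩
  · exact sum_mem fun i _ => entry_mem_localRing_of_ne_node hx hM i i

/-- If `I` contains its orthogonal with respect to the difference of the trace forms, then the stalk
of the order at the node contains its dual with respect to the trace form. -/
theorem mem_orderStalk_node_of_trace_mul_mem
    (hI : ∀ q : Matrix (Fin n) (Fin n) k × Matrix (Fin n) (Fin n) k,
      (∀ p ∈ I, (p.1 * q.1).trace = (p.2 * q.2).trace) → q ∈ I)
    {Y : Matrix (Fin n) (Fin n) (RatFunc k)}
    (hY : ∀ M ∈ orderStalk d I (.node : Point k), (M * Y).trace ∈ localRing (.node : Point k)) :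
    Y ∈ orderStalk d I (.node : Point k) := by
  obtain ⟨H, rfl⟩ := exists_twist_eq (d := d) Y
  -- Pairing with elementary matrices times `van` and `van * sep` puts `u = van * H j i` and `u *
  -- sep` in the local ring of the node. Since `sep` has values `1` and `0`, the second membership
  -- forces `u(0) = 0`, and the first gives `u(∞) = 0`; then `u` can be divided by `van`.
  have hH (j i : Fin n) : RegularAt 0 (H j i) ∧ RegularAt 0 (swap k (H j i)) := by
    have key {g : RatFunc k} (hg : RegularAt 0 g) (hg' : RegularAt 0 (swap k g)) :
        van k * g * H j i ∈ localRing (.node : Point k) := by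
      have := hY _ (twist_single_van_mem_orderStalk_node i j hg hg')
      rwa [trace_twist_mul_twist, Matrix.trace_single_mul] at this
    have k1 := key (RegularAt.one 0) (by rw [map_one]; exact RegularAt.one 0)
    have k2 := key regularAt_sep regularAt_swap_sep
    rw [mul_one] at k1
    rw [mul_right_comm] at k2
    obtain ⟨h1, h2, h3⟩ := mem_localRing_node.1 k1
    have h4 := (mem_localRing_node.1 k2).2.2
    rw [val0_mul h1 regularAt_sep, map_mul, val0_mul h2 regularAt_swap_sep, val0_sep,
      val0_swap_sep, mul_one, mul_zero] at h4
    have h5 := regularAt_div_van h1 h4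
    have h6 := regularAt_div_van h2 (h3 ▸ h4)
    rw [map_mul, swap_van, mul_div_cancel_left₀ _ van_ne_zero] at h6
    rw [mul_div_cancel_left₀ _ van_ne_zero] at h5
    exact ⟨h5, h6⟩
  refine twist_mem_orderStalk_node.2 ⟨hH, hI _ ?_⟩
  rintro ⟨a, b⟩ hab
  -- The function `sep` interpolates: `G` has value `a` at `0` and `b` at `∞`, so every pair in `I`
  -- comes from the stalk.
  let G : Matrix (Fin n) (Fin n) (RatFunc k) :=
    .of fun i j => RatFunc.C (a i j) * sep k + RatFunc.C (b i j) * (1 - sep k)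
  have hs (i j : Fin n) : swap k (G i j) =
      RatFunc.C (a i j) * swap k (sep k) + RatFunc.C (b i j) * (1 - swap k (sep k)) := by
    simp [G, swap_C]
  have r0 {f : RatFunc k} (hf : RegularAt 0 f) (a b : k) :
      RegularAt 0 (RatFunc.C a * f) ∧ RegularAt 0 (RatFunc.C b * (1 - f)) :=
    ⟨(RegularAt.C 0 a).mul hf, (RegularAt.C 0 b).mul ((RegularAt.one 0).sub hf)⟩
  have v0 {f : RatFunc k} (hf : RegularAt 0 f) (a b : k) :
      val0 (RatFunc.C a * f + RatFunc.C b * (1 - f)) = a * val0 f + b * (1 - val0 f) := by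
    rw [val0_add (r0 hf a b).1 (r0 hf a b).2, val0_mul (RegularAt.C 0 a) hf,
      val0_mul (RegularAt.C 0 b) ((RegularAt.one 0).sub hf), val0_sub (RegularAt.one 0) hf,
      val0_one, val0_C, val0_C]
  have hG (i j : Fin n) : RegularAt 0 (G i j) ∧ RegularAt 0 (swap k (G i j)) :=
    have r1 := r0 (regularAt_sep (k := k)) (a i j) (b i j)
    have r2 := r0 (regularAt_swap_sep (k := k)) (a i j) (b i j)
    ⟨r1.1.add r1.2, hs i j ▸ r2.1.add r2.2⟩
  have e1 : matVal0 G = a := Matrix.ext fun i j => (v0 regularAt_sep _ _).trans (by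
    rw [val0_sep]; ring)
  have e2 : matVal0 (G.map (swap k)) = b := Matrix.ext fun i j => by
    change val0 (swap k (G i j)) = _
    rw [hs, v0 regularAt_swap_sep, val0_swap_sep]; ring
  have hGm : twist d G ∈ orderStalk d I (.node : Point k) := by
    refine twist_mem_orderStalk_node.2 ⟨hG, ?_⟩
    change (matVal0 G, matVal0 (G.map (swap k))) ∈ I
    rwa [e1, e2]
  have := hY _ hGm
  rw [trace_twist_mul_twist] at this
  have h3 := (mem_localRing_node.1 this).2.2
  rw [(regularAt_trace_mul (fun i j => (hG i j).1) fun i j => (hH i j).1).2, swap_trace_mul,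
    (regularAt_trace_mul (G := G.map (swap k)) (H := H.map (swap k)) (fun i j => (hG i j).2)
      fun i j => (hH i j).2).2, e1, e2] at h3
  exact h3

/-- The morphism `a ↦ tr(a) dt / t` from the order to the dualizing sheaf. -/
noncomputable def traceHom (hI : ∀ p ∈ I, p.1.trace = p.2.trace) :
    SheafOfModules.Hom (orderSheaf d I).toModules (dualizingSheaf k) where
  val := PresheafOfModules.homMk
    { app := fun U => AddCommGrpCat.ofHom
        { toFun := fun s => (⟨fun x => (s.1 x).trace * RatFunc.X⁻¹,
            s.2.1.comp fun M => M.trace * RatFunc.X⁻¹,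
            fun x => isDualizingAt_mul_inv_X_iff.2 (trace_mem_localRing hI (s.2.2 x))⟩ :
            addSections (X := TopCat.of (Point k)) dualizingStalk U.unop)
          map_zero' := Subtype.ext (funext fun x => by
            change (0 : Matrix (Fin n) (Fin n) (RatFunc k)).trace * RatFunc.X⁻¹ = 0
            rw [Matrix.trace_zero, zero_mul])
          map_add' := fun s t => Subtype.ext (funext fun x => by
            change (s.1 x + t.1 x).trace * RatFunc.X⁻¹ = _
            rw [Matrix.trace_add, add_mul]; rfl) }
      naturality := fun _ _ _ => rfl }
    (fun U f s => Subtype.ext (funext fun x => by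
      change (Matrix.scalar (Fin n) (f.1 x) * s.1 x).trace * RatFunc.X⁻¹ =
        f.1 x * ((s.1 x).trace * RatFunc.X⁻¹)
      rw [Matrix.scalar_apply, ← Matrix.smul_eq_diagonal_mul, Matrix.trace_smul, smul_eq_mul,
        mul_assoc]))

theorem dualEval_traceHom (hI : ∀ p ∈ I, p.1.trace = p.2.trace) {U : Opens (nodalCurve k)}
    {x : Point k} (hx : x ∈ U) (s : Sec (orderSheaf d I).toModules U) :
    dualEval hx (Sec.map (traceHom hI) U s) = (modEval hx s).trace * RatFunc.X⁻¹ := rfl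


/-! ### Morphisms to the dualizing sheaf -/

open SphericalOrder StalkwiseSheaf

variable {k : Type u} [Field k] {n : ℕ} {d : Fin n → ℤ}
  {I : Subalgebra k (Matrix (Fin n) (Fin n) k × Matrix (Fin n) (Fin n) k)}

/-- Away from the node the order is free on the elementary matrices, so a morphism to the dualizing
sheaf is determined by its values there. These values, divided by `dt/t`, are the transposed entries
of `Y`. -/
theorem exists_matrix_of_localHom {U : Opens (nodalCurve k)} {y : Point k} (hy : y ∈ U)
    (φ : LocalHom (orderSheaf d I).toModules (dualizingSheaf k) U) :
    ∃ Y : Matrix (Fin n) (Fin n) (RatFunc k),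
      (∀ x ∈ U, x ≠ (.node : Point k) → ∀ i j, Y i j ∈ localRing x) ∧
      ∀ (V : Opens (nodalCurve k)) (hV : V ≤ U) (x : Point k) (hx : x ∈ V)
        (s : (orderSheaf d I).Sections V),
        dualEval hx (φ.app V hV ((orderSheaf d I).toSec s)) =
          (secEval hx s * Y).trace * RatFunc.X⁻¹ := by
  have hX := RatFunc.X_ne_zero (K := k)
  obtain ⟨W, hWU, hgW, hW⟩ := exists_open_ne_node hy
  let E (V : Opens (nodalCurve k)) (hV : V ≤ W) (i j : Fin n) : (orderSheaf d I).Sections V :=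
    constSec (Matrix.single i j 1) fun x hx =>
      single_mem_orderStalk_of_ne_node ((hW x).1 (hV hx)).2 i j
  let f (i j : Fin n) : RatFunc k :=
    dualEval hgW (φ.app W hWU ((orderSheaf d I).toSec (E W le_rfl i j)))
  refine ⟨.of fun j i => f i j * RatFunc.X, fun x hx hxn j i => ?_, fun V hV x hx s => ?_⟩
  · refine isDualizingAt_mul_inv_X_iff.1 ?_
    rw [Matrix.of_apply, mul_inv_cancel_right₀ hX]
    exact dualEval_mem hgW ((hW x).2 ⟨hx, hxn⟩) _
  -- If `V` contains the node, elementary matrices need not be sections over it. Restriction to the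
  -- complement of the node loses nothing, since germs are constant.
  · obtain ⟨W', hW'V, hgW', hW'⟩ := exists_open_ne_node hx
    have hW'W : W' ≤ W := fun z hz => (hW z).2 ⟨hV (hW'V hz), ((hW' z).1 hz).2⟩
    set M := secEval hx s with hM
    have hMloc (i j : Fin n) : ∀ z ∈ W', M i j ∈ localRing z := fun z hz =>
      entry_mem_localRing_of_ne_node ((hW' z).1 hz).2 (secEval_mem hx (hW'V hz) s) i j
    have hs : Sec.res hW'V ((orderSheaf d I).toSec s) =
        ∑ i, ∑ j, constFn (M i j) (hMloc i j) • (orderSheaf d I).toSec (E W' hW'W i j) := by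
      refine modEval_injective hgW' ?_
      rw [modEval_res, modEval_toSec, secEval_eq _ hx, ← hM]
      conv_lhs => rw [Matrix.matrix_eq_sum_single M]
      rw [map_sum]
      refine Finset.sum_congr rfl fun i _ => ?_
      rw [map_sum]
      refine Finset.sum_congr rfl fun j _ => ?_
      rw [modEval_smul, fnEval_constFn, modEval_toSec, secEval_constSec, Matrix.smul_single,
        smul_eq_mul, mul_one]
    have hE (i j : Fin n) : dualEval hgW' (φ.app W' (hW'V.trans hV)
        ((orderSheaf d I).toSec (E W' hW'W i j))) = f i j :=
      congrArg (dualEval hgW')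
        (φ.naturality W W' hWU hW'W ((orderSheaf d I).toSec (E W le_rfl i j)))
    have hn := congrArg (dualEval hgW')
      (φ.naturality V W' hV hW'V ((orderSheaf d I).toSec s))
    rw [dualEval_res, dualEval_eq _ hx, hs, map_sum, map_sum] at hn
    rw [← hn, Matrix.trace, Finset.sum_mul]
    refine Finset.sum_congr rfl fun i _ => ?_
    rw [map_sum, map_sum, Matrix.diag_apply, Matrix.mul_apply, Finset.sum_mul]
    refine Finset.sum_congr rfl fun j _ => ?_
    rw [map_smul, dualEval_smul, hE, fnEval_constFn, Matrix.of_apply, mul_assoc,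
      mul_inv_cancel_right₀ hX]

/-- A morphism is the trace form against a rational matrix `Y`, and the point is that `Y` lies in
the order. Away from the node this is regularity of the entries; at the node it is the self-duality
of the stalk. -/
theorem nuIsIso_traceHom (hI : ∀ p ∈ I, p.1.trace = p.2.trace)
    (hI' : ∀ q : Matrix (Fin n) (Fin n) k × Matrix (Fin n) (Fin n) k,
      (∀ p ∈ I, (p.1 * q.1).trace = (p.2 * q.2).trace) → q ∈ I) :
    NuIsIso (orderSheaf d I) (traceHom hI) := by
  intro U φ
  have hX := RatFunc.X_ne_zero (K := k)
  by_cases hU : ∃ x, x ∈ U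
  swap
  · have hU' : ∀ x, x ∉ U := by simpa using hU
    refine ⟨0, fun V hV x => ?_, fun z _ => (sections_subsingleton hU').elim _ _⟩
    exact (dual_subsingleton fun x hx => hU' x (hV hx)).elim _ _
  obtain ⟨y, hy⟩ := hU
  change Point k at y
  obtain ⟨Y, hY, hφ⟩ := exists_matrix_of_localHom hy φ
  have hYm : ∀ x ∈ U, Y ∈ orderStalk d I x := by
    intro x hx
    change Point k at x
    by_cases hxn : x = .node
    · subst hxn
      refine mem_orderStalk_node_of_trace_mul_mem hI' fun M hM => ?_
      -- Any `M` in the stalk at the node extends to a section near it, so the given morphism can be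
      -- evaluated on it.
      obtain ⟨V, hVU, hxV, hV⟩ := exists_open_forall hx
        (finite_notMem_orderStalk (d := d) (I := I) M) (mem_orderStalk_generic M) hM
      rw [← isDualizingAt_mul_inv_X_iff]
      have := hφ V hVU _ hxV (constSec M hV)
      rw [secEval_constSec] at this
      rw [← this]
      exact dualEval_mem hxV hxV _
    · exact mem_orderStalk_of_ne_node hxn (hY x hx hxn)
  refine ⟨constSec Y hYm, fun V hV s => ?_, fun z hz => ?_⟩
  · by_cases hne : ∃ x, x ∈ V
    · obtain ⟨x, hx⟩ := hne
      change Point k at x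
      refine dualEval_injective hx ?_
      rw [hφ, dualEval_traceHom, modEval_toSec, map_mul, secEval_res, secEval_constSec]
    · exact (dual_subsingleton (by simpa using hne)).elim _ _
  -- Uniqueness: testing on elementary matrices off the node recovers every entry.
  · obtain ⟨W, hWU, hgW, hW⟩ := exists_open_ne_node hy
    refine secEval_injective (hWU hgW) (Matrix.ext fun j i => ?_)
    rw [secEval_constSec]
    have h := congrArg (dualEval hgW) (hz W hWU (constSec (Matrix.single i j 1) fun x hx =>
      single_mem_orderStalk_of_ne_node ((hW x).1 hx).2 i j))
    rw [hφ, dualEval_traceHom, modEval_toSec, map_mul, secEval_res, secEval_constSec,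
      Matrix.trace_single_mul, Matrix.trace_single_mul, one_smul, one_smul] at h
    exact (mul_right_cancel₀ (inv_ne_zero hX) h).symm

/-! ### Global sections -/

/-- A global section of `𝒪(e)` on the projective line is a polynomial of degree at most `e`. -/
theorem exists_polynomial_of_isSectionAt [IsAlgClosed k] {e : ℤ} {f : RatFunc k}
    (hf : ∀ p, IsSectionAt e p f) :
    ∃ p : Polynomial k, f = algebraMap _ _ p ∧ (p ≠ 0 → (p.natDegree : ℤ) ≤ e) := by
  have h1 : f.denom = 1 := by
    refine Polynomial.eq_one_of_monic_natDegree_zero (RatFunc.monic_denom f) ?_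
    by_contra h
    obtain ⟨a, ha⟩ := IsAlgClosed.exists_root f.denom
      (fun h' => h (Polynomial.natDegree_eq_of_degree_eq_some h'))
    exact hf (.finite a) ha
  have h2 : f = algebraMap _ _ f.num := by
    conv_lhs => rw [← RatFunc.num_div_denom f, h1, map_one, div_one]
  refine ⟨f.num, h2, fun h0 => ?_⟩
  by_contra! hlt
  set p := f.num
  have hX := RatFunc.X_ne_zero (K := k)
  have hi : RegularAt 0 (swap k (RatFunc.X ^ (-e) * f)) := hf .infty
  -- In the coordinate `1/t` the polynomial becomes its reverse divided by `t ^ deg p`.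
  have e1 : swap k (algebraMap _ _ p) * RatFunc.X ^ p.natDegree = algebraMap _ _ p.reverse := by
    let _ : Invertible (RatFunc.X⁻¹ : RatFunc k) := invertibleOfNonzero (inv_ne_zero hX)
    have := Polynomial.eval₂_reverse_mul_pow (algebraMap k (RatFunc k)) (RatFunc.X⁻¹) p
    rw [swap_algebraMap, Polynomial.aeval_def, ← this, mul_assoc, ← mul_pow,
      inv_mul_cancel₀ hX, one_pow, mul_one, invOf_eq_inv, inv_inv, ← Polynomial.aeval_def,
      RatFunc.aeval_X_left_eq_algebraMap]
  have e2 : RatFunc.X ^ ((p.natDegree : ℤ) - e) * swap k (RatFunc.X ^ (-e) * f) =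
      algebraMap _ _ p.reverse := by
    rw [← e1, map_mul, map_zpow₀, swap_X, inv_zpow, zpow_neg, inv_inv, ← h2, zpow_sub₀ hX,
      zpow_natCast]
    have := zpow_ne_zero e hX
    field_simp
  -- If `deg p > e`, at least one factor `t` is left over: the reverse is `t` times a function
  -- regular at `0`. Its constant term, the leading coefficient of `p`, would then vanish.
  obtain ⟨N, hN⟩ := Int.eq_ofNat_of_zero_le (show 0 ≤ (p.natDegree : ℤ) - e - 1 by omega)
  have e3 : RatFunc.X * (RatFunc.X ^ N * swap k (RatFunc.X ^ (-e) * f)) =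
      algebraMap _ _ p.reverse := by
    rw [← e2, ← mul_assoc, ← pow_succ', ← zpow_natCast]
    congr 2
    push_cast
    omega
  have h3 := congrArg val0 e3
  rw [val0_mul (RegularAt.X 0) (((RegularAt.X 0).pow N).mul hi), val0_X, zero_mul, val0,
    RatFunc.eval_algebraMap] at h3
  simp [Polynomial.eval₂_at_zero] at h3
  exact h0 (Polynomial.leadingCoeff_eq_zero.1 h3.symm)

theorem eq_zero_of_isSectionAt_of_neg [IsAlgClosed k] {e : ℤ} (he : e < 0) {f : RatFunc k}
    (hf : ∀ p, IsSectionAt e p f) : f = 0 := by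
  obtain ⟨p, rfl, hp⟩ := exists_polynomial_of_isSectionAt hf
  by_cases h : p = 0
  · rw [h, map_zero]
  · have := hp h; omega

theorem exists_eq_C_of_isSectionAt_zero [IsAlgClosed k] {f : RatFunc k}
    (hf : ∀ p, IsSectionAt 0 p f) : ∃ c, f = RatFunc.C c := by
  obtain ⟨p, rfl, hp⟩ := exists_polynomial_of_isSectionAt hf
  have : p.natDegree = 0 := by
    by_cases h : p = 0
    · simp [h]
    · have := hp h; omega
  refine ⟨p.coeff 0, ?_⟩
  conv_lhs => rw [Polynomial.eq_C_of_natDegree_eq_zero this]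
  simp

/-- A section of `𝒪(1)` vanishing at `0` and `∞` is zero. -/
theorem eq_zero_of_isSectionAt_one [IsAlgClosed k] {f : RatFunc k}
    (hf : ∀ p, IsSectionAt 1 p f) (h0 : val0 f = 0) (hi : valInfty 1 f = 0) : f = 0 := by
  obtain ⟨p, rfl, hp⟩ := exists_polynomial_of_isSectionAt hf
  have hX := RatFunc.X_ne_zero (K := k)
  have hdeg : p.natDegree ≤ 1 := by
    by_cases h : p = 0
    · simp [h]
    · have := hp h; omega
  obtain ⟨a, b, rfl⟩ := Polynomial.exists_eq_X_add_C_of_natDegree_le_one hdeg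
  have ev : algebraMap _ (RatFunc k) (Polynomial.C a * Polynomial.X + Polynomial.C b) =
      RatFunc.C a * RatFunc.X + RatFunc.C b := by simp
  have r (a b : k) : val0 (RatFunc.C a * RatFunc.X + RatFunc.C b) = b := by
    rw [val0_add ((RegularAt.C 0 a).mul (RegularAt.X 0)) (RegularAt.C 0 b),
      val0_mul (RegularAt.C 0 a) (RegularAt.X 0), val0_X, mul_zero, zero_add, val0_C]
  have e : swap k (RatFunc.X ^ (-1 : ℤ) * (RatFunc.C a * RatFunc.X + RatFunc.C b)) =
      RatFunc.C b * RatFunc.X + RatFunc.C a := by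
    rw [map_mul, map_zpow₀, map_add, map_mul, swap_X, swap_C, swap_C, zpow_neg_one, inv_inv]
    field_simp
    ring
  rw [ev] at h0 hi ⊢
  rw [valInfty, e, r] at hi
  rw [r] at h0
  simp [h0, hi]

theorem isSectionAt_of_forall_mem {M : Matrix (Fin n) (Fin n) (RatFunc k)}
    (hM : ∀ x, M ∈ orderStalk d I x) (i j : Fin n) (p : P1 k) :
    IsSectionAt (d i - d j) p (M i j) :=
  (hM (proj p)).1 p rfl i j

/-! ### Spherical orders from Lagrangian subalgebras -/

theorem scalars_bijective [IsAlgClosed k] : Function.Bijective (scalars k) := by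
  have ht : (.generic : Point k) ∈ (⊤ : Opens (nodalCurve k)) := trivial
  refine ⟨fun c c' h => ?_, fun f => ?_⟩
  · have := congrArg (fnEval ht) h
    exact RatFunc.C_injective this
  · obtain ⟨c, hc⟩ := exists_eq_C_of_isSectionAt_zero (f := fnEval ht f) fun p =>
      (fnEval_mem ht (y := proj p) trivial f).1 p rfl
    exact ⟨c, fnEval_injective ht hc.symm⟩

/-- If all global sections are scalar, then `h⁰ = 1`. -/
theorem h0_order [NeZero n] (hM : ∀ M : Matrix (Fin n) (Fin n) (RatFunc k),
    (∀ x, M ∈ orderStalk d I x) → ∃ c, M = Matrix.scalar (Fin n) (RatFunc.C c)) :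
    (orderSheaf d I).h0 (scalars k) = 1 := by
  have ht : (.generic : Point k) ∈ (⊤ : Opens (nodalCurve k)) := trivial
  let _ : Module k ((orderSheaf d I).Sections ⊤) :=
    Module.compHom _ (((orderSheaf d I).unitMap ⊤).comp (scalars k))
  change Module.finrank k ((orderSheaf d I).Sections ⊤) = 1
  refine finrank_eq_one (1 : (orderSheaf d I).Sections ⊤) (fun h => ?_) fun s => ?_
  · have := congrArg (secEval ht) h
    rw [map_one, map_zero] at this
    exact one_ne_zero this
  · obtain ⟨c, hc⟩ := hM (secEval ht s) fun x => secEval_mem ht trivial s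
    refine ⟨c, secEval_injective ht ?_⟩
    change secEval ht ((orderSheaf d I).unitMap ⊤ (scalars k c) * 1) = _
    rw [map_mul, map_one, mul_one, secEval_unitMap, hc]
    rfl

/-- An order attached to a Lagrangian subalgebra `I` is a symmetric spherical order, if all its
global sections are scalar. -/
theorem isSymmetricSphericalOrder_order [IsAlgClosed k] [NeZero n]
    (hI : ∀ p ∈ I, p.1.trace = p.2.trace)
    (hI' : ∀ q : Matrix (Fin n) (Fin n) k × Matrix (Fin n) (Fin n) k,
      (∀ p ∈ I, (p.1 * q.1).trace = (p.2 * q.2).trace) → q ∈ I)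
    (hM : ∀ M : Matrix (Fin n) (Fin n) (RatFunc k),
      (∀ x, M ∈ orderStalk d I x) → ∃ c, M = Matrix.scalar (Fin n) (RatFunc.C c)) :
    IsSymmetricSphericalOrder (scalars k) (dualizingSheaf k) (orderSheaf d I) where
  isOrder := isOrder_order
  constants := scalars_bijective
  spherical := by
    have ht : (.generic : Point k) ∈ (⊤ : Opens (nodalCurve k)) := trivial
    refine ⟨traceHom hI, ?_, fun τ => ?_, nuIsIso_traceHom hI hI', fun U x y => ?_⟩
    · obtain ⟨W, -, hgW, hW⟩ := exists_open_ne_node ht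
      refine ⟨W, (orderSheaf d I).toSec (constSec (Matrix.single 0 0 1) fun x hx =>
        single_mem_orderStalk_of_ne_node ((hW x).1 hx).2 0 0), fun h => ?_⟩
      have := congrArg (dualEval hgW) h
      rw [dualEval_traceHom, modEval_toSec, secEval_constSec, Matrix.trace_single_eq_same, one_mul,
        map_zero] at this
      exact inv_ne_zero RatFunc.X_ne_zero this
    -- Surjectivity of `ν` on global sections writes the second morphism as `x ↦ τ(xy)`; here `y` is
    -- a global section, hence a constant scalar.
    · let φ : LocalHom (orderSheaf d I).toModules (dualizingSheaf k) ⊤ :=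
        { app := fun V _ => Sec.map τ V
          naturality := fun V W _ hW x =>
            PresheafOfModules.naturality_apply τ.val (homOfLE hW).op x }
      obtain ⟨y, hy, -⟩ := nuIsIso_traceHom hI hI' ⊤ φ
      obtain ⟨c, hc⟩ := hM (secEval ht y) fun x => secEval_mem ht trivial y
      refine ⟨c, fun U x => ?_⟩
      have h := hy U le_top (ofSec x)
      by_cases hU : ∃ z, z ∈ U
      · obtain ⟨z, hz⟩ := hU
        change Point k at z
        refine dualEval_injective hz ((congrArg (dualEval hz) h).trans ?_)
        rw [dualEval_smul, dualEval_traceHom, dualEval_traceHom, modEval_toSec, map_mul,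
          secEval_res, fnEval_res, secEval_eq _ ht, hc]
        change (_ * _ : Matrix (Fin n) (Fin n) (RatFunc k)).trace * _ =
          RatFunc.C c * ((secEval hz (ofSec x)).trace * _)
        rw [Matrix.scalar_apply, ← Matrix.smul_eq_mul_diagonal, Matrix.trace_smul, smul_eq_mul,
          mul_assoc]
      · exact (dual_subsingleton (by simpa using hU)).elim _ _
    · by_cases hU : ∃ z, z ∈ U
      · obtain ⟨z, hz⟩ := hU
        change Point k at z
        refine dualEval_injective hz ?_
        rw [dualEval_traceHom, dualEval_traceHom, modEval_toSec, modEval_toSec, map_mul, map_mul,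
          Matrix.trace_mul_comm]
      · exact (dual_subsingleton (by simpa using hU)).elim _ _

end NodalCurve

/-! ### Orbits of a cycle -/

/-- The orbits of two points under a cyclic permutation are not comparable. -/
theorem Equiv.Perm.IsCycleOn.not_forall_pow_lt {α : Type*} [Finite α] {σ : Equiv.Perm α}
    (hσ : σ.IsCycleOn _root_.Set.univ) (ρ : α → ℕ) (i j : α) :
    ¬ ∀ r : ℕ, ρ ((σ ^ r) i) < ρ ((σ ^ r) j) := by
  intro h
  obtain ⟨s, hs⟩ := hσ.exists_pow_eq' (_root_.Set.toFinite _) (_root_.Set.mem_univ i)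
    (_root_.Set.mem_univ j)
  -- As `j = σ^s(i)`, the inequality at the exponent `s * l` compares consecutive terms of the
  -- sequence `σ^(s l)(i)`. So `ρ` would increase strictly forever on a finite set.
  have hmono : StrictMono fun l : ℕ => ρ ((σ ^ (s * l)) i) := by
    refine strictMono_nat_of_lt_succ fun l => ?_
    have := h (s * l)
    rwa [← hs, ← Equiv.Perm.mul_apply, ← pow_add, ← Nat.mul_succ] at this
  have hinj : Function.Injective fun l : ℕ => (σ ^ (s * l)) i := fun a b hab =>
    hmono.injective (congrArg ρ hab)
  exact not_injective_infinite_finite _ hinj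

namespace AssociativeBDData

open NodalCurve

/-! ### The two orders on the indices and the degrees -/

section

variable {n : ℕ}

theorem degrees_le_of_le (m : Fin n) {i j : Fin n} (h : i ≤ j) : degrees m i ≤ degrees m j := by
  simp only [degrees, Fin.lt_def, Fin.le_def] at *
  split_ifs <;> omega

/-- The rank runs through `m, …, n - 1` first and then through `0, …, m - 1`. So the order `S_m` is
the natural one within each degree, and puts degree `1` before degree `0`, contrary to the natural
order. -/
theorem degrees_le_of_rank_le (m : Fin n) {i j : Fin n} (h : rank m i ≤ rank m j) :
    degrees m j ≤ degrees m i := by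
  simp only [degrees, rank, Fin.lt_def] at *
  split_ifs at * <;> omega

theorem rank_lt_iff_of_degrees_eq (m : Fin n) {i j : Fin n} (h : degrees m i = degrees m j) :
    rank m i < rank m j ↔ i < j := by
  simp only [degrees, rank, Fin.lt_def] at *
  split_ifs at * <;> omega

/-- The entries in `𝒪(1)` lie both below the diagonal and above it for `S_m`; triangularity
therefore controls their values at `0` and at `∞` together. -/
theorem lt_of_degrees_lt (m : Fin n) {i j : Fin n} (h : degrees m j < degrees m i) :
    j < i ∧ rank m i < rank m j ∧ degrees m i - degrees m j = 1 := by
  simp only [degrees, rank, Fin.lt_def] at *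
  split_ifs at * <;> omega

theorem lt_of_mem_Pi₁ [NeZero n] (D : AssociativeBDData n)
    (h₁ : ((finRotate n).symm 0, 0) ∉ D.Γ₁) {i j : Fin n} (h : (i, j) ∈ D.Pi₁) : i < j :=
  (rank_zero_lt i j).1 (rank_lt D.proper₁.1 h₁ h)

theorem rank_lt_of_mem_Pi₂ (D : AssociativeBDData n) (m : Fin n)
    (h₂ : ((finRotate n).symm m, m) ∉ D.Γ₂) {i j : Fin n} (h : (i, j) ∈ D.Pi₂) :
    rank m i < rank m j :=
  rank_lt D.proper₂.1 h₂ h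

end

/-! ### The Lagrangian property of the subalgebra -/

variable {n : ℕ} [NeZero n] (D : AssociativeBDData n) {k : Type u} [Field k]
  (h₁ : ((finRotate n).symm 0, 0) ∉ D.Γ₁) (m : Fin n) (h₂ : ((finRotate n).symm m, m) ∉ D.Γ₂)

theorem eq_of_algebraMap_mem {a b : k} (h : (algebraMap k (Matrix (Fin n) (Fin n) k) a,
    algebraMap k (Matrix (Fin n) (Fin n) k) b) ∈ D.isotropicSubalgebra k h₁ m h₂) : a = b := by
  simpa [Matrix.algebraMap_matrix_apply] using (h.2.2 0 0 (.inl rfl)).1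

/-- The two diagonals agree up to the permutation `σ`. Applied to products in the subalgebra, this
says that it is isotropic. -/
theorem trace_eq_of_mem {p : Matrix (Fin n) (Fin n) k × Matrix (Fin n) (Fin n) k}
    (hp : p ∈ D.isotropicSubalgebra k h₁ m h₂) : p.1.trace = p.2.trace := by
  rw [Matrix.trace, Matrix.trace, ← Equiv.sum_comp D.σ p.2.diag]
  exact Finset.sum_congr rfl fun i _ => (hp.2.2 i i (.inl rfl)).1

/-- The subalgebra `I(P₁, P₂, σ)` contains its orthogonal with respect to the difference of the
trace forms. -/
theorem mem_of_forall_trace_mul_eq {q : Matrix (Fin n) (Fin n) k × Matrix (Fin n) (Fin n) k}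
    (hq : ∀ p ∈ D.isotropicSubalgebra k h₁ m h₂, (p.1 * q.1).trace = (p.2 * q.2).trace) :
    q ∈ D.isotropicSubalgebra k h₁ m h₂ := by
  refine ⟨fun i j hji hn => ?_, fun i j hij hn => ?_, (D.leviMatch_iff _ _).2 fun i j hb => ?_⟩
  · have hnb : ¬ Block D.Γ₁ j i := by
      rintro (h | h | h)
      exacts [hji.ne h, hn h, (D.lt_of_mem_Pi₁ h₁ h).not_gt hji]
    -- The position `(j, i)` is above the diagonal and outside the Levi blocks, so this test pair
    -- lies in the nilpotent part of the first parabolic.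
    have := hq (Matrix.single j i 1, 0) ⟨fun i' j' h' _ => ?_, fun _ _ _ _ => rfl,
      (D.leviMatch_iff _ _).2 fun i' j' hb => ?_⟩
    · simpa [Matrix.trace_single_mul] using this
    · refine Matrix.single_apply_of_ne _ _ _ _ _ ?_
      rintro ⟨rfl, rfl⟩
      exact h'.not_gt hji
    · refine Matrix.single_apply_of_ne _ _ _ _ _ ?_
      rintro ⟨rfl, rfl⟩
      exact hnb hb
  · have hr := (mem_cyclicOrder_iff m i j).1 hij
    have hnb : ¬ Block D.Γ₂ j i := by
      rintro (h | h | h)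
      exacts [hr.ne (by rw [h]), (D.rank_lt_of_mem_Pi₂ m h₂ h).not_gt hr, hn h]
    -- The same test in the nilpotent part of the second parabolic.
    have := hq (0, Matrix.single j i 1) ⟨fun _ _ _ _ => rfl, fun i' j' h' _ => ?_,
      (D.leviMatch_iff _ _).2 fun i' j' hb => ?_⟩
    · simpa [Matrix.trace_single_mul] using this.symm
    · refine Matrix.single_apply_of_ne _ _ _ _ _ ?_
      rintro ⟨rfl, rfl⟩
      exact ((mem_cyclicOrder_iff m _ _).1 h').not_gt hr
    · refine (Matrix.single_apply_of_ne _ _ _ _ _ ?_).symm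
      rintro ⟨rfl, rfl⟩
      exact hnb ((D.block_iff _ _).2 hb)
  -- Inside a block, the test pairs are elementary matrices corresponding to each other under `σ`.
  · have := hq (Matrix.single j i 1, Matrix.single (D.σ j) (D.σ i) 1)
      ⟨fun i' j' h' hn => ?_, fun i' j' h' hn => ?_, (D.leviMatch_iff _ _).2 fun i' j' hb => ?_⟩
    · simpa [Matrix.trace_single_mul] using this
    · refine Matrix.single_apply_of_ne _ _ _ _ _ ?_
      rintro ⟨rfl, rfl⟩
      rcases hb with h | h | h
      exacts [h'.ne h, hn h, (D.lt_of_mem_Pi₁ h₁ h).not_gt h']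
    · refine Matrix.single_apply_of_ne _ _ _ _ _ ?_
      rintro ⟨rfl, rfl⟩
      have hr := (mem_cyclicOrder_iff m _ _).1 h'
      rcases (D.block_iff _ _).2 hb with h | h | h
      exacts [hr.ne (by rw [h]), (D.rank_lt_of_mem_Pi₂ m h₂ h).not_gt hr, hn h]
    · simp only [Matrix.single_apply, D.σ.injective.eq_iff]

/-! ### Global sections -/

/-- A pair of matrices in `I(P₁, P₂, σ)` which comes from a global section is triangular. -/
theorem triangular_of_mem {A B : Matrix (Fin n) (Fin n) k}
    (h : (A, B) ∈ D.isotropicSubalgebra k h₁ m h₂)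
    (heq : ∀ i j, degrees m i = degrees m j → A i j = B i j)
    (hlt : ∀ i j, degrees m i < degrees m j → A i j = 0 ∧ B i j = 0) :
    (∀ i j, j < i → A i j = 0) ∧ ∀ i j, rank m i < rank m j → B i j = 0 := by
  obtain ⟨hA, hB, hL⟩ := h
  rw [leviMatch_iff] at hL
  dsimp only at hA hB hL
  constructor
  -- A nonzero entry below the diagonal lies in the Levi part, so it equals the entry of `B` at `(σ
  -- i, σ j)`, where `σ j` precedes `σ i` in `S_m`. The degree of that entry is then at most `0`,
  -- and `hlt` excludes negative degree. In degree `0` the two orders agree and `heq` returns from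
  -- `B` to `A`.
  · have step (i j : Fin n) (h : j < i ∧ A i j ≠ 0) : D.σ j < D.σ i ∧ A (D.σ i) (D.σ j) ≠ 0 := by
      have hP : (j, i) ∈ D.Pi₁ := by
        by_contra hn
        exact h.2 (hA i j h.1 hn)
      have hr := D.rank_lt_of_mem_Pi₂ m h₂ ((D.mem_Pi_iff j i).2 hP)
      have hb : B (D.σ i) (D.σ j) ≠ 0 := by
        rw [← hL i j (.inr (.inr hP))]; exact h.2
      rcases (degrees_le_of_rank_le m hr.le).eq_or_lt with e | e
      · exact ⟨(rank_lt_iff_of_degrees_eq m e.symm).1 hr, by rwa [heq _ _ e]⟩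
      · exact absurd (hlt _ _ e).2 hb
    intro i j hji
    by_contra hne
    refine D.cyclic.not_forall_pow_lt Fin.val j i fun r => ?_
    suffices (D.σ ^ r) j < (D.σ ^ r) i ∧ A ((D.σ ^ r) i) ((D.σ ^ r) j) ≠ 0 from this.1
    induction r with
    | zero => exact ⟨hji, hne⟩
    | succ r ih =>
      rw [pow_succ', Equiv.Perm.mul_apply, Equiv.Perm.mul_apply]
      exact step _ _ ih
  -- The mirror image: from `B` back to `A` along `σ⁻¹`, with the roles of the natural order and
  -- `S_m` exchanged.
  · have step (i j : Fin n) (h : rank m i < rank m j ∧ B i j ≠ 0) :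
        rank m (D.σ⁻¹ i) < rank m (D.σ⁻¹ j) ∧ B (D.σ⁻¹ i) (D.σ⁻¹ j) ≠ 0 := by
      obtain ⟨i, rfl⟩ := D.σ.surjective i
      obtain ⟨j, rfl⟩ := D.σ.surjective j
      have e (i : Fin n) : D.σ⁻¹ (D.σ i) = i := D.σ.symm_apply_apply i
      rw [e, e]
      have hP : (i, j) ∈ D.Pi₁ := by
        by_contra hn
        exact h.2 (hB _ _ ((mem_cyclicOrder_iff m _ _).2 h.1)
          fun h' => hn ((D.mem_Pi_iff i j).1 h'))
      have hr := D.lt_of_mem_Pi₁ h₁ hP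
      have ha : A i j ≠ 0 := by
        rw [hL i j (.inr (.inl hP))]; exact h.2
      rcases (degrees_le_of_le m hr.le).eq_or_lt with e | e
      · exact ⟨(rank_lt_iff_of_degrees_eq m e).2 hr, by rwa [← heq _ _ e]⟩
      · exact absurd (hlt _ _ e).1 ha
    intro i j hij
    by_contra hne
    refine D.cyclic.inv.not_forall_pow_lt (rank m) i j fun r => ?_
    suffices rank m ((D.σ⁻¹ ^ r) i) < rank m ((D.σ⁻¹ ^ r) j) ∧
      B ((D.σ⁻¹ ^ r) i) ((D.σ⁻¹ ^ r) j) ≠ 0 from this.1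
    induction r with
    | zero => exact ⟨hij, hne⟩
    | succ r ih =>
      rw [pow_succ', Equiv.Perm.mul_apply, Equiv.Perm.mul_apply]
      exact step _ _ ih

/-- The degrees of the entries are `-1`, `0` or `1`. Degree `-1` gives zero and degree `0` gives
constants, which feeds `triangular_of_mem`; the resulting triangularity at `0` and `∞` kills the
remaining off-diagonal entries. -/
theorem exists_eq_scalar_of_forall_mem [IsAlgClosed k] (M : Matrix (Fin n) (Fin n) (RatFunc k))
    (hM : ∀ x, M ∈ orderStalk (degrees m) (D.isotropicSubalgebra k h₁ m h₂) x) :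
    ∃ c, M = Matrix.scalar (Fin n) (RatFunc.C c) := by
  have hsec := isSectionAt_of_forall_mem hM
  have hI := (hM .node).2 rfl
  have hconst (i j : Fin n) (h : degrees m i = degrees m j) :
      M i j = RatFunc.C (val0 (M i j)) ∧ valInfty (degrees m i - degrees m j) (M i j) =
        val0 (M i j) := by
    have hs := hsec i j
    rw [h, sub_self] at hs ⊢
    obtain ⟨c, hc⟩ := exists_eq_C_of_isSectionAt_zero hs
    rw [hc, val0_C, valInfty_C]
    exact ⟨rfl, rfl⟩
  have hzero (i j : Fin n) (h : degrees m i < degrees m j) : M i j = 0 :=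
    eq_zero_of_isSectionAt_of_neg (by omega) (hsec i j)
  obtain ⟨hA, hB⟩ := D.triangular_of_mem h₁ m h₂ hI (fun i j h => (hconst i j h).2.symm)
    fun i j h => by
      simp [matVal0, matValInfty, hzero i j h, val0_zero, valInfty_zero]
  -- The Levi condition equates the value at `0` in position `i` with the value at `∞` in position
  -- `σ i`; diagonal entries are constant, so the latter is also the value at `0`. Transitivity of
  -- `σ` then makes the diagonal constant.
  have hdiag (i : Fin n) : val0 (M (D.σ i) (D.σ i)) = val0 (M i i) := by
    have := (hI.2.2 i i (.inl rfl)).1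
    exact (hconst (D.σ i) (D.σ i) rfl).2.symm.trans this.symm
  have hdiag' (i : Fin n) : val0 (M i i) = val0 (M 0 0) := by
    obtain ⟨s, rfl⟩ := D.cyclic.exists_pow_eq' (Set.toFinite _) (Set.mem_univ 0) (Set.mem_univ i)
    induction s with
    | zero => rfl
    | succ s ih => rw [pow_succ', Equiv.Perm.mul_apply, hdiag, ih]
  refine ⟨val0 (M 0 0), Matrix.ext fun i j => ?_⟩
  by_cases hij : i = j
  · subst hij
    rw [(hconst i i rfl).1, hdiag' i]
    simp
  · rw [Matrix.scalar_apply, Matrix.diagonal_apply_ne _ hij]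
    rcases lt_trichotomy (degrees m i) (degrees m j) with h | h | h
    · exact hzero i j h
    · obtain ⟨hc, hv⟩ := hconst i j h
      suffices val0 (M i j) = 0 by rw [hc, this, map_zero]
      rcases lt_or_gt_of_ne hij with h' | h'
      · rw [← hv]; exact hB i j ((rank_lt_iff_of_degrees_eq m h).2 h')
      · exact hA i j h'
    -- A section of `𝒪(1)` has two coefficients, and these are its values at `0` and `∞`; both
    -- vanish by triangularity.
    · obtain ⟨h1, h2, h3⟩ := lt_of_degrees_lt m h
      have hs := hsec i j
      have hb : valInfty (degrees m i - degrees m j) (M i j) = 0 := hB i j h2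
      rw [h3] at hs hb
      exact eq_zero_of_isSectionAt_one hs (hA i j h1) hb

end AssociativeBDData

theorem lemma1p7 {k : Type u} [Field k] [IsAlgClosed k] [CharZero k] {n : ℕ} [NeZero n]
    (D : AssociativeBDData n) (h₁ : ((finRotate n).symm 0, 0) ∉ D.Γ₁)
    (m : Fin n) (h₂ : ((finRotate n).symm m, m) ∉ D.Γ₂) :
    (D.order k h₁ m h₂).h0 (NodalCurve.scalars k) = 1 ∧
    SphericalOrder.IsSymmetricSphericalOrder (NodalCurve.scalars k) (NodalCurve.dualizingSheaf k)
      (D.order k h₁ m h₂) ∧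
    SphericalOrder.CenterIsStructureSheaf (D.order k h₁ m h₂) :=
  ⟨NodalCurve.h0_order (D.exists_eq_scalar_of_forall_mem h₁ m h₂),
    NodalCurve.isSymmetricSphericalOrder_order (fun _ => D.trace_eq_of_mem h₁ m h₂)
      (fun _ => D.mem_of_forall_trace_mul_eq h₁ m h₂) (D.exists_eq_scalar_of_forall_mem h₁ m h₂),
    NodalCurve.centerIsStructureSheaf_order fun _ _ => D.eq_of_algebraMap_mem h₁ m h₂⟩
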